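/- **Setting.** Let $d\ge 2$, $T_0>0$. For $0\le t\le T_0$ let $\Omega(t)\subset\mathbb R^d$ be a bounded open set, containing two disjoint open subsets $\Omega_1(t),\Omega_2(t)$; put $\Gamma(t)=\Omega(t)\setminus(\Omega_1(t)\cup\Omega_2(t))$ and assume $\Gamma(t)\subset\overline{\Omega_1(t)}\cap\overline{\Omega_2(t)}$. Each of the three families $V(t)=\Omega(t),\Omega_1(t),\Omega_2(t)$ is a *moving Lipschitz domain* on $[0,T_0]$: the set $\{(t,x):0\le t\le T_0,\ x\in V(t)\}$ is bounded and relatively open in $[0,T_0]\times\mathbb R^d$, and near each point of its relative boundary in $[0,T_0]\times\mathbb R^d$ there is an orthonormal coordinate system of $\mathbb R^d$ (independent of $t$) in which $V(t)=\{x_d>\varphi(t,x')\}$ with $\varphi$ Lipschitz in $(t,x')$. (A fixed interface is the special case of families independent of $t$.) Let $\beta_1,\beta_2>0$ be constants, and let $n$ be the unit normal on $\Gamma(t)$ pointing out of $\Omega_1(t)$, which exists at almost every point of $\Gamma(t)$. For $0<T\le T_0$ and data $f,g_1,g_2,g_0,g_D$, a classical solution of the parabolic interface problem on $[0,T]$ is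 a pair $u=(u_1,u_2)$ of functions with $u_i\in C^2$ on $\{(t,x):0\le t\le T,\ x\in\overline{\Omega_i(t)}\}$ and $$\partial_t u_i-\nabla\cdot(\beta_i\nabla u_i)=f \text{ in }\Omega_i(t),\ 0<t\le T,\qquad u_i(0,\cdot)=g_0\text{ in }\Omega_i(0),\qquad u_i=g_D\text{ on }\partial\Omega_i(t)\setminus\Gamma(t),$$ $$u_1-u_2=g_1,\qquad \beta_1\nabla u_1\cdot n-\beta_2\nabla u_2\cdot n=g_2\quad\text{on }\Gamma(t)$$ (the last one wherever $n$ exists). For a pair $v=(v_1,v_2)$ of functions of the same $C^2$ regularity (for instance, but not necessarily, neural networks) define the residuals $$\mathcal L_i=\partial_t v_i-\nabla\cdot(\beta_i\nabla v_i)-f,\quad \mathcal B_i=v_i-g_D,\quad \mathcal T_i=v_i(0,\cdot)-g_0,\quad \mathcal I_1=v_1-v_2-g_1,\quad \mathcal I_2=\beta_1\nabla v_1\cdot n-\beta_2\nabla v_2\cdot n-g_2 .$$ Given $M_i,M_{\mathcal B_i},M_\Gamma,M_{\mathcal T_i}$ sample points in, respectively, $\{x\in\Omega_i(t)\}$, $\{x\in\partial\Omega_i(t)\setminus\Gamma(t)\}$,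 $\{x\in\Gamma(t),\ n \text{ exists}\}$ (space-time points with $0\le t\le T$) and $\Omega_i(0)$, the losses $\mathcal F_{\mathcal L_i},\mathcal F_{\mathcal B_i},\mathcal F_\Gamma,\mathcal F_{\mathcal T_i}$ are the arithmetic means over these points of $|\mathcal L_i|^2$, $|\mathcal B_i|^2$, $|\mathcal I_1|^2+|\mathcal I_2|^2$, $|\mathcal T_i|^2$. *Quadrature assumption.* For each of these integrands $g$, with its set $D$ of integration (space-time for the first three, with $ds\,dt$ on boundary and interface), its number $M$ of points $y_k$, and constants $C_{quad}$ and $\alpha>0$ belonging to it, the equal-weight rule satisfies $\bigl|\int_D g-\frac{|D|}{M}\sum_{k} g(y_k)\bigr|\le C_{quad}M^{-\alpha}$. (If $M=0$, the sum, the loss and the right-hand side are read as $0$.) **Theorem.** For every $K\ge 0$ there are constants $C_1,C_2>0$, depending only on $K$, $\beta_1,\beta_2$ and the families $\Omega(t),\Omega_1(t),\Omega_2(t)$, $0\le t\le T_0$, such that the following holds for all $0<T\le T_0$, all data, every classical solution $u$ on $[0,T]$, and every pair $v$ as above, if the $C^2$ norms of $u_i$ and $v_i$ on $\{(t,x):0\le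 t\le T,\,x\in\overline{\Omega_i(t)}\}$, $i=1,2$, are at most $K$. Let $e_i=u_i-v_i$. (a) (Stability, with exponent $1/2$ for the interior, boundary and interface residuals and $1$ for the initial residual) $$\int_0^T\sum_{i=1}^2\int_{\Omega_i(t)}|e_i|^2\,dx\,dt\le C_1T(1+C_2Te^{C_2T})\sum_{i=1}^2\int_{\Omega_i(0)}|\mathcal T_i|^2dx$$ $$+C_1T^{1/2}(1+C_2Te^{C_2T})\Bigl[\int_0^T\Bigl(\sum_{i=1}^2\int_{\Omega_i(t)}|\mathcal L_i|^2dx+\sum_{i=1}^2\int_{\partial\Omega_i(t)\setminus\Gamma(t)}|\mathcal B_i|^2ds+\int_{\Gamma(t)}(|\mathcal I_1|^2+|\mathcal I_2|^2)ds\Bigr)dt\Bigr]^{1/2}.$$ (b) For all sample points and all quadrature constants and rates for which the quadrature assumption holds, $$\int_0^T\sum_{i=1}^2\int_{\Omega_i(t)}|e_i|^2\,dx\,dt\le C_1T(1+C_2Te^{C_2T})\Bigl[\sum_{i=1}^2\mathcal F_{\mathcal T_i}+\sum_{i=1}^2C_{quad}^{\mathcal T_i}M_{\mathcal T_i}^{-\alpha_{\mathcal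 T_i}}\Bigr]$$ $$+C_1T^{1/2}(1+C_2Te^{C_2T})\Bigl[\sum_{i=1}^2\mathcal F_{\mathcal L_i}+\sum_{i=1}^2\mathcal F_{\mathcal B_i}+\mathcal F_\Gamma+\sum_{i=1}^2C_{quad}^{\mathcal L_i}M_i^{-\alpha_{\mathcal L_i}}+\sum_{i=1}^2C_{quad}^{\mathcal B_i}M_{\mathcal B_i}^{-\alpha_{\mathcal B_i}}+C_{quad}^{\Gamma}M_\Gamma^{-\alpha_\Gamma}\Bigr]^{1/2}.$$ -/

import Mathlib

open Set Filter Topology MeasureTheory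
open scoped NNReal ENNReal InnerProductSpace

noncomputable section

namespace ParabolicInterface

/-- The space `ℝ^d` with its Euclidean norm. Space-time points are pairs `(t, x)`. -/
abbrev Space (d : ℕ) : Type := EuclideanSpace ℝ (Fin d)

variable {d : ℕ}

/-! ### Moving domains -/

/-- The space-time set `{(t, x) : 0 ≤ t ≤ T, x ∈ U(t)}`. -/
def tube (T : ℝ) (U : ℝ → Set (Space d)) : Set (ℝ × Space d) :=
  {p | p.1 ∈ Icc 0 T ∧ p.2 ∈ U p.1}

/-- The space-time set `{(t, x) : 0 ≤ t ≤ T, x ∈ closure U(t)}`. -/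
def closedTube (T : ℝ) (U : ℝ → Set (Space d)) : Set (ℝ × Space d) :=
  tube T fun t => closure (U t)

/-- A moving bounded Lipschitz domain on the time interval `[0, T]`: its space-time tube is bounded
and relatively open in `[0, T] × ℝ^d`, and near each of its space-time boundary points the set
`U(t)` is, for some unit vector `e`, the region above the graph (in direction `e`) of a function `φ`
that is Lipschitz in time and in the components orthogonal to `e`.
For a family that does not depend on time this says that `U` is a bounded Lipschitz domain. -/
structure IsLipschitzTube (T : ℝ) (U : ℝ → Set (Space d)) : Prop where
  isBounded : Bornology.IsBounded (tube T U)
  isOpen : ∀ p ∈ tube T U, ∀ᶠ q in 𝓝 p, q.1 ∈ Icc 0 T → q ∈ tube T U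
  chart : ∀ p ∈ closure (tube T U) \ tube T U,
    ∃ (e : Space d) (φ : ℝ × Space d → ℝ) (L : ℝ≥0),
      ‖e‖ = 1 ∧ LipschitzWith L φ ∧
      ∀ᶠ q in 𝓝 p, q.1 ∈ Icc 0 T →
        (q.2 ∈ U q.1 ↔ φ (q.1, q.2 - ⟪e, q.2⟫_ℝ • e) < ⟪e, q.2⟫_ℝ)

/-- The interface `Γ(t)`: what the two subdomains leave of `Ω(t)`. -/
def interface (Ω : ℝ → Set (Space d)) (U : Fin 2 → ℝ → Set (Space d)) (t : ℝ) : Set (Space d) :=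
  Ω t \ (U 0 t ∪ U 1 t)

/-- The outer part `∂Ω_i(t) \ Γ(t)` of the boundary of the `i`-th subdomain. -/
def outerBoundary (Ω : ℝ → Set (Space d)) (U : Fin 2 → ℝ → Set (Space d)) (i : Fin 2) (t : ℝ) :
    Set (Space d) :=
  frontier (U i t) \ interface Ω U t

/-- The (possibly moving) Lipschitz domain `Ω(t)` is partitioned by the interface `Γ(t)` into two
disjoint Lipschitz subdomains. Both the immersed and the back-to-back configuration are covered. -/
structure IsMovingPartition (T : ℝ) (Ω : ℝ → Set (Space d)) (U : Fin 2 → ℝ → Set (Space d)) :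
    Prop where
  domain : IsLipschitzTube T Ω
  subdomain : ∀ i, IsLipschitzTube T (U i)
  subset : ∀ i, ∀ t ∈ Icc 0 T, U i t ⊆ Ω t
  disjoint : ∀ t ∈ Icc 0 T, Disjoint (U 0 t) (U 1 t)
  interface_subset : ∀ i, ∀ t ∈ Icc 0 T, interface Ω U t ⊆ closure (U i t)

/-! ### The unit normal -/

/-- `n` is the outward unit normal of `S` at the boundary point `x`: to first order at `x`, the set
`S` is the half-space `{y | ⟪y - x, n⟫ < 0}`. It is unique if it exists, and it exists at almost
every boundary point of a Lipschitz domain. -/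
def IsOuterNormal (S : Set (Space d)) (x n : Space d) : Prop :=
  ‖n‖ = 1 ∧ ∀ ε > 0, ∀ᶠ y in 𝓝 x,
    (y ∈ S → ⟪y - x, n⟫_ℝ ≤ ε * ‖y - x‖) ∧ (y ∉ S → -(ε * ‖y - x‖) ≤ ⟪y - x, n⟫_ℝ)

open Classical in
/-- The outward unit normal of `S` at `x` (and `0` at the exceptional points where none exists). -/
def outerNormal (S : Set (Space d)) (x : Space d) : Space d :=
  if h : ∃ n, IsOuterNormal S x n then h.choose else 0

/-! ### Derivatives of functions that are `C^2` up to the boundary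

`Q` is a closed space-time tube; in its interior the derivatives within `Q` are the usual ones. -/

/-- The time derivative `∂_t w`. -/
def timeDeriv (Q : Set (ℝ × Space d)) (w : ℝ × Space d → ℝ) (p : ℝ × Space d) : ℝ :=
  fderivWithin ℝ w Q p (1, 0)

/-- The spatial gradient `∇w`. -/
def spaceGrad (Q : Set (ℝ × Space d)) (w : ℝ × Space d → ℝ) (p : ℝ × Space d) : Space d :=
  WithLp.toLp 2 fun j => fderivWithin ℝ w Q p (0, EuclideanSpace.single j 1)

/-- The spatial Laplacian `Δw`, the sum of the pure second order spatial partial derivatives. -/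
def spaceLaplacian (Q : Set (ℝ × Space d)) (w : ℝ × Space d → ℝ) (p : ℝ × Space d) : ℝ :=
  ∑ j : Fin d, iteratedFDerivWithin ℝ 2 w Q p fun _ => (0, EuclideanSpace.single j 1)

/-- The `C^2` norm on `Q`: the supremum over `Q` of all derivatives of order at most two. -/
def c2Norm (Q : Set (ℝ × Space d)) (w : ℝ × Space d → ℝ) : ℝ≥0∞ :=
  ⨆ (k : ℕ) (_ : k ≤ 2) (p : ℝ × Space d) (_ : p ∈ Q), ‖iteratedFDerivWithin ℝ k w Q p‖ₑ

/-! ### The parabolic interface problem -/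

/-- The data of the problem: source `f`, interface jumps `g₁` and `g₂`, initial value `g₀` and
boundary value `gD`. -/
structure ProblemData (d : ℕ) where
  f : ℝ × Space d → ℝ
  g₁ : ℝ × Space d → ℝ
  g₂ : ℝ × Space d → ℝ
  g₀ : Space d → ℝ
  gD : ℝ × Space d → ℝ

/-- `∂_t w_i - ∇ · (β_i ∇ w_i) - f`; the coefficient `β_i` is constant. -/
def interiorResidual (T : ℝ) (U : Fin 2 → ℝ → Set (Space d)) (β : Fin 2 → ℝ) (D : ProblemData d)
    (w : Fin 2 → ℝ × Space d → ℝ) (i : Fin 2) (p : ℝ × Space d) : ℝ :=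
  timeDeriv (closedTube T (U i)) (w i) p - β i * spaceLaplacian (closedTube T (U i)) (w i) p - D.f p

/-- `w_i - g_D`. -/
def boundaryResidual (D : ProblemData d) (w : Fin 2 → ℝ × Space d → ℝ) (i : Fin 2)
    (p : ℝ × Space d) : ℝ :=
  w i p - D.gD p

/-- `w_i(0, ·) - g_0`. -/
def initialResidual (D : ProblemData d) (w : Fin 2 → ℝ × Space d → ℝ) (i : Fin 2)
    (x : Space d) : ℝ :=
  w i (0, x) - D.g₀ x

/-- `⟦w⟧ - g_1`. -/
def jumpResidual (D : ProblemData d) (w : Fin 2 → ℝ × Space d → ℝ) (p : ℝ × Space d) : ℝ :=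
  w 0 p - w 1 p - D.g₁ p

/-- `⟦β ∇w · n⟧` for a given vector `n`. -/
def fluxJump (T : ℝ) (U : Fin 2 → ℝ → Set (Space d)) (β : Fin 2 → ℝ)
    (w : Fin 2 → ℝ × Space d → ℝ) (n : Space d) (p : ℝ × Space d) : ℝ :=
  β 0 * ⟪spaceGrad (closedTube T (U 0)) (w 0) p, n⟫_ℝ -
    β 1 * ⟪spaceGrad (closedTube T (U 1)) (w 1) p, n⟫_ℝ

/-- `⟦β ∇w · n⟧ - g_2` with the unit normal `n` pointing out of the first subdomain. -/
def fluxResidual (T : ℝ) (U : Fin 2 → ℝ → Set (Space d)) (β : Fin 2 → ℝ) (D : ProblemData d)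
    (w : Fin 2 → ℝ × Space d → ℝ) (p : ℝ × Space d) : ℝ :=
  fluxJump T U β w (outerNormal (U 0 p.1) p.2) p - D.g₂ p

/-- `w_i` is twice continuously differentiable on the closed space-time tubes, `i = 1, 2`. -/
def IsC2 (T : ℝ) (U : Fin 2 → ℝ → Set (Space d)) (w : Fin 2 → ℝ × Space d → ℝ) : Prop :=
  ∀ i, ContDiffOn ℝ 2 (w i) (closedTube T (U i))

/-- The pair `u` is a classical solution of the parabolic interface problem on `[0, T]`. The flux
condition is imposed at the interface points that have a unit normal. -/
structure IsClassicalSolution (T : ℝ) (Ω : ℝ → Set (Space d)) (U : Fin 2 → ℝ → Set (Space d))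
    (β : Fin 2 → ℝ) (D : ProblemData d) (u : Fin 2 → ℝ × Space d → ℝ) : Prop where
  isC2 : IsC2 T U u
  equation : ∀ i, ∀ t ∈ Ioc 0 T, ∀ x ∈ U i t, interiorResidual T U β D u i (t, x) = 0
  jump : ∀ t ∈ Icc 0 T, ∀ x ∈ interface Ω U t, jumpResidual D u (t, x) = 0
  flux : ∀ t ∈ Icc 0 T, ∀ x ∈ interface Ω U t, ∀ n, IsOuterNormal (U 0 t) x n →
    fluxJump T U β u n (t, x) = D.g₂ (t, x)
  initial : ∀ i, ∀ x ∈ U i 0, initialResidual D u i x = 0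
  boundary : ∀ i, ∀ t ∈ Icc 0 T, ∀ x ∈ outerBoundary Ω U i t, boundaryResidual D u i (t, x) = 0

/-! ### Integrals and losses -/

/-- The space-time integral `∫_0^T ∫_{S(t)} g dm dt` of a nonnegative function `g`. -/
def stIntegral (T : ℝ) (m : Measure (Space d)) (S : ℝ → Set (Space d)) (g : ℝ × Space d → ℝ) :
    ℝ≥0∞ :=
  ∫⁻ t in Icc 0 T, ∫⁻ x in S t, ENNReal.ofReal (g (t, x)) ∂m

/-- The surface measure: Hausdorff measure of dimension `d - 1`, in its Euclidean normalization. -/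
def surface (d : ℕ) : Measure (Space d) := μHE[d - 1]

/-- The mean `(1/M) ∑ g(x_k)` over `M` sample points (equal to `0` if there are none). -/
def sampleMean {X : Type*} {M : ℕ} (y : Fin M → X) (g : X → ℝ) : ℝ :=
  1 / (M : ℝ) * ∑ k, g (y k)

/-- The error of the equal weight quadrature rule `I_M(g) = ∑ (|D|/M) g(x_k)` for an integral `I`
over a set `D` is at most `C M ^ (-α)`, with `α > 0`. Here `V = |D|` and `F` is the mean of `g` over
the sample points. -/
def HasQuadratureError (I V F : ℝ) (M : ℕ) (C α : ℝ) : Prop :=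
  0 < α ∧ |I - V * F| ≤ C * (M : ℝ) ^ (-α)

/-- `∫_0^T ∫_{Ω_i(t)} |interior residual|^2 dx dt`. -/
def interiorIntegral (T : ℝ) (U : Fin 2 → ℝ → Set (Space d)) (β : Fin 2 → ℝ) (D : ProblemData d)
    (w : Fin 2 → ℝ × Space d → ℝ) (i : Fin 2) : ℝ :=
  (stIntegral T volume (U i) fun p => interiorResidual T U β D w i p ^ 2).toReal

/-- `∫_0^T ∫_{∂Ω_i(t) \ Γ(t)} |boundary residual|^2 ds dt`. -/
def boundaryIntegral (T : ℝ) (Ω : ℝ → Set (Space d)) (U : Fin 2 → ℝ → Set (Space d))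
    (D : ProblemData d) (w : Fin 2 → ℝ × Space d → ℝ) (i : Fin 2) : ℝ :=
  (stIntegral T (surface d) (outerBoundary Ω U i) fun p => boundaryResidual D w i p ^ 2).toReal

/-- `∫_0^T ∫_{Γ(t)} (|jump residual|^2 + |flux residual|^2) ds dt`. -/
def interfaceIntegral (T : ℝ) (Ω : ℝ → Set (Space d)) (U : Fin 2 → ℝ → Set (Space d))
    (β : Fin 2 → ℝ) (D : ProblemData d) (w : Fin 2 → ℝ × Space d → ℝ) : ℝ :=
  (stIntegral T (surface d) (interface Ω U) fun p =>
    jumpResidual D w p ^ 2 + fluxResidual T U β D w p ^ 2).toReal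

/-- `∫_{Ω_i(0)} |initial residual|^2 dx`. -/
def initialIntegral (U : Fin 2 → ℝ → Set (Space d)) (D : ProblemData d)
    (w : Fin 2 → ℝ × Space d → ℝ) (i : Fin 2) : ℝ :=
  (∫⁻ x in U i 0, ENNReal.ofReal (initialResidual D w i x ^ 2)).toReal

/-- A choice of interior, boundary, interface and initial sample points, with the numbers
`M_i`, `M_{B_i}`, `M_Γ` and `M_{T_i}` of these points. A number may be `0`, as it has to be for an
empty boundary part. Interface points are taken where the unit normal exists. -/
structure Sampling (T : ℝ) (Ω : ℝ → Set (Space d)) (U : Fin 2 → ℝ → Set (Space d)) where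
  M : Fin 2 → ℕ
  MB : Fin 2 → ℕ
  MΓ : ℕ
  MT : Fin 2 → ℕ
  x : ∀ i, Fin (M i) → ℝ × Space d
  xB : ∀ i, Fin (MB i) → ℝ × Space d
  xΓ : Fin MΓ → ℝ × Space d
  xT : ∀ i, Fin (MT i) → Space d
  x_mem : ∀ i k, x i k ∈ tube T (U i)
  xB_mem : ∀ i k, xB i k ∈ tube T (outerBoundary Ω U i)
  xΓ_mem : ∀ k, xΓ k ∈ tube T (interface Ω U)
  xΓ_normal : ∀ k, ∃ n, IsOuterNormal (U 0 (xΓ k).1) (xΓ k).2 n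
  xT_mem : ∀ i k, xT i k ∈ U i 0

variable {T : ℝ} {Ω : ℝ → Set (Space d)} {U : Fin 2 → ℝ → Set (Space d)}

/-- The interior loss `(1/M_i) ∑ |∂_t w_i - ∇ · (β_i ∇ w_i) - f|^2 (t_k, x_k)`. -/
def interiorLoss (s : Sampling T Ω U) (β : Fin 2 → ℝ) (D : ProblemData d)
    (w : Fin 2 → ℝ × Space d → ℝ) (i : Fin 2) : ℝ :=
  sampleMean (s.x i) fun p => interiorResidual T U β D w i p ^ 2

/-- The boundary loss `(1/M_{B_i}) ∑ |w_i - g_D|^2 (t_k, x_k)`. -/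
def boundaryLoss (s : Sampling T Ω U) (D : ProblemData d) (w : Fin 2 → ℝ × Space d → ℝ)
    (i : Fin 2) : ℝ :=
  sampleMean (s.xB i) fun p => boundaryResidual D w i p ^ 2

/-- The interface loss `(1/M_Γ) ∑ (|⟦w⟧ - g_1|^2 + |⟦β ∇w · n⟧ - g_2|^2) (t_k, x_k)`. -/
def interfaceLoss (s : Sampling T Ω U) (β : Fin 2 → ℝ) (D : ProblemData d)
    (w : Fin 2 → ℝ × Space d → ℝ) : ℝ :=
  sampleMean s.xΓ fun p => jumpResidual D w p ^ 2 + fluxResidual T U β D w p ^ 2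

/-- The initial loss `(1/M_{T_i}) ∑ |w_i(0, x_k) - g_0(x_k)|^2`. -/
def initialLoss (s : Sampling T Ω U) (D : ProblemData d) (w : Fin 2 → ℝ × Space d → ℝ)
    (i : Fin 2) : ℝ :=
  sampleMean (s.xT i) fun x => initialResidual D w i x ^ 2

/-- Constants and rates of the quadrature error estimates. -/
structure QuadratureRates where
  C : Fin 2 → ℝ
  CB : Fin 2 → ℝ
  CΓ : ℝ
  CT : Fin 2 → ℝ
  α : Fin 2 → ℝ
  αB : Fin 2 → ℝ
  αΓ : ℝ
  αT : Fin 2 → ℝ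

/-- The squared residuals of `w` are integrated by the equal weight rules on the sample points `s`
with the errors given by `q`. -/
structure QuadratureAssumption (s : Sampling T Ω U) (β : Fin 2 → ℝ) (D : ProblemData d)
    (w : Fin 2 → ℝ × Space d → ℝ) (q : QuadratureRates) : Prop where
  interior : ∀ i, HasQuadratureError (interiorIntegral T U β D w i)
    (stIntegral T volume (U i) fun _ => 1).toReal (interiorLoss s β D w i) (s.M i) (q.C i) (q.α i)
  boundary : ∀ i, HasQuadratureError (boundaryIntegral T Ω U D w i)
    (stIntegral T (surface d) (outerBoundary Ω U i) fun _ => 1).toReal (boundaryLoss s D w i)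
    (s.MB i) (q.CB i) (q.αB i)
  onInterface : HasQuadratureError (interfaceIntegral T Ω U β D w)
    (stIntegral T (surface d) (interface Ω U) fun _ => 1).toReal (interfaceLoss s β D w)
    s.MΓ q.CΓ q.αΓ
  initial : ∀ i, HasQuadratureError (initialIntegral U D w i)
    (volume (U i 0)).toReal (initialLoss s D w i) (s.MT i) (q.CT i) (q.αT i)

end ParabolicInterface

end

open Set Filter Topology MeasureTheory
open scoped NNReal ENNReal InnerProductSpace

noncomputable section

namespace ParabolicInterface

variable {d : ℕ}

/-! Let `e_i = u_i - v_i`, so that `∂_t e_i - β_i Δ e_i` is minus the interior residual. Put `ω = T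
- t` and integrate the space-time divergence of `ω (e_i², -2 β_i e_i ∇e_i)` over both phases. Since
`-ω' = 1` and `ω(T) = 0`, this bounds `∫∫ e²` by `T ∫ e(0)²`, plus `∫∫ 2 ω |e| |residual|`, plus the
energy flux through the outer boundary, plus the jump of the energy flux across the interface. The
term `-2 β_i ω |∇e_i|²` has the good sign and is dropped. The motion of the domains only appears as
the time component of the space-time conormal.

No Gronwall argument is needed. The errors and their gradients are bounded by `2K`, so every term
except the initial one is at most a constant times `T ∫ |r|` with `r` a residual. Then `|r| ≤ l +
r²/l`, the uniform bound on volumes and areas of slices, and the choice `l = √(R/T)` produce `√T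
√R`, where `R` is the sum of the residual integrals; this is the exponent `1/2`. The initial term
stays quadratic, which is the exponent `1`. The factor `1 + C₂ T exp (C₂ T)` enters only through
being at least `1`.

The boundaries are merely Lipschitz and move, so the divergence theorem is obtained by cut-offs. For
a Lipschitz test function with compact support in one phase the energy identity has no boundary term
(`Phase.integral_weakIntegrand_eq_zero`). At the interface the two fluxes have to be compared
exactly: a partition of unity reduces to one graph, a ramp of width `ε` is inserted on each side,
and the layers converge to traces on the same graph with opposite signs
(`Phase.integral_weakIntegrand_eq_trace`). Their difference is a combination of the two interface
residuals (`Comparison.abs_flux_sub_flux_le`).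

At the outer boundary and at the initial time upper bounds suffice. The cut-off by the distance to
the exterior has slope `1/ε` on a strip where the flux is at most a constant times `|e|`, and
reverse Fatou in graph coordinates leaves an integral of `|e|` over the outer boundary
(`Comparison.limsup_lintegral_stripLayer_le`); the initial layer gives the initial energy
(`Comparison.limsup_timeLayer_le`). The area formula is replaced by the fact that projecting a graph
to its base does not increase Hausdorff measure. Part (b) follows by bounding each residual integral
through its quadrature rule. -/

lemma _root_.LipschitzWith.euclideanHausdorffMeasure_image_le {X Y : Type*} [MetricSpace X]
    [MeasurableSpace X] [BorelSpace X] [MetricSpace Y] [MeasurableSpace Y] [BorelSpace Y]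
    {f : X → Y} {K : ℝ≥0} (hf : LipschitzWith K f) (n : ℕ) (s : Set X) :
    (μHE[n] : Measure Y) (f '' s) ≤ (K : ℝ≥0∞) ^ n * (μHE[n] : Measure X) s := by
  simp only [Measure.euclideanHausdorffMeasure_def, Measure.smul_apply]
  have h := hf.hausdorffMeasure_image_le (d := n) n.cast_nonneg s
  rw [ENNReal.rpow_natCast] at h
  rw [ENNReal.smul_def, ENNReal.smul_def, smul_eq_mul, smul_eq_mul, mul_left_comm]
  gcongr

/-! ### Moving Lipschitz graphs: coordinates, volume and area -/

/-- The parameter space of the graph of a function over a hyperplane of `ℝ^d`. -/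
abbrev Base (d : ℕ) : Type := EuclideanSpace ℝ (Fin (d - 1))

/-- An orthonormal splitting of `ℝ^d` together with a Lipschitz function of time and of the first
component; it describes the moving graph of that function. -/
structure GraphChart (d : ℕ) where
  frame : WithLp 2 (Base d × ℝ) ≃ₗᵢ[ℝ] Space d
  profile : ℝ × Base d → ℝ
  lip : ℝ≥0
  lipschitz : LipschitzWith lip profile

namespace GraphChart

variable (c : GraphChart d)

/-- The component along the hyperplane. -/
def base (x : Space d) : Base d := (c.frame.symm x).fst

/-- The component across the hyperplane. -/
def level (x : Space d) : ℝ := (c.frame.symm x).snd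

/-- The signed distance to the graph in the direction across the hyperplane. -/
def height (q : ℝ × Space d) : ℝ := c.level q.2 - c.profile (q.1, c.base q.2)

/-- The parametrization of space-time by the graph and the height, measured in units of `ε`. -/
def param (ε : ℝ) (y : (ℝ × Base d) × ℝ) : ℝ × Space d :=
  (y.1.1, c.frame (WithLp.toLp 2 (y.1.2, c.profile y.1 + ε * y.2)))

/-- The point of the graph over a given parameter. -/
def graphPoint (t : ℝ) (x : Base d) : Space d :=
  c.frame (WithLp.toLp 2 (x, c.profile (t, x)))

@[simp] lemma base_frame (y : WithLp 2 (Base d × ℝ)) : c.base (c.frame y) = y.fst := by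
  simp [base]

@[simp] lemma level_frame (y : WithLp 2 (Base d × ℝ)) : c.level (c.frame y) = y.snd := by
  simp [level]

@[simp] lemma height_param (ε : ℝ) (y : (ℝ × Base d) × ℝ) : c.height (c.param ε y) = ε * y.2 := by
  simp [height, param]

lemma param_zero (y : (ℝ × Base d) × ℝ) : c.param 0 y = (y.1.1, c.graphPoint y.1.1 y.1.2) := by
  simp [param, graphPoint]

lemma lipschitzWith_base : LipschitzWith 1 c.base := by
  refine LipschitzWith.of_dist_le_mul fun x y => ?_
  rw [NNReal.coe_one, one_mul, ← c.frame.symm.dist_map x y, WithLp.prod_dist_eq_of_L2]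
  refine Real.le_sqrt_of_sq_le ?_
  simp only [base]
  nlinarith [sq_nonneg (dist (c.frame.symm x).snd (c.frame.symm y).snd)]

lemma lipschitzWith_level : LipschitzWith 1 c.level := by
  refine LipschitzWith.of_dist_le_mul fun x y => ?_
  rw [NNReal.coe_one, one_mul, ← c.frame.symm.dist_map x y, WithLp.prod_dist_eq_of_L2]
  refine Real.le_sqrt_of_sq_le ?_
  simp only [level]
  nlinarith [sq_nonneg (dist (c.frame.symm x).fst (c.frame.symm y).fst)]

/-- A Lipschitz constant of the height. -/
def heightLip : ℝ≥0 := 1 + c.lip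

lemma lipschitzWith_height : LipschitzWith c.heightLip c.height := by
  refine LipschitzWith.of_dist_le_mul fun p q => ?_
  have h1 : dist (c.level p.2) (c.level q.2) ≤ dist p q := by
    have := c.lipschitzWith_level.dist_le_mul p.2 q.2
    rw [NNReal.coe_one, one_mul] at this
    exact this.trans (le_max_right _ _)
  have h2 : dist (c.base p.2) (c.base q.2) ≤ dist p q := by
    have := c.lipschitzWith_base.dist_le_mul p.2 q.2
    rw [NNReal.coe_one, one_mul] at this
    exact this.trans (le_max_right _ _)
  have h3 := c.lipschitz.dist_le_mul (p.1, c.base p.2) (q.1, c.base q.2)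
  have h4 : dist (p.1, c.base p.2) (q.1, c.base q.2) ≤ dist p q :=
    max_le (le_max_left _ _) h2
  have h5 := mul_le_mul_of_nonneg_left h4 c.lip.coe_nonneg
  calc dist (c.height p) (c.height q)
      ≤ dist (c.level p.2) (c.level q.2) +
        dist (c.profile (p.1, c.base p.2)) (c.profile (q.1, c.base q.2)) := dist_sub_sub_le _ _ _ _
    _ ≤ c.heightLip * dist p q := by
      simp only [heightLip, NNReal.coe_add, NNReal.coe_one]
      linarith

lemma continuous_height : Continuous c.height := c.lipschitzWith_height.continuous

lemma continuous_param_uncurry :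
    Continuous fun z : ℝ × ((ℝ × Base d) × ℝ) => c.param z.1 z.2 := by
  have := c.lipschitz.continuous
  unfold param
  refine Continuous.prodMk (by fun_prop) (c.frame.continuous.comp ?_)
  refine (WithLp.prod_continuous_toLp 2 _ _).comp ?_
  fun_prop

lemma continuous_param (ε : ℝ) : Continuous (c.param ε) :=
  c.continuous_param_uncurry.comp (by fun_prop : Continuous fun y => (ε, y))

lemma param_eq_param_zero_mul (ε : ℝ) (y : (ℝ × Base d) × ℝ) :
    c.param ε y = c.param 1 (y.1, ε * y.2) := by
  simp [param]

lemma param_injective {ε : ℝ} (hε : ε ≠ 0) : Function.Injective (c.param ε) := by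
  rintro ⟨⟨t, x⟩, r⟩ ⟨⟨t', x'⟩, r'⟩ h
  simp only [param, Prod.mk.injEq, EmbeddingLike.apply_eq_iff_eq, WithLp.toLp.injEq] at h
  obtain ⟨rfl, rfl, h⟩ := h
  have : r = r' := by simpa [hε] using h
  simp [this]

lemma measurableEmbedding_param {ε : ℝ} (hε : ε ≠ 0) : MeasurableEmbedding (c.param ε) :=
  (c.continuous_param ε).measurableEmbedding (c.param_injective hε)

/-- A shear translates each vertical line by the profile, hence preserves product measure, and the
frame is an isometry. No derivative of the merely Lipschitz profile enters. -/
lemma measurePreserving_param_one : MeasurePreserving (c.param 1) := by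
  have h1 : MeasurePreserving (fun y : (ℝ × Base d) × ℝ => (y.1, c.profile y.1 + y.2))
      (volume.prod volume) (volume.prod volume) := by
    refine (MeasurePreserving.id volume).skew_product (g := fun z r => c.profile z + r) ?_ ?_
    · have := c.lipschitz.continuous
      exact Continuous.measurable (by fun_prop)
    · exact ae_of_all _ fun z => map_add_left_eq_self volume (c.profile z)
  have h2 : MeasurePreserving (MeasurableEquiv.prodAssoc : (ℝ × Base d) × ℝ ≃ᵐ _)
      (volume.prod volume) (volume.prod volume) := measurePreserving_prodAssoc volume volume volume
  have h3 : MeasurePreserving (fun y : Base d × ℝ => c.frame (WithLp.toLp 2 y)) :=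
    c.frame.measurePreserving.comp (WithLp.volume_preserving_toLp _ _)
  have h4 := ((MeasurePreserving.id (volume : Measure ℝ)).prod h3).comp (h2.comp h1)
  have h5 : c.param 1 = (Prod.map id fun y => c.frame (WithLp.toLp 2 y)) ∘
      MeasurableEquiv.prodAssoc ∘ fun y => (y.1, c.profile y.1 + y.2) := by
    ext1 y
    simp [param, MeasurableEquiv.prodAssoc]
  rw [h5]
  exact h4

lemma map_param {ε : ℝ} (hε : ε ≠ 0) :
    Measure.map (c.param ε) volume = ENNReal.ofReal |ε⁻¹| • volume := by
  have h : c.param ε = c.param 1 ∘ Prod.map id (ε * ·) := by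
    ext1 y
    exact c.param_eq_param_zero_mul ε y
  have hm : Measurable (Prod.map id (ε * ·) : (ℝ × Base d) × ℝ → (ℝ × Base d) × ℝ) :=
    measurable_id.prodMap (measurable_const_mul ε)
  rw [h, ← Measure.map_map (c.continuous_param 1).measurable hm, Measure.volume_eq_prod,
    ← Measure.map_prod_map _ _ measurable_id (measurable_const_mul ε), Measure.map_id,
    Real.map_volume_mul_left hε, Measure.prod_smul_right, Measure.map_smul,
    ← Measure.volume_eq_prod, c.measurePreserving_param_one.map_eq]

lemma lintegral_param {ε : ℝ} (hε : ε ≠ 0) (f : ℝ × Space d → ℝ≥0∞) :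
    ∫⁻ y, f (c.param ε y) = ENNReal.ofReal |ε⁻¹| * ∫⁻ p, f p := by
  rw [← (c.measurableEmbedding_param hε).lintegral_map, c.map_param hε, lintegral_smul_measure,
    smul_eq_mul]

lemma integral_param {ε : ℝ} (hε : ε ≠ 0) (f : ℝ × Space d → ℝ) :
    ∫ y, f (c.param ε y) = |ε⁻¹| * ∫ p, f p := by
  rw [← (c.measurableEmbedding_param hε).integral_map, c.map_param hε, integral_smul_measure,
    ENNReal.toReal_ofReal (abs_nonneg _), smul_eq_mul]

/-- A property that holds at almost every parameter holds at almost every point. -/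
lemma ae_of_ae_param {P : ℝ × Space d → Prop} (h : ∀ᵐ y, P (c.param 1 y)) : ∀ᵐ p, P p := by
  have := c.measurePreserving_param_one.map_eq
  rw [← this]
  exact (c.measurableEmbedding_param one_ne_zero).ae_map_iff.2 h

/-- In graph coordinates a level set of the height is a hyperplane. -/
lemma ae_height_ne (a : ℝ) : ∀ᵐ p, c.height p ≠ a := by
  refine c.ae_of_ae_param ?_
  simp only [height_param, one_mul]
  have : Measure.QuasiMeasurePreserving (Prod.snd : (ℝ × Base d) × ℝ → ℝ) := by
    exact Measure.quasiMeasurePreserving_snd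
  exact this.ae (Measure.ae_ne volume a)

lemma continuous_graphPoint (t : ℝ) : Continuous (c.graphPoint t) := by
  have := c.lipschitz.continuous
  unfold graphPoint
  refine c.frame.continuous.comp ((WithLp.prod_continuous_toLp 2 _ _).comp ?_)
  fun_prop

@[simp] lemma base_graphPoint (t : ℝ) (x : Base d) : c.base (c.graphPoint t x) = x := by
  simp [graphPoint]

lemma graphPoint_base {t : ℝ} {z : Space d} (h : c.height (t, z) = 0) :
    c.graphPoint t (c.base z) = z := by
  have h' : c.level z = c.profile (t, c.base z) := by
    simpa [height, sub_eq_zero] using h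
  rw [graphPoint, ← h']
  apply c.frame.symm.injective
  rw [c.frame.symm_apply_apply]
  rfl

/-- The base projection is 1-Lipschitz and inverts the graph map, so it cannot increase Hausdorff
measure; on the base the Euclidean normalization gives Lebesgue measure. This inequality stands in
for the area formula. -/
lemma map_graphPoint_le_surface (t : ℝ) :
    Measure.map (c.graphPoint t) volume ≤ surface d := by
  refine Measure.le_iff.2 fun S hS => ?_
  rw [Measure.map_apply (c.continuous_graphPoint t).measurable hS, surface]
  rw [← EuclideanSpace.euclideanHausdorffMeasure_eq_volume]
  have h1 : (c.graphPoint t) ⁻¹' S ⊆ c.base '' S := fun x hx => ⟨_, hx, by simp⟩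
  refine (measure_mono h1).trans ?_
  simpa using c.lipschitzWith_base.euclideanHausdorffMeasure_image_le (d - 1) S

/-- The integral over a graph dominates the integral over its parameter space. -/
lemma lintegral_graphPoint_le (t : ℝ) (f : Space d → ℝ≥0∞) :
    ∫⁻ x, f (c.graphPoint t x) ≤ ∫⁻ z, f z ∂surface d := by
  have h : MeasurableEmbedding (c.graphPoint t) :=
    (c.continuous_graphPoint t).measurableEmbedding
      (Function.LeftInverse.injective (c.base_graphPoint t))
  rw [← h.lintegral_map]
  exact lintegral_mono' (c.map_graphPoint_le_surface t) le_rfl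

lemma lipschitzWith_graphPoint (t : ℝ) : LipschitzWith c.heightLip (c.graphPoint t) := by
  refine LipschitzWith.of_dist_le_mul fun x y => ?_
  have h2 : dist (c.profile (t, x)) (c.profile (t, y)) ≤ c.lip * dist x y := by
    simpa [Prod.dist_eq] using c.lipschitz.dist_le_mul (t, x) (t, y)
  rw [graphPoint, graphPoint, c.frame.dist_map, WithLp.prod_dist_eq_of_L2]
  simp only [heightLip, NNReal.coe_add, NNReal.coe_one]
  refine Real.sqrt_le_iff.2 ⟨by positivity, ?_⟩
  have h3 := dist_nonneg (x := x) (y := y)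
  have h4 := c.lip.coe_nonneg
  have h5 := pow_le_pow_left₀ dist_nonneg h2 2
  have h6 : 0 ≤ (c.lip : ℝ) * dist x y ^ 2 := by positivity
  change dist x y ^ 2 + dist (c.profile (t, x)) (c.profile (t, y)) ^ 2 ≤ _
  nlinarith

lemma surface_image_graphPoint_le (t : ℝ) (B : Set (Base d)) :
    surface d (c.graphPoint t '' B) ≤ (c.heightLip : ℝ≥0∞) ^ (d - 1) * volume B := by
  have := (c.lipschitzWith_graphPoint t).euclideanHausdorffMeasure_image_le (d - 1) B
  rwa [EuclideanSpace.euclideanHausdorffMeasure_eq_volume] at this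

/-- The chart given by a unit vector and a Lipschitz function of the orthogonal components. -/
lemma exists_height_eq {e : Space d} (he : ‖e‖ = 1) {φ : ℝ × Space d → ℝ} {L : ℝ≥0}
    (hφ : LipschitzWith L φ) : ∃ c : GraphChart d, ∀ q : ℝ × Space d,
      c.height q = ⟪e, q.2⟫_ℝ - φ (q.1, q.2 - ⟪e, q.2⟫_ℝ • e) := by
  have he0 : e ≠ 0 := by
    rintro rfl
    simp at he
  have hfin : Module.finrank ℝ (ℝ ∙ e)ᗮ = d - 1 := by
    have h1 := Submodule.finrank_add_finrank_orthogonal (ℝ ∙ e)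
    rw [finrank_span_singleton he0, finrank_euclideanSpace_fin] at h1
    omega
  have hd : 1 ≤ d := by
    have h1 := Submodule.finrank_add_finrank_orthogonal (ℝ ∙ e)
    rw [finrank_span_singleton he0, finrank_euclideanSpace_fin] at h1
    omega
  -- An orthonormal basis identifies the base with the hyperplane orthogonal to `e`; the frame will
  -- send `(y, r)` to `g y + r • e`.
  let g : Base d ≃ₗᵢ[ℝ] (ℝ ∙ e)ᗮ :=
    ((stdOrthonormalBasis ℝ (ℝ ∙ e)ᗮ).reindex (finCongr hfin)).repr.symm
  have hperp : ∀ x, ⟪e, (g x : Space d)⟫_ℝ = 0 := fun x =>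
    Submodule.mem_orthogonal_singleton_iff_inner_right.1 (g x).2
  let lin : WithLp 2 (Base d × ℝ) →ₗ[ℝ] Space d :=
    { toFun := fun y => (g y.fst : Space d) + y.snd • e
      map_add' := fun y z => by
        simp only [WithLp.add_fst, WithLp.add_snd, map_add, Submodule.coe_add, add_smul]
        abel
      map_smul' := fun a y => by
        simp [smul_smul] }
  let iso : WithLp 2 (Base d × ℝ) →ₗᵢ[ℝ] Space d :=
    { lin with
      norm_map' := fun y => by
        have h1 : ‖(g y.fst : Space d) + y.snd • e‖ ^ 2 = ‖y.fst‖ ^ 2 + ‖y.snd‖ ^ 2 := by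
          rw [norm_add_sq_real, inner_smul_right, real_inner_comm, hperp, norm_smul, he,
            Submodule.norm_coe, g.norm_map]
          ring
        change ‖(g y.fst : Space d) + y.snd • e‖ = ‖y‖
        rw [WithLp.prod_norm_eq_of_L2, ← h1, Real.sqrt_sq (norm_nonneg _)] }
  let frame : WithLp 2 (Base d × ℝ) ≃ₗᵢ[ℝ] Space d := iso.toLinearIsometryEquiv (by
    rw [(WithLp.linearEquiv 2 ℝ (Base d × ℝ)).finrank_eq, Module.finrank_prod,
      finrank_euclideanSpace_fin, finrank_euclideanSpace_fin, Module.finrank_self]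
    omega)
  have hframe : ∀ y, frame y = (g y.fst : Space d) + y.snd • e := fun y => rfl
  refine ⟨⟨frame, fun y => φ (y.1, g y.2), L, ?_⟩, ?_⟩
  · refine LipschitzWith.of_dist_le_mul fun x y => ?_
    have := hφ.dist_le_mul (x.1, (g x.2 : Space d)) (y.1, (g y.2 : Space d))
    rwa [Prod.dist_eq, ← Subtype.dist_eq, g.dist_map] at this
  · rintro ⟨t, z⟩
    obtain ⟨y, rfl⟩ := frame.surjective z
    have h1 : ⟪e, frame y⟫_ℝ = y.snd := by
      rw [hframe, inner_add_right, hperp, inner_smul_right, real_inner_self_eq_norm_sq, he]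
      ring
    simp only [h1]
    simp only [height, level, base, LinearIsometryEquiv.symm_apply_apply]
    rw [hframe, add_sub_cancel_right]

end GraphChart

/-! ### Moving Lipschitz domains: compactness and finite covers by charts -/

namespace IsLipschitzTube

variable {T : ℝ} {U : ℝ → Set (Space d)}

/-- The lateral boundary of the tube. -/
def _root_.ParabolicInterface.lateral (T : ℝ) (U : ℝ → Set (Space d)) : Set (ℝ × Space d) :=
  closure (tube T U) \ tube T U

lemma fst_mem_of_mem_closure {q : ℝ × Space d} (hq : q ∈ closure (tube T U)) : q.1 ∈ Icc 0 T := by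
  have h : tube T U ⊆ Prod.fst ⁻¹' Icc 0 T := fun p hp => hp.1
  exact closure_minimal h (isClosed_Icc.preimage continuous_fst) hq

lemma isCompact_closure (h : IsLipschitzTube T U) : IsCompact (closure (tube T U)) :=
  h.isBounded.isCompact_closure

/-- Points of the closure of the tube have their time in `[0, T]`, so the relative openness of the
tube applies to them and a point of the tube has no lateral points nearby. -/
lemma isClosed_lateral (h : IsLipschitzTube T U) : IsClosed (lateral T U) := by
  rw [← isOpen_compl_iff, isOpen_iff_mem_nhds]
  intro p hp
  by_cases hc : p ∈ closure (tube T U)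
  · have hp' : p ∈ tube T U := by
      by_contra h'
      exact hp ⟨hc, h'⟩
    filter_upwards [h.isOpen p hp'] with q hq hq'
    exact hq'.2 (hq (fst_mem_of_mem_closure hq'.1))
  · filter_upwards [isClosed_closure.isOpen_compl.mem_nhds hc] with q hq hq'
    exact hq hq'.1

lemma isCompact_lateral (h : IsLipschitzTube T U) : IsCompact (lateral T U) :=
  h.isCompact_closure.of_isClosed_subset h.isClosed_lateral sdiff_subset

lemma isOpen_slice (h : IsLipschitzTube T U) {t : ℝ} (ht : t ∈ Icc 0 T) : IsOpen (U t) := by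
  rw [isOpen_iff_mem_nhds]
  intro x hx
  have h1 : Tendsto (fun y : Space d => (t, y)) (𝓝 x) (𝓝 (t, x)) := by
    exact (Continuous.prodMk_right t).tendsto x
  filter_upwards [h1.eventually (h.isOpen (t, x) ⟨ht, hx⟩)] with y hy
  exact (hy ht).2

lemma mk_mem_closure {t : ℝ} (ht : t ∈ Icc 0 T) {x : Space d} (hx : x ∈ closure (U t)) :
    (t, x) ∈ closure (tube T U) := by
  have h1 : Continuous (fun y : Space d => (t, y)) := Continuous.prodMk_right t
  exact map_mem_closure h1 hx fun y hy => ⟨ht, hy⟩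

/-- The chart domain and the chart describe the tube. -/
def _root_.ParabolicInterface.GraphChart.Describes (c : GraphChart d) (T : ℝ)
    (U : ℝ → Set (Space d)) (N : Set (ℝ × Space d)) : Prop :=
  IsOpen N ∧ ∀ q ∈ N, q.1 ∈ Icc 0 T → (q.2 ∈ U q.1 ↔ 0 < c.height q)

/-- The lateral boundary is covered by finitely many charts. -/
lemma exists_charts (h : IsLipschitzTube T U) :
    ∃ (m : ℕ) (c : Fin m → GraphChart d) (N : Fin m → Set (ℝ × Space d)),
      (∀ b, (c b).Describes T U (N b)) ∧ lateral T U ⊆ ⋃ b, N b := by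
  have h1 : ∀ p ∈ lateral T U, ∃ (c : GraphChart d) (N : Set (ℝ × Space d)),
      c.Describes T U N ∧ p ∈ N := by
    intro p hp
    obtain ⟨e, φ, L, he, hφ, hU⟩ := h.chart p hp
    obtain ⟨c, hc⟩ := GraphChart.exists_height_eq he hφ
    obtain ⟨N, hN, hNo, hpN⟩ := eventually_nhds_iff.1 hU
    refine ⟨c, N, ⟨hNo, fun q hq ht => ?_⟩, hpN⟩
    rw [hN q hq ht, hc, sub_pos]
  choose c N hcN hpN using h1
  obtain ⟨s, hcov⟩ := h.isCompact_lateral.elim_nhds_subcover' N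
    fun p hp => (hcN p hp).1.mem_nhds (hpN p hp)
  refine ⟨s.card, fun b => c _ (s.equivFin.symm b).1.2, fun b => N _ (s.equivFin.symm b).1.2,
    fun b => hcN _ _, fun p hp => ?_⟩
  obtain ⟨x, hx, hpx⟩ := mem_iUnion₂.1 (hcov hp)
  obtain ⟨b, hb⟩ := s.equivFin.symm.surjective ⟨x, hx⟩
  have key : ∀ z : s, z = ⟨x, hx⟩ → p ∈ N z.1.1 z.1.2 := by
    rintro _ rfl
    exact hpx
  exact mem_iUnion.2 ⟨b, key _ hb⟩

/-- On the chart domain the lateral boundary is the graph. -/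
lemma height_eq_zero {c : GraphChart d} {N : Set (ℝ × Space d)}
    (hc : c.Describes T U N) {p : ℝ × Space d} (hp : p ∈ lateral T U) (hpN : p ∈ N) :
    c.height p = 0 := by
  refine le_antisymm ?_ ?_
  · by_contra! h'
    have ht := fst_mem_of_mem_closure hp.1
    exact hp.2 ⟨ht, (hc.2 p hpN ht).2 h'⟩
  · have h1 : p ∈ closure (tube T U ∩ N) := by
      rw [inter_comm]
      exact hc.1.inter_closure ⟨hpN, hp.1⟩
    have h2 : tube T U ∩ N ⊆ {q | 0 ≤ c.height q} := fun q hq =>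
      ((hc.2 q hq.2 hq.1.1).1 hq.1.2).le
    exact closure_minimal h2 (isClosed_le continuous_const c.continuous_height) h1

end IsLipschitzTube

/-! ### The height function along its vertical direction -/

namespace GraphChart

variable (c : GraphChart d)

/-- The direction across the hyperplane. -/
def up : Space d := c.frame (WithLp.toLp 2 (0, 1))

lemma base_add_smul_up (x : Space d) (r : ℝ) : c.base (x + r • c.up) = c.base x := by
  simp [base, up]

lemma level_add_smul_up (x : Space d) (r : ℝ) : c.level (x + r • c.up) = c.level x + r := by
  simp [level, up]

lemma height_add_smul_up (t : ℝ) (x : Space d) (r : ℝ) :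
    c.height (t, x + r • c.up) = c.height (t, x) + r := by
  simp only [height, base_add_smul_up, level_add_smul_up]
  ring

/-- The orthogonal projection to the hyperplane, as a continuous linear map. -/
def baseL : Space d →L[ℝ] Base d :=
  (WithLp.fstL 2 ℝ (Base d) ℝ).comp (c.frame.symm : Space d →L[ℝ] WithLp 2 (Base d × ℝ))

/-- The orthogonal coordinate, as a continuous linear map. -/
def levelL : Space d →L[ℝ] ℝ :=
  (WithLp.sndL 2 ℝ (Base d) ℝ).comp (c.frame.symm : Space d →L[ℝ] WithLp 2 (Base d × ℝ))

@[simp] lemma baseL_apply (x : Space d) : c.baseL x = c.base x := rfl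

@[simp] lemma levelL_apply (x : Space d) : c.levelL x = c.level x := rfl

lemma differentiableAt_height {q : ℝ × Space d}
    (h : DifferentiableAt ℝ c.profile (q.1, c.base q.2)) : DifferentiableAt ℝ c.height q := by
  have h1 : c.height = fun q => c.levelL q.2 - c.profile (q.1, c.baseL q.2) := rfl
  have h2 : DifferentiableAt ℝ (fun q : ℝ × Space d => (q.1, c.baseL q.2)) q := by fun_prop
  rw [h1]
  have h3 := DifferentiableAt.comp (g := c.profile) q h h2
  have h4 : DifferentiableAt ℝ (fun q : ℝ × Space d => c.levelL q.2) q := by fun_prop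
  exact h4.sub h3

lemma differentiableAt_height_slice {t : ℝ} {x : Space d}
    (h : DifferentiableAt ℝ (fun z => c.profile (t, z)) (c.base x)) :
    DifferentiableAt ℝ (fun y => c.height (t, y)) x := by
  have h1 : (fun y => c.height (t, y)) = fun y => c.levelL y - c.profile (t, c.baseL y) := rfl
  rw [h1]
  have h3 := DifferentiableAt.comp (g := fun z => c.profile (t, z)) x h c.baseL.differentiableAt
  exact c.levelL.differentiableAt.sub h3

/-- The derivative of the height in the direction `c.up` is `1`, at every point where it exists. -/
lemma gradient_slice_ne_zero {t : ℝ} {x g : Space d}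
    (h : HasGradientAt (fun y => c.height (t, y)) g x) : g ≠ 0 := by
  rintro rfl
  have h1 := h.hasFDerivAt.comp_hasDerivAt_of_eq (0 : ℝ)
    (f := fun r : ℝ => x + r • c.up) (f' := c.up)
    (by simpa using ((hasDerivAt_id (0 : ℝ)).smul_const c.up).const_add x) (by simp)
  have h2 : HasDerivAt (fun r : ℝ => c.height (t, x) + r) 1 0 := (hasDerivAt_id 0).const_add _
  have h3 : (fun y => c.height (t, y)) ∘ (fun r : ℝ => x + r • c.up) =
      fun r : ℝ => c.height (t, x) + r := by
    ext r
    exact c.height_add_smul_up t x r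
  rw [h3] at h1
  simpa using h1.unique h2

/-- The base points of a set of space-time points. -/
lemma isCompact_base_image {K : Set (ℝ × Space d)} (hK : IsCompact K) :
    IsCompact ((fun q : ℝ × Space d => c.base q.2) '' K) := by
  refine hK.image ?_
  exact c.lipschitzWith_base.continuous.comp continuous_snd

end GraphChart

/-! ### Outer normals: uniqueness, and superlevel sets -/

section Normal

variable {S : Set (Space d)} {x n m g : Space d}

/-- Moving from `x` in the direction `m - n` enters the half-space of `n` and leaves that of `m`,
both at a linear rate. Nearby points on this ray can then be neither in `S` nor outside it. -/
lemma IsOuterNormal.unique (hn : IsOuterNormal S x n) (hm : IsOuterNormal S x m) : n = m := by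
  by_contra hne
  have h1 : ⟪n, m⟫_ℝ < 1 := by
    rcases (real_inner_le_norm n m).lt_or_eq with h | h
    · simpa [hn.1, hm.1] using h
    · exact absurd ((inner_eq_one_iff_of_norm_eq_one hn.1 hm.1).1 (by simpa [hn.1, hm.1] using h))
        hne
  set a : ℝ := 1 - ⟪n, m⟫_ℝ with ha
  have ha0 : 0 < a := by linarith
  set w := m - n with hw
  have hwn : ⟪w, n⟫_ℝ = -a := by
    rw [hw, inner_sub_left, real_inner_self_eq_norm_sq, hn.1, real_inner_comm]
    ring
  have hwm : ⟪w, m⟫_ℝ = a := by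
    rw [hw, inner_sub_left, real_inner_self_eq_norm_sq, hm.1]
    ring
  have hw0 : 0 < ‖w‖ := by
    rw [norm_pos_iff, hw, sub_ne_zero]
    exact Ne.symm hne
  obtain ⟨ε, hε, hεa⟩ : ∃ ε > 0, ε * ‖w‖ < a := ⟨a / (2 * ‖w‖), by positivity, by
    field_simp
    norm_num⟩
  have hlim : Tendsto (fun r : ℝ => x + r • w) (𝓝[>] 0) (𝓝 x) := by
    refine tendsto_nhdsWithin_of_tendsto_nhds ?_
    have : Continuous fun r : ℝ => x + r • w := by fun_prop
    simpa using this.tendsto 0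
  obtain ⟨r, ⟨hr1, hr2⟩, hr0⟩ := ((hlim.eventually ((hn.2 ε hε).and (hm.2 ε hε))).and
    self_mem_nhdsWithin).exists
  have hr : 0 < r := hr0
  simp only [add_sub_cancel_left, inner_smul_left, norm_smul, hwn, hwm, Real.norm_eq_abs,
    abs_of_pos hr, conj_trivial] at hr1 hr2
  by_cases hS : x + r • w ∈ S
  · have := hr2.1 hS
    nlinarith
  · have := hr1.2 hS
    nlinarith

lemma IsOuterNormal.outerNormal_eq (hn : IsOuterNormal S x n) : outerNormal S x = n := by
  have h : ∃ n, IsOuterNormal S x n := ⟨n, hn⟩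
  rw [outerNormal, dif_pos h]
  exact h.choose_spec.unique hn

/-- The superlevel set of a differentiable function has the normalized negative gradient as its
outer normal. -/
lemma isOuterNormal_of_hasGradientAt {f : Space d → ℝ} (hf : HasGradientAt f g x) (hg : g ≠ 0)
    (hx : f x = 0) (hS : ∀ᶠ y in 𝓝 x, (y ∈ S ↔ 0 < f y)) :
    IsOuterNormal S x (-(‖g‖⁻¹ • g)) := by
  have hg0 : 0 < ‖g‖ := norm_pos_iff.2 hg
  refine ⟨by rw [norm_neg, norm_smul, norm_inv, norm_norm, inv_mul_cancel₀ hg0.ne'],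
    fun ε hε => ?_⟩
  have h1 := hf.hasFDerivAt.isLittleO.bound (mul_pos hε hg0)
  filter_upwards [h1, hS] with y hy hyS
  rw [hx, sub_zero, InnerProductSpace.toDual_apply_apply, Real.norm_eq_abs] at hy
  rw [inner_neg_right, inner_smul_right, real_inner_comm]
  have h3 := abs_le.1 hy
  have key : ‖g‖⁻¹ * (ε * ‖g‖ * ‖y - x‖) = ε * ‖y - x‖ := by
    field_simp
  constructor
  · intro hyS'
    have h2 := hyS.1 hyS'
    have h4 : -(ε * ‖g‖ * ‖y - x‖) ≤ ⟪g, y - x⟫_ℝ := by linarith [h3.2]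
    have := mul_le_mul_of_nonneg_left h4 (inv_nonneg.2 hg0.le)
    linarith
  · intro hyS'
    have h2 : f y ≤ 0 := not_lt.1 fun h => hyS' (hyS.2 h)
    have h4 : ⟪g, y - x⟫_ℝ ≤ ε * ‖g‖ * ‖y - x‖ := by linarith [h3.1]
    have := mul_le_mul_of_nonneg_left h4 (inv_nonneg.2 hg0.le)
    linarith

end Normal

/-! ### Area of the boundary slices and almost everywhere existence of normals -/

namespace IsLipschitzTube

variable {T : ℝ} {U : ℝ → Set (Space d)}

lemma mk_mem_lateral (h : IsLipschitzTube T U) {t : ℝ} (ht : t ∈ Icc 0 T) {x : Space d}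
    (hx : x ∈ frontier (U t)) : (t, x) ∈ lateral T U := by
  refine ⟨mk_mem_closure ht hx.1, fun h' => ?_⟩
  rw [(h.isOpen_slice ht).frontier_eq] at hx
  exact hx.2 h'.2

/-- The area of the boundary of a moving Lipschitz domain is bounded. -/
lemma exists_surface_frontier_le (h : IsLipschitzTube T U) :
    ∃ S : ℝ≥0, ∀ t ∈ Icc 0 T, surface d (frontier (U t)) ≤ S := by
  obtain ⟨m, c, N, hc, hcov⟩ := h.exists_charts
  -- The lateral boundary of all times is projected, so the resulting area bound does not depend on
  -- `t`.
  set B : Fin m → Set (Base d) := fun b => (fun q : ℝ × Space d => (c b).base q.2) '' lateral T U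
  have hB : ∀ b, volume (B b) ≠ ∞ := fun b =>
    ((c b).isCompact_base_image h.isCompact_lateral).measure_lt_top.ne
  have hfin : ∑ b, ((c b).heightLip : ℝ≥0∞) ^ (d - 1) * volume (B b) ≠ ∞ :=
    ENNReal.sum_ne_top.2 fun b _ => ENNReal.mul_ne_top (by simp) (hB b)
  refine ⟨(∑ b, ((c b).heightLip : ℝ≥0∞) ^ (d - 1) * volume (B b)).toNNReal, fun t ht => ?_⟩
  rw [ENNReal.coe_toNNReal hfin]
  have hsub : frontier (U t) ⊆ ⋃ b, (c b).graphPoint t '' B b := by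
    intro x hx
    have hl := h.mk_mem_lateral ht hx
    obtain ⟨b, hb⟩ := mem_iUnion.1 (hcov hl)
    exact mem_iUnion.2 ⟨b, (c b).base x, ⟨(t, x), hl, rfl⟩,
      (c b).graphPoint_base (height_eq_zero (hc b) hl hb)⟩
  refine (measure_mono hsub).trans ((measure_iUnion_fintype_le _ _).trans ?_)
  exact Finset.sum_le_sum fun b _ => (c b).surface_image_graphPoint_le t (B b)

/-- A moving Lipschitz domain has an outer normal at almost every boundary point. -/
lemma ae_exists_isOuterNormal (h : IsLipschitzTube T U) {t : ℝ} (ht : t ∈ Icc 0 T) :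
    ∀ᵐ x ∂(surface d).restrict (frontier (U t)), ∃ n, IsOuterNormal (U t) x n := by
  obtain ⟨m, c, N, hc, hcov⟩ := h.exists_charts
  rw [ae_restrict_iff' isClosed_frontier.measurableSet]
  -- Rademacher's theorem is applied to the profile at the fixed time `t`. The graph map is
  -- Lipschitz, so the exceptional base points correspond to a null set of the boundary.
  set Z : Fin m → Set (Base d) := fun b => {z | ¬ DifferentiableAt ℝ (fun z => (c b).profile (t, z)) z}
  have hZ : ∀ b, volume (Z b) = 0 := by
    intro b
    have h1 : LipschitzWith ((c b).lip * 1) (fun z => (c b).profile (t, z)) :=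
      (c b).lipschitz.comp (LipschitzWith.prodMk_left t)
    exact ae_iff.1 h1.ae_differentiableAt
  have hnull : ∀ b, surface d ((c b).graphPoint t '' Z b) = 0 := by
    intro b
    refine le_antisymm (((c b).surface_image_graphPoint_le t (Z b)).trans ?_) zero_le
    rw [hZ, mul_zero]
  have hnull' : ∀ᵐ x ∂surface d, ∀ b, x ∉ (c b).graphPoint t '' Z b :=
    ae_all_iff.2 fun b => measure_eq_zero_iff_ae_notMem.1 (hnull b)
  filter_upwards [hnull'] with x hx hxf
  have hl := h.mk_mem_lateral ht hxf
  obtain ⟨b, hb⟩ := mem_iUnion.1 (hcov hl)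
  have h0 := height_eq_zero (hc b) hl hb
  have hd : DifferentiableAt ℝ (fun z => (c b).profile (t, z)) ((c b).base x) := by
    by_contra hd
    exact hx b ⟨_, hd, (c b).graphPoint_base h0⟩
  have hg := ((c b).differentiableAt_height_slice hd).hasGradientAt
  refine ⟨_, isOuterNormal_of_hasGradientAt hg ((c b).gradient_slice_ne_zero hg) h0 ?_⟩
  have h1 : Tendsto (fun y : Space d => (t, y)) (𝓝 x) (𝓝 (t, x)) :=
    (Continuous.prodMk_right t).tendsto x
  filter_upwards [h1.eventually ((hc b).1.mem_nhds hb)] with y hy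
  exact (hc b).2 _ hy ht

end IsLipschitzTube

/-! ### The two phases seen in a chart of the first one -/

namespace IsMovingPartition

variable {T : ℝ} {Ω : ℝ → Set (Space d)} {U : Fin 2 → ℝ → Set (Space d)}

lemma interface_subset_frontier (hP : IsMovingPartition T Ω U) (i : Fin 2) {t : ℝ}
    (ht : t ∈ Icc 0 T) : interface Ω U t ⊆ frontier (U i t) := by
  intro x hx
  rw [((hP.subdomain i).isOpen_slice ht).frontier_eq]
  refine ⟨hP.interface_subset i t ht hx, fun h => hx.2 ?_⟩
  fin_cases i
  exacts [Or.inl h, Or.inr h]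

lemma measurableSet_interface (hP : IsMovingPartition T Ω U) {t : ℝ} (ht : t ∈ Icc 0 T) :
    MeasurableSet (interface Ω U t) :=
  (hP.domain.isOpen_slice ht).measurableSet.diff
    (((hP.subdomain 0).isOpen_slice ht).union ((hP.subdomain 1).isOpen_slice ht)).measurableSet

lemma measurableSet_outerBoundary (hP : IsMovingPartition T Ω U) (i : Fin 2) {t : ℝ}
    (ht : t ∈ Icc 0 T) : MeasurableSet (outerBoundary Ω U i t) :=
  isClosed_frontier.measurableSet.diff (hP.measurableSet_interface ht)

lemma mem_one_of_notMem_closure (hP : IsMovingPartition T Ω U) {t : ℝ} (ht : t ∈ Icc 0 T)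
    {x : Space d} (hx : x ∈ Ω t) (h0 : x ∉ closure (U 0 t)) : x ∈ U 1 t := by
  by_contra h1
  exact h0 (hP.interface_subset 0 t ht ⟨hx, fun h => h.elim (fun h => h0 (subset_closure h)) h1⟩)

/-- In a chart of the first subdomain, the second one is below the graph. -/
lemma mem_one_iff (hP : IsMovingPartition T Ω U) {c : GraphChart d} {N : Set (ℝ × Space d)}
    (hc : c.Describes T (U 0) N) {t : ℝ} (ht : t ∈ Icc 0 T) {x : Space d} (hx : x ∈ Ω t)
    (hN : (t, x) ∈ N) : x ∈ U 1 t ↔ c.height (t, x) < 0 := by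
  have hslice : Continuous (fun y : Space d => (t, y)) := Continuous.prodMk_right t
  constructor
  · intro h1
    by_contra! h
    -- A point on or above the graph is a limit of points strictly above it, obtained by moving up.
    -- The open second phase cannot meet the closure of the first.
    have hcl : x ∈ closure (U 0 t) := by
      have hlim : Tendsto (fun r : ℝ => x + r • c.up) (𝓝[>] 0) (𝓝 x) := by
        refine tendsto_nhdsWithin_of_tendsto_nhds ?_
        have : Continuous fun r : ℝ => x + r • c.up := by fun_prop
        simpa using this.tendsto 0
      refine mem_closure_of_tendsto hlim ?_
      have h2 : ∀ᶠ r : ℝ in 𝓝[>] 0, (t, x + r • c.up) ∈ N :=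
        (hslice.tendsto x |>.comp hlim).eventually (hc.1.mem_nhds hN)
      filter_upwards [h2, self_mem_nhdsWithin] with r hr hr0
      refine (hc.2 _ hr ht).2 ?_
      rw [c.height_add_smul_up]
      exact add_pos_of_nonneg_of_pos h hr0
    have hdis := hP.disjoint t ht
    exact ((hdis.symm.closure_right ((hP.subdomain 1).isOpen_slice ht)).notMem_of_mem_left h1) hcl
  · intro h
    refine hP.mem_one_of_notMem_closure ht hx fun hcl => ?_
    -- Below the graph and inside the chart domain there is an open set free of points of the first
    -- phase.
    have hO : IsOpen {y : Space d | (t, y) ∈ N ∧ c.height (t, y) < 0} :=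
      (hc.1.preimage hslice).inter
        ((isOpen_lt c.continuous_height continuous_const).preimage hslice)
    obtain ⟨y, hy, hyU⟩ := mem_closure_iff.1 hcl _ hO ⟨hN, h⟩
    exact absurd ((hc.2 _ hy.1 ht).1 hyU) (not_lt.2 hy.2.le)

/-- Trichotomy for the sign of the height: above the graph is the first phase, below is the second,
and `Ω` contains nothing else besides the interface. -/
lemma mem_interface_iff (hP : IsMovingPartition T Ω U) {c : GraphChart d} {N : Set (ℝ × Space d)}
    (hc : c.Describes T (U 0) N) {t : ℝ} (ht : t ∈ Icc 0 T) {x : Space d} (hx : x ∈ Ω t)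
    (hN : (t, x) ∈ N) : x ∈ interface Ω U t ↔ c.height (t, x) = 0 := by
  have h0 : x ∈ U 0 t ↔ 0 < c.height (t, x) := hc.2 _ hN ht
  have h1 := hP.mem_one_iff hc ht hx hN
  simp only [interface, Set.mem_sdiff, mem_union, hx, true_and, h0, h1]
  constructor
  · intro h
    push Not at h
    exact le_antisymm h.1 h.2
  · rintro h
    simp [h]

end IsMovingPartition

/-! ### Derivatives up to a Lipschitz graph -/

namespace GraphChart

variable (c : GraphChart d)

/-- Each side of a Lipschitz graph contains a cone at each of its points. -/
lemma uniqueDiffOn_height {σ : ℝ} (hσ : |σ| = 1) : UniqueDiffOn ℝ {q | 0 ≤ σ * c.height q} := by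
  intro p hp
  have hσ2 : σ * σ = 1 := by rw [← abs_mul_abs_self, hσ, one_mul]
  set A : ℝ × Space d →L[ℝ] ℝ × Base d :=
    (ContinuousLinearMap.id ℝ ℝ).prodMap c.baseL
  set B : ℝ × Space d →L[ℝ] ℝ := σ • c.levelL.comp (ContinuousLinearMap.snd ℝ ℝ (Space d))
  -- The cone with apex `p` and the slope of the profile's Lipschitz constant. It is convex,
  -- contains the direction `σ • c.up` in its interior, and stays on the same side of the graph as
  -- `p`.
  set C : Set (ℝ × Space d) := {q | (c.lip : ℝ) * ‖A (q - p)‖ ≤ B (q - p)}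
  have hconv : Convex ℝ C := by
    intro x hx y hy a b ha hb hab
    have h1 : a • x + b • y - p = a • (x - p) + b • (y - p) := by
      rw [smul_sub, smul_sub]
      nth_rewrite 1 [← one_smul ℝ p]
      rw [← hab, add_smul]
      abel
    simp only [C, mem_ofPred_eq] at hx hy ⊢
    rw [h1, map_add, map_add, map_smul, map_smul, map_smul, map_smul, smul_eq_mul, smul_eq_mul]
    have h2 : ‖a • A (x - p) + b • A (y - p)‖ ≤ a * ‖A (x - p)‖ + b * ‖A (y - p)‖ := by
      refine (norm_add_le _ _).trans_eq ?_
      rw [norm_smul, norm_smul, Real.norm_of_nonneg ha, Real.norm_of_nonneg hb]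
    have h3 := mul_le_mul_of_nonneg_left h2 c.lip.coe_nonneg
    have h4 := mul_le_mul_of_nonneg_left hx ha
    have h5 := mul_le_mul_of_nonneg_left hy hb
    linarith
  have hint : (interior C).Nonempty := by
    have hO : IsOpen {q : ℝ × Space d | (c.lip : ℝ) * ‖A (q - p)‖ < B (q - p)} :=
      isOpen_lt (by fun_prop) (by fun_prop)
    refine ⟨p + (0, σ • c.up), interior_maximal (fun q hq => ?_) hO ?_⟩
    · simp only [C, mem_ofPred_eq] at hq ⊢
      exact hq.le
    have h1 : A (p + (0, σ • c.up) - p) = 0 := by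
      rw [add_sub_cancel_left]
      simp [A, base, up]
    have h2 : B (p + (0, σ • c.up) - p) = 1 := by
      rw [add_sub_cancel_left]
      simp [B, level, up, hσ2]
    simp only [mem_ofPred_eq]
    rw [h1, h2]
    simp
  refine (uniqueDiffWithinAt_convex hconv hint (x := p) (subset_closure (by simp [C]))).mono ?_
  intro q hq
  simp only [C, mem_ofPred_eq] at hp hq ⊢
  have h1 := c.lipschitz.dist_le_mul (q.1, c.base q.2) (p.1, c.base p.2)
  have h2 : dist (q.1, c.base q.2) (p.1, c.base p.2) = ‖A (q - p)‖ := by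
    rw [dist_eq_norm, map_sub]
    rfl
  have h3 : B (q - p) = σ * (c.level q.2 - c.level p.2) := by
    rw [map_sub]
    simp only [B, smul_apply, ContinuousLinearMap.comp_apply,
      ContinuousLinearMap.coe_snd', levelL_apply, smul_eq_mul]
    ring
  rw [h2, Real.dist_eq, ← one_mul |_|, ← hσ, ← abs_mul] at h1
  have h4 := (abs_le.1 h1).2
  simp only [height] at hp ⊢
  rw [h3] at hq
  linarith

end GraphChart

/-- The derivative is continuous up to the graph on each side of it. -/
lemma continuousWithinAt_fderivWithin_of_graph (c : GraphChart d) {σ : ℝ} (hσ : |σ| = 1)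
    {w : ℝ × Space d → ℝ} {Q O : Set (ℝ × Space d)} (hw : ContDiffOn ℝ 2 w Q) (hO : IsOpen O)
    (hQ : ∀ q ∈ O, q ∈ Q ↔ 0 ≤ σ * c.height q) {p : ℝ × Space d} (hp : p ∈ O) (hpQ : p ∈ Q) :
    ContinuousWithinAt (fderivWithin ℝ w Q) Q p := by
  -- Inside `O` the set `Q` is one side of the graph, where derivatives are unique and hence
  -- continuous for a `C²` function. Intersecting with a neighbourhood of `p` changes neither the
  -- derivative within the set nor its limit.
  have h1 : Q ∩ O = {q | 0 ≤ σ * c.height q} ∩ O := by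
    ext q
    exact and_congr_left fun hq => hQ q hq
  have h2 : UniqueDiffOn ℝ (Q ∩ O) := by
    rw [h1]
    exact (c.uniqueDiffOn_height hσ).inter hO
  have h3 := (hw.mono inter_subset_left).continuousOn_fderivWithin h2 (by norm_num) p ⟨hpQ, hp⟩
  have h4 := (continuousWithinAt_inter (hO.mem_nhds hp)).1 h3
  refine h4.congr_of_eventuallyEq ?_ (fderivWithin_inter (hO.mem_nhds hp)).symm
  filter_upwards [mem_nhdsWithin_of_mem_nhds (hO.mem_nhds hp)] with q hq
  exact (fderivWithin_inter (hO.mem_nhds hq)).symm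

/-! ### Integration by parts against Lipschitz test functions -/

section Cutoff

variable {E : Type*} [NormedAddCommGroup E] [NormedSpace ℝ E] [FiniteDimensional ℝ E]

/-- A smooth compactly supported function in an open set that is `1` on a given compact subset. -/
lemma exists_contDiff_cutoff {K G : Set E} (hK : IsCompact K) (hG : IsOpen G) (hKG : K ⊆ G) :
    ∃ χ : E → ℝ, ContDiff ℝ 1 χ ∧ HasCompactSupport χ ∧ tsupport χ ⊆ G ∧ ∀ x ∈ K, χ x = 1 := by
  obtain ⟨K', hK', hKK', hK'G⟩ := exists_compact_between hK hG hKG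
  obtain ⟨f, h1, h0, -⟩ := exists_contMDiffMap_one_nhds_of_subset_interior (n := 1)
    (modelWithCornersSelf ℝ E) hK.isClosed hKK'
  have hs : tsupport f ⊆ K' := by
    refine closure_minimal (fun x hx => ?_) hK'.isClosed
    by_contra hx'
    exact hx (h0 x hx')
  exact ⟨f, f.contMDiff.contDiff, hK'.of_isClosed_subset (isClosed_tsupport _) hs, hs.trans hK'G,
    fun x hx => h1.self_of_nhdsSet x hx⟩

variable [MeasurableSpace E] [BorelSpace E] {μ : Measure E} [μ.IsAddHaarMeasure]

/-- Integration by parts against a Lipschitz function with compact support in an open set on which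
the other function is continuously differentiable. -/
lemma integral_fderiv_mul_add_mul_fderiv_eq_zero {G : Set E} (hG : IsOpen G) {f ζ : E → ℝ}
    (hf : ContDiffOn ℝ 1 f G) {L : ℝ≥0} (hζ : LipschitzWith L ζ) (hc : HasCompactSupport ζ)
    (hs : tsupport ζ ⊆ G) (v : E) :
    Integrable (fun p => fderiv ℝ f p v * ζ p + f p * fderiv ℝ ζ p v) μ ∧
      ∫ p, (fderiv ℝ f p v * ζ p + f p * fderiv ℝ ζ p v) ∂μ = 0 := by
  -- Multiplying `f` by a cut-off equal to `1` on the support of `ζ` makes it globally `C¹` with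
  -- compact support, hence Lipschitz. The formula for two Lipschitz functions on the whole space
  -- then applies, and the cut-off is invisible in the integrands.
  obtain ⟨χ, hχ, hχc, hχG, hχ1⟩ := exists_contDiff_cutoff hc hG hs
  set g : E → ℝ := fun x => χ x * f x
  have hg : ContDiff ℝ 1 g := by
    refine contDiff_iff_contDiffAt.2 fun x => ?_
    by_cases hx : x ∈ tsupport χ
    · exact hχ.contDiffAt.mul (hf.contDiffAt (hG.mem_nhds (hχG hx)))
    · have : g =ᶠ[𝓝 x] fun _ => 0 := by
        filter_upwards [(isClosed_tsupport χ).isOpen_compl.mem_nhds hx] with y hy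
        simp only [g, image_eq_zero_of_notMem_tsupport hy, zero_mul]
      exact contDiffAt_const.congr_of_eventuallyEq this
  have hgc : HasCompactSupport g := hχc.mul_right
  obtain ⟨C, hC⟩ := hg.lipschitzWith_of_hasCompactSupport hgc one_ne_zero
  have hd := hζ.ae_differentiableAt (μ := μ)
  have e1 : ∀ᵐ p ∂μ, lineDeriv ℝ ζ p v * g p = f p * fderiv ℝ ζ p v := by
    filter_upwards [hd] with p hp
    rw [hp.lineDeriv_eq_fderiv]
    by_cases hps : p ∈ tsupport ζ
    · simp only [g, hχ1 p hps]
      ring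
    · have : fderiv ℝ ζ p = 0 := by
        by_contra h
        exact hps (support_fderiv_subset ℝ h)
      simp [this]
  have e2 : ∀ p, lineDeriv ℝ g p v * ζ p = fderiv ℝ f p v * ζ p := by
    intro p
    by_cases hps : ζ p = 0
    · simp [hps]
    · have : g =ᶠ[𝓝 p] f := by
        filter_upwards [hζ.continuous.continuousAt.eventually_ne hps] with y hy
        simp only [g, hχ1 y (subset_tsupport ζ hy), one_mul]
      rw [(hg.differentiable one_ne_zero p).lineDeriv_eq_fderiv, this.fderiv_eq]
  have hI1 : Integrable (fun p => f p * fderiv ℝ ζ p v) μ := by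
    have hi : Integrable (fun p => lineDeriv ℝ ζ p v * g p) μ := by
      refine (hg.continuous.integrable_of_hasCompactSupport hgc).bdd_mul (c := L * ‖v‖)
        (measurable_lineDeriv hζ.continuous).aestronglyMeasurable
        (ae_of_all _ fun p => norm_lineDeriv_le_of_lipschitz ℝ hζ)
    exact hi.congr e1
  have hI2 : Integrable (fun p => fderiv ℝ f p v * ζ p) μ := by
    have hi : Integrable (fun p => lineDeriv ℝ g p v * ζ p) μ := by
      refine (hζ.continuous.integrable_of_hasCompactSupport hc).bdd_mul (c := C * ‖v‖)
        (measurable_lineDeriv hC.continuous).aestronglyMeasurable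
        (ae_of_all _ fun p => norm_lineDeriv_le_of_lipschitz ℝ hC)
    exact hi.congr (ae_of_all _ e2)
  refine ⟨hI2.add hI1, ?_⟩
  have h1 := hζ.integral_lineDeriv_mul_eq (μ := μ) hC hgc v
  have h2 : ∀ p, lineDeriv ℝ g p (-v) * ζ p = -(fderiv ℝ f p v * ζ p) := by
    intro p
    rw [← e2, (hg.differentiable one_ne_zero p).lineDeriv_eq_fderiv,
      (hg.differentiable one_ne_zero p).lineDeriv_eq_fderiv, map_neg, neg_mul]
  rw [integral_add hI2 hI1, ← integral_congr_ae e1, h1, integral_congr_ae (ae_of_all _ h2),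
    integral_neg, add_neg_cancel]

end Cutoff

instance isAddHaarMeasure_prod {E F : Type*} [NormedAddCommGroup E] [InnerProductSpace ℝ E]
    [FiniteDimensional ℝ E] [MeasurableSpace E] [BorelSpace E] [NormedAddCommGroup F]
    [InnerProductSpace ℝ F] [FiniteDimensional ℝ F] [MeasurableSpace F] [BorelSpace F] :
    (volume : Measure (E × F)).IsAddHaarMeasure :=
  Measure.prod.instIsAddHaarMeasure _ _

/-! ### The energy flux and the energy identity inside one phase -/

/-- The dual of space-time. -/
abbrev Covector (d : ℕ) : Type := ℝ × Space d →L[ℝ] ℝ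

/-- The spatial part of a space-time covector. -/
def spacePart (ξ : Covector d) : Space d :=
  WithLp.toLp 2 fun j => ξ (0, EuclideanSpace.single j 1)

lemma inner_spacePart (ξ : Covector d) (z : Space d) : ⟪spacePart ξ, z⟫_ℝ = ξ (0, z) := by
  have h : ((0 : ℝ), z) = ∑ j, z j • ((0 : ℝ), EuclideanSpace.single j (1 : ℝ)) := by
    ext1
    · simp [Prod.fst_sum]
    · rw [Prod.snd_sum]
      ext i
      simp [Finset.sum_apply, Pi.single_apply]
  rw [h, map_sum, PiLp.inner_apply]
  refine Finset.sum_congr rfl fun j _ => ?_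
  rw [map_smul]
  simp [spacePart]

lemma norm_spacePart_le (ξ : Covector d) : ‖spacePart ξ‖ ≤ ‖ξ‖ := by
  have h1 : ‖spacePart ξ‖ ^ 2 ≤ ‖ξ‖ * ‖spacePart ξ‖ := by
    rw [← real_inner_self_eq_norm_sq, inner_spacePart]
    refine (le_abs_self _).trans ((ξ.le_opNorm _).trans_eq ?_)
    rw [Prod.norm_mk, norm_zero, max_eq_right (norm_nonneg _)]
  by_contra! h
  have : 0 < ‖spacePart ξ‖ := (norm_nonneg _).trans_lt h
  nlinarith

lemma continuous_spacePart : Continuous (spacePart : Covector d → Space d) := by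
  unfold spacePart
  refine (PiLp.continuous_toLp 2 _).comp (continuous_pi fun j => ?_)
  exact (ContinuousLinearMap.apply ℝ ℝ _).continuous

/-- The space-time flux `(a², -2 b a A)` of the energy, paired with a covector. -/
def flux (b a : ℝ) (A ξ : Covector d) : ℝ :=
  a ^ 2 * ξ (1, 0) - 2 * b * a * ⟪spacePart A, spacePart ξ⟫_ℝ

lemma flux_add (b a : ℝ) (A ξ η : Covector d) : flux b a A (ξ + η) = flux b a A ξ + flux b a A η := by
  simp only [flux]
  rw [real_inner_comm, inner_spacePart, real_inner_comm, inner_spacePart,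
    real_inner_comm (spacePart η) (spacePart A), inner_spacePart]
  simp only [add_apply]
  ring

lemma flux_smul (b a r : ℝ) (A ξ : Covector d) : flux b a A (r • ξ) = r * flux b a A ξ := by
  simp only [flux]
  rw [real_inner_comm, inner_spacePart, real_inner_comm, inner_spacePart]
  simp only [smul_apply, smul_eq_mul]
  ring

@[simp] lemma flux_zero (b a : ℝ) (A : Covector d) : flux b a A 0 = 0 := by
  simpa using flux_smul b a 0 A 0

/-- One factor `|a|` is kept while all others are absorbed into `M`. This makes the outer boundary
term linear in the error. -/
lemma abs_flux_le {b a M : ℝ} (hb : 0 ≤ b) {A : Covector d} (ha : |a| ≤ M) (hA : ‖A‖ ≤ M)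
    (ξ : Covector d) : |flux b a A ξ| ≤ (1 + 2 * b) * M * |a| * ‖ξ‖ := by
  have h1 : |ξ (1, 0)| ≤ ‖ξ‖ := by
    refine (ξ.le_opNorm _).trans_eq ?_
    simp [Prod.norm_mk]
  have h2 : |⟪spacePart A, spacePart ξ⟫_ℝ| ≤ M * ‖ξ‖ :=
    (abs_real_inner_le_norm _ _).trans
      (mul_le_mul ((norm_spacePart_le A).trans hA) (norm_spacePart_le ξ) (norm_nonneg _)
        ((norm_nonneg A).trans hA))
  have h3 : |a ^ 2 * ξ (1, 0)| ≤ M * |a| * ‖ξ‖ := by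
    rw [abs_mul, abs_pow, sq]
    exact mul_le_mul (mul_le_mul_of_nonneg_right ha (abs_nonneg a)) h1 (abs_nonneg _)
      (mul_nonneg ((norm_nonneg A).trans hA) (abs_nonneg a))
  have h4 : |2 * b * a * ⟪spacePart A, spacePart ξ⟫_ℝ| ≤ 2 * b * |a| * (M * ‖ξ‖) := by
    rw [abs_mul, abs_mul, abs_of_nonneg (by positivity : 0 ≤ 2 * b)]
    gcongr
  rw [flux]
  refine (abs_sub _ _).trans ?_
  linarith

lemma continuous_flux (b : ℝ) :
    Continuous fun z : ℝ × Covector d × Covector d => flux b z.1 z.2.1 z.2.2 := by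
  have := continuous_spacePart (d := d)
  unfold flux
  have h : Continuous fun z : ℝ × Covector d × Covector d => z.2.2 (1, 0) :=
    (ContinuousLinearMap.apply ℝ ℝ ((1, 0) : ℝ × Space d)).continuous.comp (by fun_prop)
  fun_prop

/-- A function that is `C^2` with bounded derivatives up to the boundary of a bounded open set. -/
structure Phase (Q G : Set (ℝ × Space d)) (w : ℝ × Space d → ℝ) (M : ℝ) : Prop where
  isOpen : IsOpen G
  subset : G ⊆ Q
  isBounded : Bornology.IsBounded G
  contDiffOn : ContDiffOn ℝ 2 w Q
  abs_le : ∀ p ∈ Q, |w p| ≤ M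
  norm_fderiv_le : ∀ p ∈ G, ‖fderivWithin ℝ w Q p‖ ≤ M
  norm_iteratedFDeriv_le : ∀ p ∈ G, ‖iteratedFDerivWithin ℝ 2 w Q p‖ ≤ M

/-- The interior density of the energy identity. -/
def density (Q : Set (ℝ × Space d)) (b : ℝ) (w : ℝ × Space d → ℝ) (p : ℝ × Space d) : ℝ :=
  2 * w p * (timeDeriv Q w p - b * spaceLaplacian Q w p) - 2 * b * ‖spaceGrad Q w p‖ ^ 2

/-- The integrand of the energy identity with the test function `ζ`. -/
def weakIntegrand (Q : Set (ℝ × Space d)) (b : ℝ) (w ζ : ℝ × Space d → ℝ) (p : ℝ × Space d) : ℝ :=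
  density Q b w p * ζ p + flux b (w p) (fderivWithin ℝ w Q p) (fderiv ℝ ζ p)

namespace Phase

variable {Q G : Set (ℝ × Space d)} {w : ℝ × Space d → ℝ} {M b : ℝ}

lemma integrableOn (h : Phase Q G w M) {f : ℝ × Space d → ℝ} {C : ℝ}
    (hf : AEStronglyMeasurable f (volume.restrict G)) (hC : ∀ᵐ p, p ∈ G → |f p| ≤ C) :
    IntegrableOn f G :=
  haveI : IsFiniteMeasure (volume.restrict G) := ⟨by
    rw [Measure.restrict_apply_univ]
    exact h.isBounded.measure_lt_top⟩
  Integrable.of_bound hf C ((ae_restrict_iff' h.isOpen.measurableSet).2 hC)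

lemma contDiffOn_interior (h : Phase Q G w M) : ContDiffOn ℝ 2 w G := h.contDiffOn.mono h.subset

lemma mem_nhds (h : Phase Q G w M) {p : ℝ × Space d} (hp : p ∈ G) : Q ∈ 𝓝 p :=
  mem_of_superset (h.isOpen.mem_nhds hp) h.subset

lemma fderivWithin_eq (h : Phase Q G w M) {p : ℝ × Space d} (hp : p ∈ G) :
    fderivWithin ℝ w Q p = fderiv ℝ w p := fderivWithin_of_mem_nhds (h.mem_nhds hp)

lemma iteratedFDerivWithin_eq (h : Phase Q G w M) (n : ℕ) {p : ℝ × Space d} (hp : p ∈ G) :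
    iteratedFDerivWithin ℝ n w Q p = iteratedFDeriv ℝ n w p := by
  rw [← iteratedFDerivWithin_univ]
  refine iteratedFDerivWithin_congr_set ?_ n
  exact eventuallyEq_univ.2 (h.mem_nhds hp)

lemma contDiffOn_fderiv (h : Phase Q G w M) : ContDiffOn ℝ 1 (fderiv ℝ w) G :=
  h.contDiffOn_interior.fderiv_of_isOpen h.isOpen (by norm_num)

lemma continuousOn_fderivWithin (h : Phase Q G w M) : ContinuousOn (fderivWithin ℝ w Q) G :=
  h.contDiffOn_fderiv.continuousOn.congr fun _ hp => h.fderivWithin_eq hp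

lemma continuousOn_density (h : Phase Q G w M) (b : ℝ) : ContinuousOn (density Q b w) G := by
  have h1 := h.continuousOn_fderivWithin
  have h0 := h.contDiffOn_interior.continuousOn
  have h2 : ContinuousOn (fun p => timeDeriv Q w p) G := by
    unfold timeDeriv
    exact h1.clm_apply continuousOn_const
  have h3 : ContinuousOn (fun p => spaceGrad Q w p) G :=
    continuous_spacePart.comp_continuousOn h1
  have h4 : ContinuousOn (fun p => spaceLaplacian Q w p) G := by
    have h5 : ContinuousOn (iteratedFDerivWithin ℝ 2 w Q) G := by
      have := h.contDiffOn_interior.continuousOn_iteratedFDerivWithin (m := 2) le_rfl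
        h.isOpen.uniqueDiffOn
      refine this.congr fun p hp => ?_
      rw [h.iteratedFDerivWithin_eq 2 hp, iteratedFDerivWithin_of_isOpen 2 h.isOpen hp]
    unfold spaceLaplacian
    refine continuousOn_finsetSum _ fun j _ => ?_
    exact (ContinuousMultilinearMap.apply ℝ (fun _ : Fin 2 => ℝ × Space d) ℝ
      (fun _ => (0, EuclideanSpace.single j 1))).continuous.comp_continuousOn h5
  unfold density
  fun_prop

lemma abs_timeDeriv_le (h : Phase Q G w M) {p : ℝ × Space d} (hp : p ∈ G) :
    |timeDeriv Q w p| ≤ M := by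
  refine ((fderivWithin ℝ w Q p).le_opNorm (1, 0)).trans ?_
  simpa [Prod.norm_mk] using h.norm_fderiv_le p hp

lemma abs_spaceLaplacian_le (h : Phase Q G w M) {p : ℝ × Space d} (hp : p ∈ G) :
    |spaceLaplacian Q w p| ≤ d * M := by
  have h1 : ∀ j : Fin d, |iteratedFDerivWithin ℝ 2 w Q p
      fun _ => ((0 : ℝ), EuclideanSpace.single j (1 : ℝ))| ≤ M := by
    intro j
    refine ((iteratedFDerivWithin ℝ 2 w Q p).le_opNorm _).trans ?_
    simpa [Prod.norm_mk] using h.norm_iteratedFDeriv_le p hp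
  refine (Finset.abs_sum_le_sum_abs _ _).trans ((Finset.sum_le_sum fun j _ => h1 j).trans ?_)
  simp

lemma norm_spaceGrad_le (h : Phase Q G w M) {p : ℝ × Space d} (hp : p ∈ G) :
    ‖spaceGrad Q w p‖ ≤ M := (norm_spacePart_le _).trans (h.norm_fderiv_le p hp)

lemma exists_abs_density_le (h : Phase Q G w M) (b : ℝ) : ∃ C, ∀ p ∈ G, |density Q b w p| ≤ C := by
  refine ⟨2 * M * (M + |b| * (d * M)) + 2 * |b| * M ^ 2, fun p hp => ?_⟩
  have h1 := h.abs_le p (h.subset hp)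
  have h2 := h.abs_timeDeriv_le hp
  have h3 := h.abs_spaceLaplacian_le hp
  have h4 := h.norm_spaceGrad_le hp
  have hM : 0 ≤ M := (abs_nonneg _).trans h1
  have h5 : |timeDeriv Q w p - b * spaceLaplacian Q w p| ≤ M + |b| * (d * M) := by
    refine (abs_sub _ _).trans (add_le_add h2 ?_)
    rw [abs_mul]
    gcongr
  rw [density]
  refine (abs_sub _ _).trans (add_le_add ?_ ?_)
  · rw [abs_mul, abs_mul, abs_two]
    gcongr
  · rw [abs_mul, abs_mul, abs_two, abs_pow, abs_norm]
    gcongr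

lemma aestronglyMeasurable_flux (h : Phase Q G w M) (b : ℝ) {ξ : ℝ × Space d → Covector d}
    (hξ : Measurable ξ) : AEStronglyMeasurable
      (fun p => flux b (w p) (fderivWithin ℝ w Q p) (ξ p)) (volume.restrict G) := by
  have h1 := h.contDiffOn_interior.continuousOn.aestronglyMeasurable (μ := volume)
    h.isOpen.measurableSet
  have h2 := h.continuousOn_fderivWithin.aestronglyMeasurable (μ := volume) h.isOpen.measurableSet
  exact (continuous_flux b).comp_aestronglyMeasurable
    (h1.prodMk (h2.prodMk hξ.aestronglyMeasurable))

lemma integrableOn_flux (h : Phase Q G w M) (hb : 0 ≤ b) {ξ : ℝ × Space d → Covector d} {L : ℝ}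
    (hξ : Measurable ξ) (hL : ∀ p, ‖ξ p‖ ≤ L) :
    IntegrableOn (fun p => flux b (w p) (fderivWithin ℝ w Q p) (ξ p)) G := by
  refine h.integrableOn (C := (1 + 2 * b) * M * M * L) (h.aestronglyMeasurable_flux b hξ)
    (ae_of_all _ fun p hp => ?_)
  have h1 := h.abs_le p (h.subset hp)
  have hM : 0 ≤ M := (abs_nonneg _).trans h1
  refine (abs_flux_le hb h1 (h.norm_fderiv_le p hp) _).trans ?_
  gcongr
  exact hL p

lemma integrableOn_density_mul (h : Phase Q G w M) (b : ℝ) {ζ : ℝ × Space d → ℝ}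
    (hζ : Continuous ζ) {C : ℝ} (hC : ∀ p, |ζ p| ≤ C) :
    IntegrableOn (fun p => density Q b w p * ζ p) G := by
  obtain ⟨D, hD⟩ := h.exists_abs_density_le b
  refine h.integrableOn (C := D * C) ?_ (ae_of_all _ fun p hp => ?_)
  · exact ((h.continuousOn_density b).mul hζ.continuousOn).aestronglyMeasurable
      h.isOpen.measurableSet
  · rw [abs_mul]
    exact mul_le_mul (hD p hp) (hC p) (abs_nonneg _) ((abs_nonneg _).trans (hD p hp))

lemma integrableOn_weakIntegrand (h : Phase Q G w M) (hb : 0 ≤ b) {ζ : ℝ × Space d → ℝ} {L : ℝ≥0}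
    (hζ : LipschitzWith L ζ) {C : ℝ} (hC : ∀ p, |ζ p| ≤ C) :
    IntegrableOn (weakIntegrand Q b w ζ) G :=
  (h.integrableOn_density_mul b hζ.continuous hC).add
    (h.integrableOn_flux hb (measurable_fderiv ℝ ζ) fun _ => norm_fderiv_le_of_lipschitz ℝ hζ)

/-- The energy identity for a test function with compact support in the phase. -/
lemma integral_weakIntegrand_eq_zero (h : Phase Q G w M) (b : ℝ) {ζ : ℝ × Space d → ℝ} {L : ℝ≥0}
    (hζ : LipschitzWith L ζ) (hc : HasCompactSupport ζ) (hs : tsupport ζ ⊆ G) :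
    ∫ p in G, weakIntegrand Q b w ζ p = 0 := by
  have hd := h.contDiffOn_fderiv
  have hw1 : ContDiffOn ℝ 1 w G := h.contDiffOn_interior.of_le (by norm_num)
  set e : Fin d → ℝ × Space d := fun j => (0, EuclideanSpace.single j 1)
  set f : Fin d → ℝ × Space d → ℝ := fun j p => w p * fderiv ℝ w p (e j)
  have hdj : ∀ j, ContDiffOn ℝ 1 (fun p => fderiv ℝ w p (e j)) G := fun j =>
    hd.clm_apply contDiffOn_const
  have hf : ∀ j, ContDiffOn ℝ 1 (f j) G := fun j => hw1.mul (hdj j)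
  obtain ⟨i0, z0⟩ := integral_fderiv_mul_add_mul_fderiv_eq_zero (μ := volume) h.isOpen
    (hw1.pow 2) hζ hc hs (1, 0)
  have hj := fun j => integral_fderiv_mul_add_mul_fderiv_eq_zero (μ := volume) h.isOpen
    (hf j) hζ hc hs (e j)
  have hout : ∀ p ∉ tsupport ζ, ζ p = 0 ∧ fderiv ℝ ζ p = 0 := fun p hp =>
    ⟨image_eq_zero_of_notMem_tsupport hp, by
      by_contra h'
      exact hp (support_fderiv_subset ℝ h')⟩
  -- The integrand is the space-time divergence of `ζ (w², -2 b w ∇w)`, by `∂_t w² = 2 w ∂_t w` and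
  -- `∂_j (w ∂_j w) = (∂_j w)² + w ∂_j² w`. Each summand integrates to zero.
  have key : ∀ p, weakIntegrand Q b w ζ p =
      (fderiv ℝ (fun p => w p ^ 2) p (1, 0) * ζ p + w p ^ 2 * fderiv ℝ ζ p (1, 0)) -
        ∑ j, 2 * b * (fderiv ℝ (f j) p (e j) * ζ p + f j p * fderiv ℝ ζ p (e j)) := by
    intro p
    by_cases hp : p ∈ tsupport ζ
    · have hpG := hs hp
      have hwd : DifferentiableAt ℝ w p :=
        (hw1.contDiffAt (h.isOpen.mem_nhds hpG)).differentiableAt one_ne_zero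
      have hdd : DifferentiableAt ℝ (fderiv ℝ w) p :=
        (hd.contDiffAt (h.isOpen.mem_nhds hpG)).differentiableAt one_ne_zero
      have e0 : fderiv ℝ (fun p => w p ^ 2) p (1, 0) = 2 * w p * fderiv ℝ w p (1, 0) := by
        rw [fderiv_fun_pow 2 hwd]
        simp
      have ej : ∀ j, fderiv ℝ (f j) p (e j) = fderiv ℝ w p (e j) ^ 2 +
          w p * iteratedFDeriv ℝ 2 w p (fun _ => e j) := by
        intro j
        have hx : DifferentiableAt ℝ (fun p => fderiv ℝ w p (e j)) p :=
          hdd.clm_apply (differentiableAt_const _)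
        rw [fderiv_fun_mul hwd hx, iteratedFDeriv_two_apply, fderiv_clm_apply hdd
          (differentiableAt_const _)]
        simp
        ring
      have eg : ‖spaceGrad Q w p‖ ^ 2 = ∑ j, fderiv ℝ w p (e j) ^ 2 := by
        rw [spaceGrad, h.fderivWithin_eq hpG, EuclideanSpace.norm_sq_eq]
        simp [e]
      have ei : ⟪spacePart (fderiv ℝ w p), spacePart (fderiv ℝ ζ p)⟫_ℝ =
          ∑ j, fderiv ℝ w p (e j) * fderiv ℝ ζ p (e j) := by
        rw [PiLp.inner_apply]
        simp [spacePart, e, mul_comm]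
      have el : spaceLaplacian Q w p = ∑ j, iteratedFDeriv ℝ 2 w p (fun _ => e j) := by
        rw [spaceLaplacian, h.iteratedFDerivWithin_eq 2 hpG]
      rw [weakIntegrand, density, flux, timeDeriv, h.fderivWithin_eq hpG, eg, ei, el, e0]
      simp only [ej, f]
      have es : ∑ j, 2 * b * ((fderiv ℝ w p (e j) ^ 2 +
          w p * iteratedFDeriv ℝ 2 w p (fun _ => e j)) * ζ p +
          w p * fderiv ℝ w p (e j) * fderiv ℝ ζ p (e j)) =
          2 * b * ζ p * ∑ j, fderiv ℝ w p (e j) ^ 2 +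
          2 * b * w p * ζ p * ∑ j, iteratedFDeriv ℝ 2 w p (fun _ => e j) +
          2 * b * w p * ∑ j, fderiv ℝ w p (e j) * fderiv ℝ ζ p (e j) := by
        rw [Finset.mul_sum, Finset.mul_sum, Finset.mul_sum, ← Finset.sum_add_distrib,
          ← Finset.sum_add_distrib]
        refine Finset.sum_congr rfl fun j _ => ?_
        ring
      rw [es]
      ring
    · obtain ⟨h1, h2⟩ := hout p hp
      simp [weakIntegrand, h1, h2]
  rw [setIntegral_eq_integral_of_forall_compl_eq_zero]
  · simp_rw [key]
    rw [integral_sub i0 (integrable_finsetSum _ fun j _ => (hj j).1.const_mul _), z0,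
      integral_finsetSum _ fun j _ => (hj j).1.const_mul _]
    simp_rw [integral_const_mul, (hj _).2]
    simp
  · intro p hp
    obtain ⟨h1, h2⟩ := hout p fun h' => hp (hs h')
    simp [weakIntegrand, h1, h2]

end Phase

/-! ### Ramps near a graph -/

/-- The piecewise linear ramp from `0` at `1` to `1` at `2`. -/
def ramp (r : ℝ) : ℝ := max 0 (min 1 (r - 1))

lemma ramp_nonneg (r : ℝ) : 0 ≤ ramp r := le_max_left _ _

lemma ramp_le_one (r : ℝ) : ramp r ≤ 1 := max_le zero_le_one (min_le_left _ _)

lemma abs_ramp_le_one (r : ℝ) : |ramp r| ≤ 1 := by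
  rw [abs_of_nonneg (ramp_nonneg r)]
  exact ramp_le_one r

lemma ramp_of_le {r : ℝ} (hr : r ≤ 1) : ramp r = 0 :=
  max_eq_left ((min_le_right _ _).trans (by linarith))

lemma ramp_of_ge {r : ℝ} (hr : 2 ≤ r) : ramp r = 1 := by
  rw [ramp, min_eq_left (by linarith), max_eq_right zero_le_one]

lemma ramp_of_mem {r : ℝ} (hr : r ∈ Icc 1 2) : ramp r = r - 1 := by
  rw [ramp, min_eq_right (by linarith [hr.2]), max_eq_right (by linarith [hr.1])]

lemma lipschitzWith_ramp : LipschitzWith 1 ramp := by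
  have h1 : LipschitzWith 1 fun r : ℝ => r - 1 := by
    simpa using LipschitzWith.id.sub (LipschitzWith.const (α := ℝ) (1 : ℝ))
  exact (h1.const_min 1).const_max 0

lemma hasDerivAt_ramp {r : ℝ} (h1 : r ≠ 1) (h2 : r ≠ 2) :
    HasDerivAt ramp (indicator (Ioo 1 2) 1 r) r := by
  rcases lt_or_gt_of_ne h1 with h | h
  · rw [indicator_of_notMem fun h' => lt_asymm h h'.1]
    refine (hasDerivAt_const r (0 : ℝ)).congr_of_eventuallyEq ?_
    filter_upwards [Iio_mem_nhds h] with s hs using ramp_of_le (le_of_lt hs)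
  · rcases lt_or_gt_of_ne h2 with h' | h'
    · rw [indicator_of_mem (show r ∈ Ioo (1 : ℝ) 2 from ⟨h, h'⟩)]
      refine ((hasDerivAt_id r).sub_const 1).congr_of_eventuallyEq ?_
      filter_upwards [Ioo_mem_nhds h h'] with s hs
      exact ramp_of_mem ⟨le_of_lt hs.1, le_of_lt hs.2⟩
    · rw [indicator_of_notMem fun h'' => lt_asymm h' h''.2]
      refine (hasDerivAt_const r (1 : ℝ)).congr_of_eventuallyEq ?_
      filter_upwards [Ioi_mem_nhds h'] with s hs using ramp_of_ge (le_of_lt hs)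

lemma LipschitzWith.exists_mul {X : Type*} [PseudoMetricSpace X] {f g : X → ℝ} {L L' : ℝ≥0}
    (hf : LipschitzWith L f) (hg : LipschitzWith L' g) {A B : ℝ} (hA : ∀ x, |f x| ≤ A)
    (hB : ∀ x, |g x| ≤ B) : ∃ L'', LipschitzWith L'' fun x => f x * g x := by
  refine ⟨A.toNNReal * L' + B.toNNReal * L, LipschitzWith.of_dist_le_mul fun x y => ?_⟩
  have h1 := hf.dist_le_mul x y
  have h2 := hg.dist_le_mul x y
  have hA0 : 0 ≤ A := (abs_nonneg _).trans (hA x)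
  have hB0 : 0 ≤ B := (abs_nonneg _).trans (hB x)
  rw [Real.dist_eq] at h1 h2 ⊢
  simp only [NNReal.coe_add, NNReal.coe_mul, Real.coe_toNNReal _ hA0, Real.coe_toNNReal _ hB0]
  have e : f x * g x - f y * g y = f x * (g x - g y) + g y * (f x - f y) := by ring
  rw [e]
  refine (abs_add_le _ _).trans ?_
  rw [abs_mul, abs_mul]
  have h3 : |f x| * |g x - g y| ≤ A * (L' * dist x y) :=
    mul_le_mul (hA x) h2 (abs_nonneg _) hA0
  have h4 : |g y| * |f x - f y| ≤ B * (L * dist x y) :=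
    mul_le_mul (hB y) h1 (abs_nonneg _) hB0
  linarith

lemma exists_abs_le_of_hasCompactSupport {X : Type*} [TopologicalSpace X] {f : X → ℝ}
    (hf : Continuous f) (hc : HasCompactSupport f) : ∃ A, ∀ x, |f x| ≤ A :=
  hc.exists_bound_of_continuous hf

namespace GraphChart

variable (c : GraphChart d)

/-- The ramp on the side `σ` of the graph, at scale `ε`. -/
def rampAt (σ ε : ℝ) (p : ℝ × Space d) : ℝ := ramp (σ * c.height p / ε)

lemma exists_lipschitzWith_rampAt (σ ε : ℝ) : ∃ L, LipschitzWith L (c.rampAt σ ε) := by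
  have h : c.rampAt σ ε = ramp ∘ (fun r => (σ / ε) * r) ∘ c.height := by
    ext p
    simp only [rampAt, Function.comp]
    congr 1
    ring
  rw [h]
  exact ⟨_, lipschitzWith_ramp.comp ((lipschitzWith_smul (σ / ε)).comp c.lipschitzWith_height)⟩

/-- The ramp has two kinks, whose preimages are level sets of the height and therefore null;
elsewhere the chain rule applies wherever the height is differentiable. -/
lemma ae_hasFDerivAt_rampAt {σ ε : ℝ} (hσ : σ ≠ 0) (hε : 0 < ε) : ∀ᵐ p, HasFDerivAt (c.rampAt σ ε)
    ((indicator (Ioo 1 2) 1 (σ * c.height p / ε) * (σ / ε)) • fderiv ℝ c.height p) p := by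
  filter_upwards [c.lipschitzWith_height.ae_differentiableAt, c.ae_height_ne (ε / σ),
    c.ae_height_ne (2 * ε / σ)] with p hp h1 h2
  have h1' : σ * c.height p / ε ≠ 1 := by
    intro h
    apply h1
    field_simp at h ⊢
    linarith
  have h2' : σ * c.height p / ε ≠ 2 := by
    intro h
    apply h2
    field_simp at h ⊢
    linarith
  have h3 : HasFDerivAt (fun q => σ * c.height q / ε) ((σ / ε) • fderiv ℝ c.height p) p := by
    have := hp.hasFDerivAt.const_mul (σ / ε)
    refine this.congr_of_eventuallyEq (Eventually.of_forall fun q => ?_)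
    ring
  have := (hasDerivAt_ramp h1' h2').comp_hasFDerivAt p h3
  rw [smul_smul] at this
  exact this

/-- The derivative of the height is constant along the direction across the hyperplane. -/
lemma fderiv_height_param (ε : ℝ) (y : (ℝ × Base d) × ℝ) :
    fderiv ℝ c.height (c.param ε y) = fderiv ℝ c.height (c.param 0 y) := by
  set v : ℝ × Space d := (0, (ε * y.2) • c.up)
  have h1 : c.param ε y = c.param 0 y + v := by
    have : WithLp.toLp 2 (y.1.2, c.profile y.1 + ε * y.2) =
        WithLp.toLp 2 (y.1.2, c.profile y.1 + 0 * y.2) +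
          (ε * y.2) • WithLp.toLp 2 ((0 : Base d), (1 : ℝ)) := by
      rw [← WithLp.toLp_smul, ← WithLp.toLp_add]
      simp
    simp only [param, v, up, Prod.mk_add_mk, add_zero]
    rw [← map_smul, ← map_add, this]
  have h2 : (fun q => c.height (q + v)) = fun q => c.height q + ε * y.2 := by
    ext q
    have := c.height_add_smul_up q.1 q.2 (ε * y.2)
    rw [← this]
    simp [v, Prod.add_def]
  rw [h1, ← fderiv_comp_add_right, h2, fderiv_add_const]

lemma quasiMeasurePreserving_param {ε : ℝ} (hε : ε ≠ 0) :
    Measure.QuasiMeasurePreserving (c.param ε) := by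
  refine ⟨(c.continuous_param ε).measurable, ?_⟩
  rw [c.map_param hε]
  exact Measure.smul_absolutelyContinuous

/-- The part of the parameter space with relative height between `1` and `2`. -/
def slab (d : ℕ) : Set ((ℝ × Base d) × ℝ) := {y | y.2 ∈ Ioo 1 2}

lemma measurableSet_slab : MeasurableSet (slab d) := measurable_snd measurableSet_Ioo

end GraphChart

open GraphChart

/-! ### Traces on a graph as limits of thin layers -/

/-- The flux of the energy through the graph, weighted by `ζ`. -/
def traceIntegrand (c : GraphChart d) (Q : Set (ℝ × Space d)) (b : ℝ) (w ζ : ℝ × Space d → ℝ)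
    (y : (ℝ × Base d) × ℝ) : ℝ :=
  ζ (c.param 0 y) * flux b (w (c.param 0 y)) (fderivWithin ℝ w Q (c.param 0 y))
    (fderiv ℝ c.height (c.param 0 y))

/-- The set of parameters over a compact set, with bounded heights. -/
lemma exists_isBounded_param (c : GraphChart d) {K : Set (ℝ × Space d)} (hK : IsCompact K) (r : ℝ) :
    ∃ B : Set ((ℝ × Base d) × ℝ), MeasurableSet B ∧ volume B ≠ ∞ ∧
      ∀ ε y, c.param ε y ∈ K → |y.2| ≤ r → y ∈ B := by
  have hcont : Continuous fun q : ℝ × Space d => (q.1, c.base q.2) := by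
    have := c.lipschitzWith_base.continuous
    fun_prop
  have hB : IsCompact (((fun q : ℝ × Space d => (q.1, c.base q.2)) '' K) ×ˢ Icc (-r) r) :=
    (hK.image hcont).prod isCompact_Icc
  refine ⟨_, hB.measurableSet, hB.measure_lt_top.ne, fun ε y hy hr => ⟨⟨_, hy, ?_⟩, abs_le.1 hr⟩⟩
  simp [param]

namespace Phase

variable {Q G : Set (ℝ × Space d)} {w ζ : ℝ × Space d → ℝ} {M b : ℝ}

/-- Leibniz rule, using that the flux is linear in its covector. For a ramp `k` the last term is the
one that concentrates on the graph. -/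
lemma ae_weakIntegrand_mul {k : ℝ × Space d → ℝ} (hζ : ∀ᵐ p, DifferentiableAt ℝ ζ p)
    (hk : ∀ᵐ p, DifferentiableAt ℝ k p) (Q : Set (ℝ × Space d)) (b : ℝ) (w : ℝ × Space d → ℝ) :
    ∀ᵐ p, weakIntegrand Q b w (fun q => ζ q * k q) p = k p * weakIntegrand Q b w ζ p +
      ζ p * flux b (w p) (fderivWithin ℝ w Q p) (fderiv ℝ k p) := by
  filter_upwards [hζ, hk] with p h1 h2
  rw [weakIntegrand, weakIntegrand, fderiv_fun_mul h1 h2, flux_add, flux_smul, flux_smul]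
  ring

/-- The scaled integrand of the energy flux through a thin layer on one side of a graph converges
to the energy flux through the graph. -/
lemma tendsto_layer (h : Phase Q G w M) (hb : 0 ≤ b) (c : GraphChart d) {σ : ℝ} (hσ : |σ| = 1)
    (hζ : Continuous ζ) (hc : HasCompactSupport ζ)
    (hG : ∀ p ∈ tsupport ζ, 0 < σ * c.height p → p ∈ G)
    (hQ : ∀ p ∈ tsupport ζ, c.height p = 0 → ζ p ≠ 0 → p ∈ Q ∧ ContinuousWithinAt w Q p ∧
      ContinuousWithinAt (fderivWithin ℝ w Q) Q p)
    {ε : ℕ → ℝ} (hε : ∀ n, 0 < ε n) (hε0 : Tendsto ε atTop (𝓝 0)) :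
    IntegrableOn (traceIntegrand c Q b w ζ) (slab d) ∧
    Tendsto (fun n => ∫ p in G, ζ p * flux b (w p) (fderivWithin ℝ w Q p)
        ((indicator (Ioo 1 2) 1 (σ * c.height p / ε n) * (σ / ε n)) • fderiv ℝ c.height p)) atTop
      (𝓝 (σ * ∫ y in slab d, traceIntegrand c Q b w ζ y)) := by
  have hσ0 : σ ≠ 0 := by
    rintro rfl
    simp at hσ
  have hσ2 : σ * σ = 1 := by rw [← abs_mul_abs_self, hσ, one_mul]
  obtain ⟨A, hA⟩ := exists_abs_le_of_hasCompactSupport hζ hc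
  have hA0 : 0 ≤ A := (abs_nonneg _).trans (hA 0)
  set F : ℝ × Space d → ℝ := fun p =>
    ζ p * flux b (w p) (fderivWithin ℝ w Q p) (fderiv ℝ c.height p)
  set D : ℝ := A * ((1 + 2 * b) * |M| * |M| * c.heightLip)
  have hFG : ∀ p ∈ G, |flux b (w p) (fderivWithin ℝ w Q p) (fderiv ℝ c.height p)| ≤
      (1 + 2 * b) * |M| * |M| * c.heightLip := by
    intro p hp
    have h1 := (h.abs_le p (h.subset hp)).trans (le_abs_self M)
    refine (abs_flux_le hb h1 ((h.norm_fderiv_le p hp).trans (le_abs_self M)) _).trans ?_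
    gcongr
    exact norm_fderiv_le_of_lipschitz ℝ c.lipschitzWith_height
  -- Measuring the height in units of `σ ε n` maps every layer onto the same slab, so dominated
  -- convergence can be used there.
  set H : ℕ → ((ℝ × Base d) × ℝ) → ℝ := fun n y => G.indicator F (c.param (σ * ε n) y)
  have hFm : AEStronglyMeasurable F (volume.restrict G) :=
    hζ.aestronglyMeasurable.mul (h.aestronglyMeasurable_flux b (measurable_fderiv ℝ c.height))
  have hεσ : ∀ n, σ * ε n ≠ 0 := fun n => mul_ne_zero hσ0 (hε n).ne'
  have hHm : ∀ n, AEStronglyMeasurable (H n) (volume.restrict (slab d)) := by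
    intro n
    have h1 : AEStronglyMeasurable (G.indicator F) volume :=
      (aestronglyMeasurable_indicator_iff h.isOpen.measurableSet).2 hFm
    exact (h1.comp_quasiMeasurePreserving (c.quasiMeasurePreserving_param (hεσ n))).restrict
  obtain ⟨B, hBm, hBv, hB⟩ := exists_isBounded_param c hc 2
  have hbound : ∀ n, ∀ᵐ y ∂volume.restrict (slab d), ‖H n y‖ ≤ B.indicator (fun _ => D) y := by
    intro n
    refine (ae_restrict_iff' measurableSet_slab).2 (ae_of_all _ fun y hy => ?_)
    by_cases hK : c.param (σ * ε n) y ∈ tsupport ζ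
    · have hy2 : |y.2| ≤ 2 := _root_.abs_le.2 ⟨by linarith [hy.1], hy.2.le⟩
      rw [indicator_of_mem (hB _ _ hK hy2)]
      by_cases hpG : c.param (σ * ε n) y ∈ G
      · simp only [H]
        rw [indicator_of_mem hpG, Real.norm_eq_abs, abs_mul]
        exact mul_le_mul (hA _) (hFG _ hpG) (abs_nonneg _) hA0
      · simp only [H]
        rw [indicator_of_notMem hpG, norm_zero]
        positivity
    · have : H n y = 0 := by
        simp only [H, indicator_apply_eq_zero, F, image_eq_zero_of_notMem_tsupport hK, zero_mul,
          implies_true]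
      rw [this, norm_zero]
      exact indicator_nonneg (fun _ _ => by positivity) _
  have hBi : Integrable (B.indicator fun _ => D) (volume.restrict (slab d)) :=
    ((integrable_indicator_iff hBm).2 (integrableOn_const hBv)).restrict
  have hparam : ∀ y, Tendsto (fun n => c.param (σ * ε n) y) atTop (𝓝 (c.param 0 y)) := by
    intro y
    have h1 : Continuous fun r => c.param r y :=
      c.continuous_param_uncurry.comp (by fun_prop : Continuous fun r : ℝ => (r, y))
    have h2 : Tendsto (fun n => σ * ε n) atTop (𝓝 0) := by simpa using hε0.const_mul σ
    exact (h1.tendsto 0).comp h2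
  have hlim : ∀ᵐ y ∂volume.restrict (slab d),
      Tendsto (fun n => H n y) atTop (𝓝 (traceIntegrand c Q b w ζ y)) := by
    refine (ae_restrict_iff' measurableSet_slab).2 (ae_of_all _ fun y hy => ?_)
    have hζlim : Tendsto (fun n => ζ (c.param (σ * ε n) y)) atTop (𝓝 (ζ (c.param 0 y))) :=
      (hζ.tendsto _).comp (hparam y)
    -- Where `ζ` vanishes on the graph nothing is known about the derivatives of `w`; a bounded flux
    -- times a factor tending to zero is enough.
    by_cases h0 : ζ (c.param 0 y) = 0
    · rw [traceIntegrand, h0, zero_mul]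
      rw [h0] at hζlim
      refine squeeze_zero_norm (a := fun n => |ζ (c.param (σ * ε n) y)| *
        ((1 + 2 * b) * |M| * |M| * c.heightLip)) (fun n => ?_) ?_
      · by_cases hpG : c.param (σ * ε n) y ∈ G
        · simp only [H]
          rw [indicator_of_mem hpG, Real.norm_eq_abs, abs_mul]
          exact mul_le_mul_of_nonneg_left (hFG _ hpG) (abs_nonneg _)
        · simp only [H]
          rw [indicator_of_notMem hpG, norm_zero]
          positivity
      · simpa using hζlim.abs.mul_const _
    · obtain ⟨-, hw, hdw⟩ := hQ _ (subset_tsupport ζ h0) (by simp) h0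
      have hev : ∀ᶠ n in atTop, c.param (σ * ε n) y ∈ G := by
        filter_upwards [hζlim.eventually_ne h0] with n hn
        refine hG _ (subset_tsupport ζ hn) ?_
        rw [c.height_param, ← mul_assoc, ← mul_assoc, hσ2, one_mul]
        exact mul_pos (hε n) (by linarith [hy.1])
      -- The points approach the graph from inside `G ⊆ Q`, so continuity within `Q` identifies the
      -- limit. The derivative of the height is constant along the approach.
      have hwithin : Tendsto (fun n => c.param (σ * ε n) y) atTop (𝓝[Q] (c.param 0 y)) :=
        tendsto_nhdsWithin_iff.2 ⟨hparam y, hev.mono fun n hn => h.subset hn⟩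
      have h1 := (hw.tendsto.comp hwithin).prodMk_nhds
        ((hdw.tendsto.comp hwithin).prodMk_nhds
          (tendsto_const_nhds (x := fderiv ℝ c.height (c.param 0 y))))
      have h2 := hζlim.mul (((continuous_flux b).tendsto _).comp h1)
      refine h2.congr' ?_
      filter_upwards [hev] with n hn
      simp only [H]
      rw [indicator_of_mem hn]
      simp only [F, Function.comp, c.fderiv_height_param]
  -- Measurability of the trace is inherited from the approximating layers.
  have hIm : AEStronglyMeasurable (traceIntegrand c Q b w ζ) (volume.restrict (slab d)) :=
    aestronglyMeasurable_of_tendsto_ae atTop hHm hlim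
  have hIi : IntegrableOn (traceIntegrand c Q b w ζ) (slab d) := by
    refine hBi.mono' hIm ?_
    filter_upwards [ae_all_iff.2 hbound, hlim] with y h1 h2
    exact le_of_tendsto h2.norm (Eventually.of_forall h1)
  refine ⟨hIi, ?_⟩
  have hT := tendsto_integral_of_dominated_convergence _ hHm hBi hbound hlim
  refine (hT.const_mul σ).congr fun n => ?_
  -- The factor `1 / ε n` of the change of variables is exactly the slope of the ramp.
  have h1 := c.integral_param (hεσ n) fun p => indicator (Ioo 1 2) 1 (σ * c.height p / ε n) *
    G.indicator F p
  have h2 : ∀ y, indicator (Ioo 1 2) (1 : ℝ → ℝ) (σ * c.height (c.param (σ * ε n) y) / ε n) *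
      G.indicator F (c.param (σ * ε n) y) = (slab d).indicator (H n) y := by
    intro y
    have h3 : σ * c.height (c.param (σ * ε n) y) / ε n = y.2 := by
      rw [c.height_param, ← mul_assoc, ← mul_assoc, hσ2, one_mul, mul_div_cancel_left₀ _ (hε n).ne']
    rw [h3]
    by_cases hy : y.2 ∈ Ioo (1 : ℝ) 2
    · rw [indicator_of_mem hy, indicator_of_mem (show y ∈ slab d from hy), Pi.one_apply, one_mul]
    · rw [indicator_of_notMem hy, indicator_of_notMem (show y ∉ slab d from hy), zero_mul]
  simp_rw [h2] at h1
  rw [integral_indicator measurableSet_slab] at h1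
  rw [h1, abs_inv, abs_mul, hσ, one_mul, abs_of_pos (hε n), ← mul_assoc, ← integral_const_mul,
    ← integral_indicator h.isOpen.measurableSet]
  refine integral_congr_ae (ae_of_all _ fun p => ?_)
  by_cases hp : p ∈ G
  · simp only [indicator_of_mem hp, F, flux_smul]
    ring
  · simp only [indicator_of_notMem hp, mul_zero]

/-- The energy identity on one side of a graph: the boundary term is the flux through the graph. -/
lemma integral_weakIntegrand_eq_trace (h : Phase Q G w M) (hb : 0 ≤ b) (c : GraphChart d) {σ : ℝ}
    (hσ : |σ| = 1) {L : ℝ≥0} (hζ : LipschitzWith L ζ) (hc : HasCompactSupport ζ)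
    (hG : ∀ p ∈ tsupport ζ, p ∈ G ↔ 0 < σ * c.height p)
    (hQ : ∀ p ∈ tsupport ζ, c.height p = 0 → ζ p ≠ 0 → p ∈ Q ∧ ContinuousWithinAt w Q p ∧
      ContinuousWithinAt (fderivWithin ℝ w Q) Q p) :
    IntegrableOn (traceIntegrand c Q b w ζ) (slab d) ∧
      ∫ p in G, weakIntegrand Q b w ζ p = -(σ * ∫ y in slab d, traceIntegrand c Q b w ζ y) := by
  have hσ0 : σ ≠ 0 := by
    rintro rfl
    simp at hσ
  obtain ⟨A, hA⟩ := exists_abs_le_of_hasCompactSupport hζ.continuous hc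
  set ε : ℕ → ℝ := fun n => 1 / ((n : ℝ) + 1)
  have hε : ∀ n, 0 < ε n := fun n => Nat.one_div_pos_of_nat
  have hε0 : Tendsto ε atTop (𝓝 0) := tendsto_one_div_add_atTop_nhds_zero_nat
  obtain ⟨hI, hlim⟩ := h.tendsto_layer hb c hσ hζ.continuous hc (fun p hp => (hG p hp).2) hQ hε hε0
  refine ⟨hI, ?_⟩
  have hwi := h.integrableOn_weakIntegrand hb hζ hA
  -- At a point of `G` in the support of `ζ` the signed height is positive, so the ramps are
  -- eventually `1` there; off the support the integrand is zero.
  have hlim2 : Tendsto (fun n => ∫ p in G, c.rampAt σ (ε n) p * weakIntegrand Q b w ζ p) atTop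
      (𝓝 (∫ p in G, weakIntegrand Q b w ζ p)) := by
    refine tendsto_integral_of_dominated_convergence (fun p => ‖weakIntegrand Q b w ζ p‖)
      (fun n => ?_) hwi.norm (fun n => ae_of_all _ fun p => ?_) ?_
    · obtain ⟨L', hL'⟩ := c.exists_lipschitzWith_rampAt σ (ε n)
      exact hL'.continuous.aestronglyMeasurable.mul hwi.aestronglyMeasurable
    · rw [norm_mul]
      exact mul_le_of_le_one_left (norm_nonneg _) (abs_ramp_le_one _)
    · refine (ae_restrict_iff' h.isOpen.measurableSet).2 (ae_of_all _ fun p hp => ?_)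
      by_cases hs : p ∈ tsupport ζ
      · have hpos := (hG p hs).1 hp
        refine tendsto_const_nhds.congr' ?_
        filter_upwards [hε0.eventually (gt_mem_nhds (show 0 < σ * c.height p / 2 by positivity))]
          with n hn
        have : 2 ≤ σ * c.height p / ε n := by
          rw [le_div_iff₀ (hε n)]
          linarith
        rw [rampAt, ramp_of_ge this, one_mul]
      · have h1 : fderiv ℝ ζ p = 0 := by
          by_contra h'
          exact hs (support_fderiv_subset ℝ h')
        simp [weakIntegrand, h1, image_eq_zero_of_notMem_tsupport hs]
  -- The product of `ζ` with the ramp has compact support inside `G`, so the identity without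
  -- boundary term holds for it. The Leibniz rule splits it into a bulk part and a layer part.
  have hsum : ∀ n, (∫ p in G, c.rampAt σ (ε n) p * weakIntegrand Q b w ζ p) +
      ∫ p in G, ζ p * flux b (w p) (fderivWithin ℝ w Q p)
        ((indicator (Ioo 1 2) 1 (σ * c.height p / ε n) * (σ / ε n)) • fderiv ℝ c.height p) = 0 := by
    intro n
    obtain ⟨L', hL'⟩ := c.exists_lipschitzWith_rampAt σ (ε n)
    obtain ⟨L'', hL''⟩ := LipschitzWith.exists_mul hζ hL' hA fun p => abs_ramp_le_one _
    have hc' : HasCompactSupport fun p => ζ p * c.rampAt σ (ε n) p := hc.mul_right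
    have hs : tsupport (fun p => ζ p * c.rampAt σ (ε n) p) ⊆ G := by
      have h1 : tsupport (fun p => ζ p * c.rampAt σ (ε n) p) ⊆
          tsupport ζ ∩ {p | ε n ≤ σ * c.height p} := by
        refine closure_minimal (fun p hp => ?_) ((isClosed_tsupport ζ).inter
          (isClosed_le continuous_const (c.continuous_height.const_mul σ)))
        have hp' : ζ p ≠ 0 ∧ c.rampAt σ (ε n) p ≠ 0 := mul_ne_zero_iff.1 hp
        refine ⟨subset_tsupport ζ hp'.1, ?_⟩
        by_contra h'
        refine hp'.2 (ramp_of_le ?_)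
        rw [div_le_one (hε n)]
        exact (not_le.1 h').le
      exact fun p hp => (hG p (h1 hp).1).2 ((hε n).trans_le (h1 hp).2)
    have h0 := h.integral_weakIntegrand_eq_zero b hL'' hc' hs
    have hk := c.ae_hasFDerivAt_rampAt hσ0 (hε n)
    have hae := ae_weakIntegrand_mul hζ.ae_differentiableAt (hk.mono fun p hp => hp.differentiableAt)
      Q b w
    rw [← integral_add, ← h0]
    · refine integral_congr_ae (ae_restrict_of_ae ?_)
      filter_upwards [hae, hk] with p h1 h2
      rw [h1, h2.fderiv]
    · exact hwi.bdd_mul hL'.continuous.aestronglyMeasurable (c := 1)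
        (ae_of_all _ fun p => abs_ramp_le_one _)
    · have h3 := (h.integrableOn_flux hb (measurable_fderiv ℝ (c.rampAt σ (ε n)))
        fun p => norm_fderiv_le_of_lipschitz ℝ hL').bdd_mul (c := A)
        hζ.continuous.aestronglyMeasurable (ae_of_all _ fun p => hA p)
      refine h3.congr (ae_restrict_of_ae ?_)
      filter_upwards [hk] with p h2
      rw [h2.fderiv]
  have h5 := tendsto_nhds_unique (hlim2.add hlim)
    (tendsto_const_nhds.congr fun n => (hsum n).symm)
  linarith

end Phase

/-! ### The error pair and its flux jump across the interface -/

/-- The open space-time set `{(t, x) : 0 < t < T, x ∈ U(t)}`. -/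
def innerTube (T : ℝ) (U : ℝ → Set (Space d)) : Set (ℝ × Space d) :=
  {p | p.1 ∈ Ioo 0 T ∧ p.2 ∈ U p.1}

/-- The error of the approximation `v` of `u`. -/
def err (u v : Fin 2 → ℝ × Space d → ℝ) (i : Fin 2) (p : ℝ × Space d) : ℝ := u i p - v i p

lemma IsLipschitzTube.isOpen_innerTube {T₀ T : ℝ} {U : ℝ → Set (Space d)}
    (h : IsLipschitzTube T₀ U) (hT : T ≤ T₀) : IsOpen (innerTube T U) := by
  rw [isOpen_iff_mem_nhds]
  intro p hp
  have h1 : p ∈ tube T₀ U := ⟨⟨hp.1.1.le, hp.1.2.le.trans hT⟩, hp.2⟩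
  filter_upwards [h.isOpen p h1, continuous_fst.continuousAt.preimage_mem_nhds
    (Ioo_mem_nhds hp.1.1 hp.1.2)] with q hq hq'
  exact ⟨hq', (hq ⟨hq'.1.le, hq'.2.le.trans hT⟩).2⟩

lemma abs_le_of_c2Norm_le {Q : Set (ℝ × Space d)} {w : ℝ × Space d → ℝ} {K : ℝ≥0}
    (h : c2Norm Q w ≤ K) {k : ℕ} (hk : k ≤ 2) {p : ℝ × Space d} (hp : p ∈ Q) :
    ‖iteratedFDerivWithin ℝ k w Q p‖ ≤ K := by
  have h1 : ‖iteratedFDerivWithin ℝ k w Q p‖ₑ ≤ K :=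
    (le_iSup₂ (f := fun p (_ : p ∈ Q) => ‖iteratedFDerivWithin ℝ k w Q p‖ₑ) p hp).trans
      ((le_iSup₂ (f := fun (k : ℕ) (_ : k ≤ 2) => ⨆ (p : ℝ × Space d) (_ : p ∈ Q),
        ‖iteratedFDerivWithin ℝ k w Q p‖ₑ) k hk).trans h)
  rw [enorm_eq_nnnorm, ENNReal.coe_le_coe] at h1
  exact_mod_cast h1

/-- The hypotheses of the error estimates: a moving partition, a classical solution `u` and an
approximation `v`, both with `C^2` norms at most `K`. -/
structure Comparison (T₀ T : ℝ) (Ω : ℝ → Set (Space d)) (U : Fin 2 → ℝ → Set (Space d))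
    (β : Fin 2 → ℝ) (D : ProblemData d) (u v : Fin 2 → ℝ × Space d → ℝ) (K : ℝ≥0) : Prop where
  partition : IsMovingPartition T₀ Ω U
  pos : 0 < T
  le : T ≤ T₀
  coeff_pos : ∀ i, 0 < β i
  solution : IsClassicalSolution T Ω U β D u
  isC2 : IsC2 T U v
  norm_u : ∀ i, c2Norm (closedTube T (U i)) (u i) ≤ K
  norm_v : ∀ i, c2Norm (closedTube T (U i)) (v i) ≤ K

namespace Comparison

variable {T₀ T : ℝ} {Ω : ℝ → Set (Space d)} {U : Fin 2 → ℝ → Set (Space d)} {β : Fin 2 → ℝ}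
  {D : ProblemData d} {u v : Fin 2 → ℝ × Space d → ℝ} {K : ℝ≥0}

lemma mem_Icc (h : Comparison T₀ T Ω U β D u v K) {t : ℝ} (ht : t ∈ Icc 0 T) : t ∈ Icc 0 T₀ :=
  ⟨ht.1, ht.2.trans h.le⟩

lemma differentiableWithinAt_u (h : Comparison T₀ T Ω U β D u v K) {i : Fin 2} {p : ℝ × Space d}
    (hp : p ∈ closedTube T (U i)) : DifferentiableWithinAt ℝ (u i) (closedTube T (U i)) p :=
  (h.solution.isC2 i p hp).differentiableWithinAt (by norm_num)

lemma differentiableWithinAt_v (h : Comparison T₀ T Ω U β D u v K) {i : Fin 2} {p : ℝ × Space d}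
    (hp : p ∈ closedTube T (U i)) : DifferentiableWithinAt ℝ (v i) (closedTube T (U i)) p :=
  (h.isC2 i p hp).differentiableWithinAt (by norm_num)

lemma fderivWithin_err (h : Comparison T₀ T Ω U β D u v K) {i : Fin 2} {p : ℝ × Space d}
    (hp : p ∈ closedTube T (U i)) (hu : UniqueDiffWithinAt ℝ (closedTube T (U i)) p) :
    fderivWithin ℝ (err u v i) (closedTube T (U i)) p =
      fderivWithin ℝ (u i) (closedTube T (U i)) p - fderivWithin ℝ (v i) (closedTube T (U i)) p :=
  fderivWithin_fun_sub hu (h.differentiableWithinAt_u hp) (h.differentiableWithinAt_v hp)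

lemma contDiffOn_err (h : Comparison T₀ T Ω U β D u v K) (i : Fin 2) :
    ContDiffOn ℝ 2 (err u v i) (closedTube T (U i)) := (h.solution.isC2 i).sub (h.isC2 i)

lemma abs_err_le (h : Comparison T₀ T Ω U β D u v K) {i : Fin 2} {p : ℝ × Space d}
    (hp : p ∈ closedTube T (U i)) : |err u v i p| ≤ 2 * K := by
  have h1 := abs_le_of_c2Norm_le (h.norm_u i) (k := 0) (by norm_num) hp
  have h2 := abs_le_of_c2Norm_le (h.norm_v i) (k := 0) (by norm_num) hp
  rw [norm_iteratedFDerivWithin_zero, Real.norm_eq_abs] at h1 h2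
  refine (abs_sub _ _).trans ?_
  linarith

lemma norm_fderivWithin_err_le (h : Comparison T₀ T Ω U β D u v K) {i : Fin 2} {p : ℝ × Space d}
    (hp : p ∈ closedTube T (U i)) (hu : UniqueDiffWithinAt ℝ (closedTube T (U i)) p) :
    ‖fderivWithin ℝ (err u v i) (closedTube T (U i)) p‖ ≤ 2 * K := by
  have h1 := abs_le_of_c2Norm_le (h.norm_u i) (k := 1) (by norm_num) hp
  have h2 := abs_le_of_c2Norm_le (h.norm_v i) (k := 1) (by norm_num) hp
  rw [norm_iteratedFDerivWithin_one _ hu] at h1 h2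
  rw [h.fderivWithin_err hp hu]
  refine (norm_sub_le _ _).trans ?_
  linarith

lemma isOpen_innerTube (h : Comparison T₀ T Ω U β D u v K) (i : Fin 2) :
    IsOpen (innerTube T (U i)) := (h.partition.subdomain i).isOpen_innerTube h.le

lemma innerTube_subset_closedTube (U : ℝ → Set (Space d)) :
    innerTube T U ⊆ closedTube T U :=
  fun _ hp => ⟨⟨hp.1.1.le, hp.1.2.le⟩, subset_closure hp.2⟩

lemma closedTube_mem_nhds (h : Comparison T₀ T Ω U β D u v K) {i : Fin 2} {p : ℝ × Space d}
    (hp : p ∈ innerTube T (U i)) : closedTube T (U i) ∈ 𝓝 p :=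
  mem_of_superset ((h.isOpen_innerTube i).mem_nhds hp) (innerTube_subset_closedTube _)

lemma iteratedFDerivWithin_err (h : Comparison T₀ T Ω U β D u v K) {i : Fin 2} {p : ℝ × Space d}
    (hp : p ∈ innerTube T (U i)) :
    iteratedFDerivWithin ℝ 2 (err u v i) (closedTube T (U i)) p =
      iteratedFDerivWithin ℝ 2 (u i) (closedTube T (U i)) p -
        iteratedFDerivWithin ℝ 2 (v i) (closedTube T (U i)) p := by
  have hn := h.closedTube_mem_nhds hp
  have hcongr : ∀ w : ℝ × Space d → ℝ, iteratedFDerivWithin ℝ 2 w (closedTube T (U i)) p =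
      iteratedFDeriv ℝ 2 w p := by
    intro w
    rw [← iteratedFDerivWithin_univ]
    exact iteratedFDerivWithin_congr_set (eventuallyEq_univ.2 hn) 2
  have h1 := (h.solution.isC2 i).contDiffAt hn
  have h2 := (h.isC2 i).contDiffAt hn
  rw [hcongr, hcongr, hcongr]
  exact iteratedFDeriv_sub_apply h1 h2

lemma phase (h : Comparison T₀ T Ω U β D u v K) (i : Fin 2) :
    Phase (closedTube T (U i)) (innerTube T (U i)) (err u v i) (2 * K) where
  isOpen := h.isOpen_innerTube i
  subset := innerTube_subset_closedTube _
  isBounded := (h.partition.subdomain i).isBounded.subset fun p hp =>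
    ⟨⟨hp.1.1.le, hp.1.2.le.trans h.le⟩, hp.2⟩
  contDiffOn := h.contDiffOn_err i
  abs_le := fun p hp => h.abs_err_le hp
  norm_fderiv_le := fun p hp => h.norm_fderivWithin_err_le (innerTube_subset_closedTube _ hp)
    (uniqueDiffWithinAt_of_mem_nhds (h.closedTube_mem_nhds hp))
  norm_iteratedFDeriv_le := fun p hp => by
    have hp' := innerTube_subset_closedTube (U i) hp
    have h1 := abs_le_of_c2Norm_le (h.norm_u i) (k := 2) le_rfl hp'
    have h2 := abs_le_of_c2Norm_le (h.norm_v i) (k := 2) le_rfl hp'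
    rw [h.iteratedFDerivWithin_err hp]
    refine (norm_sub_le _ _).trans ?_
    linarith

/-- The sign of the side of a chart of the first subdomain on which a subdomain lies. -/
def side (i : Fin 2) : ℝ := if i = 0 then 1 else -1

lemma abs_side (i : Fin 2) : |side i| = 1 := by
  unfold side
  split_ifs <;> simp

lemma mem_iff_side (h : Comparison T₀ T Ω U β D u v K) {c : GraphChart d} {N : Set (ℝ × Space d)}
    (hc : c.Describes T₀ (U 0) N) (i : Fin 2) {q : ℝ × Space d} (ht : q.1 ∈ Icc 0 T)
    (hx : q.2 ∈ Ω q.1) (hN : q ∈ N) : q.2 ∈ U i q.1 ↔ 0 < side i * c.height q := by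
  fin_cases i
  · simpa [side] using hc.2 q hN (h.mem_Icc ht)
  · simpa [side] using h.partition.mem_one_iff hc (h.mem_Icc ht) hx hN

/-- In a chart of the first subdomain, the closed tubes are the two sides of the graph. -/
lemma mem_closedTube_iff_side (h : Comparison T₀ T Ω U β D u v K) {c : GraphChart d}
    {N : Set (ℝ × Space d)} (hc : c.Describes T₀ (U 0) N) (i : Fin 2) {q : ℝ × Space d}
    (hq : q ∈ innerTube T Ω) (hN : q ∈ N) :
    q ∈ closedTube T (U i) ↔ 0 ≤ side i * c.height q := by
  have ht : q.1 ∈ Icc 0 T := ⟨hq.1.1.le, hq.1.2.le⟩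
  constructor
  · intro hcl
    have hslice : Continuous (fun y : Space d => (q.1, y)) := Continuous.prodMk_right q.1
    have hO : IsOpen {y : Space d | (q.1, y) ∈ N ∧ y ∈ Ω q.1} :=
      (hc.1.preimage hslice).inter (h.partition.domain.isOpen_slice (h.mem_Icc ht))
    have h1 : q.2 ∈ closure ({y : Space d | (q.1, y) ∈ N ∧ y ∈ Ω q.1} ∩ U i q.1) :=
      hO.inter_closure ⟨⟨hN, hq.2⟩, hcl.2⟩
    have h2 : IsClosed {y : Space d | 0 ≤ side i * c.height (q.1, y)} :=
      isClosed_le continuous_const ((c.continuous_height.comp hslice).const_mul _)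
    refine closure_minimal (fun y hy => ?_) h2 h1
    exact ((h.mem_iff_side hc i (q := (q.1, y)) ht hy.1.2 hy.1.1).1 hy.2).le
  · intro h0
    refine ⟨ht, ?_⟩
    rcases h0.lt_or_eq with h1 | h1
    · exact subset_closure ((h.mem_iff_side hc i ht hq.2 hN).2 h1)
    · have h2 : c.height q = 0 := by
        have := abs_side i
        rcases mul_eq_zero.1 h1.symm with h3 | h3
        · rw [h3] at this
          simp at this
        · exact h3
      exact h.partition.interface_subset i q.1 (h.mem_Icc ht)
        ((h.partition.mem_interface_iff hc (h.mem_Icc ht) hq.2 hN).2 h2)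

/-- On the interface the derivative within the closed tube of a difference is the difference of the
derivatives only if derivatives are unique; the cone condition on each side of the graph provides
this. -/
lemma uniqueDiffWithinAt_closedTube (h : Comparison T₀ T Ω U β D u v K) {c : GraphChart d}
    {N : Set (ℝ × Space d)} (hc : c.Describes T₀ (U 0) N) (i : Fin 2) {q : ℝ × Space d}
    (hq : q ∈ innerTube T Ω) (hN : q ∈ N) (hQ : q ∈ closedTube T (U i)) :
    UniqueDiffWithinAt ℝ (closedTube T (U i)) q := by
  have hO : IsOpen (N ∩ innerTube T Ω) :=
    hc.1.inter (h.partition.domain.isOpen_innerTube h.le)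
  have h1 := (c.uniqueDiffOn_height (abs_side i)) q ((h.mem_closedTube_iff_side hc i hq hN).1 hQ)
  have h2 := h1.inter (hO.mem_nhds ⟨hN, hq⟩)
  exact h2.mono fun p hp => (h.mem_closedTube_iff_side hc i hp.2.2 hp.2.1).2 hp.1

lemma continuousWithinAt_fderivWithin_err (h : Comparison T₀ T Ω U β D u v K) {c : GraphChart d}
    {N : Set (ℝ × Space d)} (hc : c.Describes T₀ (U 0) N) (i : Fin 2) {q : ℝ × Space d}
    (hq : q ∈ innerTube T Ω) (hN : q ∈ N) (hQ : q ∈ closedTube T (U i)) :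
    ContinuousWithinAt (fderivWithin ℝ (err u v i) (closedTube T (U i))) (closedTube T (U i)) q :=
  continuousWithinAt_fderivWithin_of_graph c (abs_side i) (h.contDiffOn_err i)
    (hc.1.inter (h.partition.domain.isOpen_innerTube h.le))
    (fun _ hp => h.mem_closedTube_iff_side hc i hp.2 hp.1) ⟨hN, hq⟩ hQ

/-- The squared interface residuals. -/
def _root_.ParabolicInterface.interfaceSq (T : ℝ) (U : Fin 2 → ℝ → Set (Space d)) (β : Fin 2 → ℝ)
    (D : ProblemData d) (v : Fin 2 → ℝ × Space d → ℝ) (p : ℝ × Space d) : ℝ :=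
  jumpResidual D v p ^ 2 + fluxResidual T U β D v p ^ 2

/-- The jump of the energy flux across the interface is controlled by the interface residuals. -/
lemma abs_flux_sub_flux_le (h : Comparison T₀ T Ω U β D u v K) {c : GraphChart d}
    {N : Set (ℝ × Space d)} (hc : c.Describes T₀ (U 0) N) {q : ℝ × Space d}
    (hq : q ∈ innerTube T Ω) (hN : q ∈ N) (h0 : c.height q = 0)
    (hd : DifferentiableAt ℝ c.height q) {l : ℝ} (hl : 0 < l) :
    |flux (β 1) (err u v 1 q) (fderivWithin ℝ (err u v 1) (closedTube T (U 1)) q)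
        (fderiv ℝ c.height q) -
      flux (β 0) (err u v 0 q) (fderivWithin ℝ (err u v 0) (closedTube T (U 0)) q)
        (fderiv ℝ c.height q)| ≤
      4 * K * c.heightLip * (2 + β 0) * (l + interfaceSq T U β D v q / l) := by
  have hQ : ∀ i, q ∈ closedTube T (U i) := fun i =>
    (h.mem_closedTube_iff_side hc i hq hN).2 (by rw [h0, mul_zero])
  have hu := fun i => h.uniqueDiffWithinAt_closedTube hc i hq hN (hQ i)
  have ht : q.1 ∈ Icc 0 T := ⟨hq.1.1.le, hq.1.2.le⟩
  have hΓ : q.2 ∈ interface Ω U q.1 :=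
    (h.partition.mem_interface_iff hc (h.mem_Icc ht) hq.2 hN).2 h0
  set ξ := fderiv ℝ c.height q with hξ
  set g := spacePart ξ with hg
  have hξL : ‖ξ‖ ≤ c.heightLip := norm_fderiv_le_of_lipschitz ℝ c.lipschitzWith_height
  have hslice : Tendsto (fun y : Space d => (q.1, y)) (𝓝 q.2) (𝓝 q) :=
    (Continuous.prodMk_right q.1).tendsto q.2
  have hgrad : HasGradientAt (fun y => c.height (q.1, y)) g q.2 := by
    rw [hasGradientAt_iff_hasFDerivAt]
    have h1 : HasFDerivAt (fun y : Space d => (q.1, y))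
        (ContinuousLinearMap.inr ℝ ℝ (Space d)) q.2 := hasFDerivAt_prodMk_right q.1 q.2
    have h2 := HasFDerivAt.comp (g := c.height) q.2 hd.hasFDerivAt h1
    have e : InnerProductSpace.toDual ℝ (Space d) g = ξ.comp (ContinuousLinearMap.inr ℝ ℝ _) := by
      ext1 z
      rw [InnerProductSpace.toDual_apply_apply, hg, inner_spacePart]
      rfl
    rw [e]
    exact h2
  have hg0 : g ≠ 0 := c.gradient_slice_ne_zero hgrad
  have hgn : 0 < ‖g‖ := norm_pos_iff.2 hg0
  -- The first phase lies where the height is positive, so its outer normal is the negative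
  -- normalized spatial gradient.
  set n : Space d := -(‖g‖⁻¹ • g) with hn
  have hnormal : IsOuterNormal (U 0 q.1) q.2 n := by
    refine isOuterNormal_of_hasGradientAt hgrad hg0 h0 ?_
    filter_upwards [hslice.eventually (hc.1.mem_nhds hN)] with y hy
    exact hc.2 (q.1, y) hy (h.mem_Icc ht)
  have hgn' : ∀ z : Space d, ⟪z, g⟫_ℝ = -(‖g‖ * ⟪z, n⟫_ℝ) := by
    intro z
    rw [hn, inner_neg_right, inner_smul_right]
    field_simp
  set a := fun i => err u v i q with ha
  set A := fun i => spaceGrad (closedTube T (U i)) (err u v i) q with hA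
  have hAuv : ∀ i, A i = spaceGrad (closedTube T (U i)) (u i) q -
      spaceGrad (closedTube T (U i)) (v i) q := by
    intro i
    ext j
    simp [A, spaceGrad, h.fderivWithin_err (hQ i) (hu i)]
  have hAn : ∀ i, |⟪A i, n⟫_ℝ| ≤ 2 * K := by
    intro i
    refine (abs_real_inner_le_norm _ _).trans ?_
    rw [hnormal.1, mul_one]
    exact (norm_spacePart_le _).trans (h.norm_fderivWithin_err_le (hQ i) (hu i))
  have haK : ∀ i, |a i| ≤ 2 * K := fun i => h.abs_err_le (hQ i)
  have hjump : a 0 - a 1 = -jumpResidual D v q := by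
    have := h.solution.jump q.1 ht q.2 hΓ
    simp only [jumpResidual, a, err] at this ⊢
    linarith
  have hflux : β 0 * ⟪A 0, n⟫_ℝ - β 1 * ⟪A 1, n⟫_ℝ = -fluxResidual T U β D v q := by
    have h1 := h.solution.flux q.1 ht q.2 hΓ n hnormal
    rw [fluxResidual, hnormal.outerNormal_eq]
    simp only [fluxJump, hAuv, inner_sub_left, Prod.mk.eta] at h1 ⊢
    linarith
  have hfl : ∀ i, flux (β i) (err u v i q) (fderivWithin ℝ (err u v i) (closedTube T (U i)) q) ξ =
      a i ^ 2 * ξ (1, 0) + 2 * β i * a i * ‖g‖ * ⟪A i, n⟫_ℝ := by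
    intro i
    have h1 : ⟪spacePart (fderivWithin ℝ (err u v i) (closedTube T (U i)) q), spacePart ξ⟫_ℝ =
        -(‖g‖ * ⟪A i, n⟫_ℝ) := hgn' _
    rw [flux, h1]
    ring
  rw [hfl, hfl]
  set I1 := jumpResidual D v q
  set I2 := fluxResidual T U β D v q
  -- The jump of `a²` factors as a difference of squares, and the jump of `a β ⟪A, n⟫` telescopes
  -- through the mixed product `a 1 * (β 0 * ⟪A 0, n⟫)`. Every summand then carries exactly one
  -- interface residual; the term with `ξ (1, 0)` stems from the motion of the interface.
  have e : a 1 ^ 2 * ξ (1, 0) + 2 * β 1 * a 1 * ‖g‖ * ⟪A 1, n⟫_ℝ -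
      (a 0 ^ 2 * ξ (1, 0) + 2 * β 0 * a 0 * ‖g‖ * ⟪A 0, n⟫_ℝ) =
      I1 * ((a 0 + a 1) * ξ (1, 0) + 2 * ‖g‖ * (β 0 * ⟪A 0, n⟫_ℝ)) + I2 * (2 * ‖g‖ * a 1) := by
    have e1 : I1 = -(a 0 - a 1) := by rw [hjump, neg_neg]
    have e2 : I2 = -(β 0 * ⟪A 0, n⟫_ℝ - β 1 * ⟪A 1, n⟫_ℝ) := by rw [hflux, neg_neg]
    rw [e1, e2]
    ring
  rw [e]
  have hL0 : (0 : ℝ) ≤ c.heightLip := c.heightLip.coe_nonneg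
  have hK0 : (0 : ℝ) ≤ K := K.coe_nonneg
  have hβ0 := (h.coeff_pos 0).le
  have hξ1 : |ξ (1, 0)| ≤ c.heightLip := by
    refine (ξ.le_opNorm _).trans ?_
    simpa [Prod.norm_mk] using hξL
  have hgL : ‖g‖ ≤ c.heightLip := (norm_spacePart_le ξ).trans hξL
  have b1 : |(a 0 + a 1) * ξ (1, 0) + 2 * ‖g‖ * (β 0 * ⟪A 0, n⟫_ℝ)| ≤
      4 * K * c.heightLip * (2 + β 0) := by
    have b2 : |(a 0 + a 1) * ξ (1, 0)| ≤ (4 * K) * c.heightLip := by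
      rw [abs_mul]
      refine mul_le_mul ((abs_add_le _ _).trans ?_) hξ1 (abs_nonneg _) (by positivity)
      linarith [haK 0, haK 1]
    have b3 : |2 * ‖g‖ * (β 0 * ⟪A 0, n⟫_ℝ)| ≤ 2 * c.heightLip * (β 0 * (2 * K)) := by
      rw [abs_mul, abs_mul, abs_mul, abs_two, abs_norm, abs_of_nonneg hβ0]
      gcongr
      exact hAn 0
    refine (abs_add_le _ _).trans ?_
    nlinarith [mul_nonneg hK0 hL0]
  have b4 : |2 * ‖g‖ * a 1| ≤ 4 * K * c.heightLip * (2 + β 0) := by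
    rw [abs_mul, abs_mul, abs_two, abs_norm]
    have : 2 * ‖g‖ * |a 1| ≤ 2 * c.heightLip * (2 * K) := by
      gcongr
      exact haK 1
    nlinarith [mul_nonneg hK0 hL0, mul_nonneg (mul_nonneg hK0 hL0) hβ0]
  -- Each residual takes half of the weight `l`, so that the two together cost `l` only.
  have b5 : |I1| + |I2| ≤ l + interfaceSq T U β D v q / l := by
    have b6 : ∀ x : ℝ, |x| ≤ l / 2 + x ^ 2 / (2 * l) := by
      intro x
      have : 0 ≤ (|x| - l) ^ 2 / (2 * l) := by positivity
      rw [sub_sq, sq_abs] at this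
      have e3 : (x ^ 2 - 2 * |x| * l + l ^ 2) / (2 * l) = x ^ 2 / (2 * l) - |x| + l / 2 := by
        field_simp
      linarith
    have e4 : interfaceSq T U β D v q / l = 2 * (I1 ^ 2 / (2 * l)) + 2 * (I2 ^ 2 / (2 * l)) := by
      change (I1 ^ 2 + I2 ^ 2) / l = _
      field_simp
    have := b6 I1
    have := b6 I2
    have : 0 ≤ I1 ^ 2 / (2 * l) := by positivity
    have : 0 ≤ I2 ^ 2 / (2 * l) := by positivity
    linarith
  refine (abs_add_le _ _).trans ?_
  rw [abs_mul, abs_mul]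
  have hC : 0 ≤ 4 * K * c.heightLip * (2 + β 0) := by positivity
  calc _ ≤ |I1| * (4 * K * c.heightLip * (2 + β 0)) + |I2| * (4 * K * c.heightLip * (2 + β 0)) := by
        gcongr
    _ = 4 * K * c.heightLip * (2 + β 0) * (|I1| + |I2|) := by ring
    _ ≤ _ := mul_le_mul_of_nonneg_left b5 hC

end Comparison

/-! ### Integrals over moving graphs, bounded without measurability of the integrand -/

lemma lintegral_prod_le_lintegral_lintegral {α γ : Type*} [MeasurableSpace α] [MeasurableSpace γ]
    {μ : Measure α} {ν : Measure γ} [SFinite ν] (F : α × γ → ℝ≥0∞) :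
    ∫⁻ z, F z ∂μ.prod ν ≤ ∫⁻ x, ∫⁻ y, F (x, y) ∂ν ∂μ := by
  -- A measurable minorant with the same integral satisfies Tonelli's theorem, and its iterated
  -- integral is at most that of `F`. So this inequality can be used for residuals whose joint
  -- measurability is not established.
  obtain ⟨g, hg, hgF, he⟩ := exists_measurable_le_lintegral_eq (μ := μ.prod ν) F
  rw [he, lintegral_prod _ hg.aemeasurable]
  exact lintegral_mono fun x => lintegral_mono fun y => hgF (x, y)

namespace GraphChart

variable (c : GraphChart d)

/-- An integral over the parameters of a moving graph is at most the space-time integral over any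
moving set, if the integrand vanishes off that set. -/
lemma lintegral_graph_le {T : ℝ} {S : ℝ → Set (Space d)} (hS : ∀ t ∈ Icc 0 T, MeasurableSet (S t))
    (F : ℝ × Space d → ℝ≥0∞) :
    ∫⁻ z : ℝ × Base d, (tube T S).indicator F (z.1, c.graphPoint z.1 z.2) ≤
      ∫⁻ t in Icc 0 T, ∫⁻ x in S t, F (t, x) ∂surface d := by
  rw [Measure.volume_eq_prod]
  refine (lintegral_prod_le_lintegral_lintegral _).trans ?_
  rw [← lintegral_indicator measurableSet_Icc]
  refine lintegral_mono fun t => ?_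
  by_cases ht : t ∈ Icc 0 T
  · rw [indicator_of_mem ht, ← lintegral_indicator (hS t ht)]
    refine le_trans (lintegral_mono fun x => ?_)
      (c.lintegral_graphPoint_le t ((S t).indicator fun x => F (t, x)))
    by_cases hx : c.graphPoint t x ∈ S t
    · rw [indicator_of_mem hx, indicator_of_mem (show (t, c.graphPoint t x) ∈ tube T S from ⟨ht, hx⟩)]
    · rw [indicator_of_notMem hx,
        indicator_of_notMem (show (t, c.graphPoint t x) ∉ tube T S from fun h => hx h.2)]
  · rw [indicator_of_notMem ht]
    refine (lintegral_eq_zero_of_ae_eq_zero (ae_of_all _ fun x => ?_)).le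
    exact indicator_of_notMem (fun h => ht h.1) _

/-- An integral over a layer of parameters of an integrand that does not depend on the height. -/
lemma lintegral_layer_le (I : Set ℝ) (hI : MeasurableSet I) (hv : volume I ≠ ∞)
    (F : ℝ × Base d → ℝ≥0∞) :
    ∫⁻ y in {y : (ℝ × Base d) × ℝ | y.2 ∈ I}, F y.1 ≤ volume I * ∫⁻ z, F z := by
  have hm : MeasurableSet {y : (ℝ × Base d) × ℝ | y.2 ∈ I} := measurable_snd hI
  rw [← lintegral_indicator hm, Measure.volume_eq_prod]
  refine (lintegral_prod_le_lintegral_lintegral _).trans ?_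
  have h1 : ∀ z : ℝ × Base d, ∫⁻ r, ({y : (ℝ × Base d) × ℝ | y.2 ∈ I}).indicator
      (fun y => F y.1) (z, r) = F z * volume I := by
    intro z
    have : ∀ r, ({y : (ℝ × Base d) × ℝ | y.2 ∈ I}).indicator (fun y => F y.1) (z, r) =
        I.indicator (fun _ => F z) r := fun r => rfl
    simp_rw [this]
    rw [lintegral_indicator_const hI]
  simp_rw [h1]
  rw [lintegral_mul_const' _ _ hv, mul_comm]

end GraphChart

open GraphChart

namespace Comparison

variable {T₀ T : ℝ} {Ω : ℝ → Set (Space d)} {U : Fin 2 → ℝ → Set (Space d)} {β : Fin 2 → ℝ}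
  {D : ProblemData d} {u v : Fin 2 → ℝ × Space d → ℝ} {K : ℝ≥0} {ζ : ℝ × Space d → ℝ} {L : ℝ≥0}
  {A l : ℝ}

/-- The weighted interface integral that bounds the energy production at the interface. -/
def _root_.ParabolicInterface.interfaceBound (T : ℝ) (Ω : ℝ → Set (Space d))
    (U : Fin 2 → ℝ → Set (Space d)) (β : Fin 2 → ℝ) (D : ProblemData d)
    (v : Fin 2 → ℝ × Space d → ℝ) (l : ℝ) : ℝ≥0∞ :=
  ∫⁻ t in Icc 0 T, ∫⁻ x in interface Ω U t,
    ENNReal.ofReal (l + interfaceSq T U β D v (t, x) / l) ∂surface d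

/-- The energy identity of both phases, tested with `ζ`. -/
def _root_.ParabolicInterface.totalWeak (T : ℝ) (U : Fin 2 → ℝ → Set (Space d)) (β : Fin 2 → ℝ)
    (w : Fin 2 → ℝ × Space d → ℝ) (ζ : ℝ × Space d → ℝ) : ℝ :=
  ∑ i, ∫ p in innerTube T (U i), weakIntegrand (closedTube T (U i)) (β i) (w i) ζ p

/-- Both phases end at the same graph from opposite sides. Their traces enter with opposite signs,
so only the jump of the energy flux survives, and this is controlled by the interface residuals. -/
lemma ofReal_abs_totalWeak_le_of_chart (h : Comparison T₀ T Ω U β D u v K) {c : GraphChart d}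
    {N : Set (ℝ × Space d)} (hc : c.Describes T₀ (U 0) N) (hζ : LipschitzWith L ζ)
    (hcs : HasCompactSupport ζ) (hs : tsupport ζ ⊆ innerTube T Ω ∩ N) (hA : ∀ p, |ζ p| ≤ A)
    (hl : 0 < l) :
    ENNReal.ofReal |totalWeak T U β (err u v) ζ| ≤
      ENNReal.ofReal (A * (4 * K * c.heightLip * (2 + β 0))) * interfaceBound T Ω U β D v l := by
  have hA0 : 0 ≤ A := (abs_nonneg _).trans (hA 0)
  have hβ0 := (h.coeff_pos 0).le
  set C : ℝ := 4 * K * c.heightLip * (2 + β 0) with hC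
  have hC0 : 0 ≤ C := by positivity
  set tr : Fin 2 → ((ℝ × Base d) × ℝ) → ℝ := fun i =>
    traceIntegrand c (closedTube T (U i)) (β i) (err u v i) ζ with htr
  have hmemQ : ∀ i, ∀ p ∈ tsupport ζ, c.height p = 0 → p ∈ closedTube T (U i) := fun i p hp h0 =>
    (h.mem_closedTube_iff_side hc i (hs hp).1 (hs hp).2).2 (by rw [h0, mul_zero])
  have hmain := fun i => (h.phase i).integral_weakIntegrand_eq_trace (h.coeff_pos i).le c
    (abs_side i) hζ hcs
    (fun p hp => by
      have hp1 := (hs hp).1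
      rw [← h.mem_iff_side hc i ⟨hp1.1.1.le, hp1.1.2.le⟩ hp1.2 (hs hp).2]
      exact ⟨fun hp' => hp'.2, fun hp' => ⟨hp1.1, hp'⟩⟩)
    (fun p hp h0 _ => ⟨hmemQ i p hp h0, (h.contDiffOn_err i).continuousOn p (hmemQ i p hp h0),
      h.continuousWithinAt_fderivWithin_err hc i (hs hp).1 (hs hp).2 (hmemQ i p hp h0)⟩)
  have hsum : totalWeak T U β (err u v) ζ = ∫ y in slab d, (tr 1 y - tr 0 y) := by
    rw [integral_sub (hmain 1).1 (hmain 0).1, totalWeak, Fin.sum_univ_two, (hmain 0).2, (hmain 1).2]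
    simp only [side]
    norm_num
    ring
  rw [hsum]
  -- The graph is null in space-time, so differentiability of the height almost everywhere in
  -- space-time says nothing on it. Rademacher's theorem for the profile, in the parameters of the
  -- graph, does.
  have hdiff : ∀ᵐ y ∂volume.restrict (slab d), DifferentiableAt ℝ c.profile y.1 := by
    have h1 : ∀ᵐ z : ℝ × Base d, DifferentiableAt ℝ c.profile z := c.lipschitz.ae_differentiableAt
    exact ae_restrict_of_ae (Measure.quasiMeasurePreserving_fst.ae h1)
  have hpt : ∀ᵐ y ∂volume.restrict (slab d), ‖tr 1 y - tr 0 y‖ₑ ≤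
      (tube T (interface Ω U)).indicator
        (fun p => ENNReal.ofReal (A * C) * ENNReal.ofReal (l + interfaceSq T U β D v p / l))
        (y.1.1, c.graphPoint y.1.1 y.1.2) := by
    filter_upwards [hdiff] with y hy
    have hp0 : c.param 0 y = (y.1.1, c.graphPoint y.1.1 y.1.2) := c.param_zero y
    by_cases h0 : ζ (c.param 0 y) = 0
    · simp [htr, traceIntegrand, h0]
    · have hsupp := hs (subset_tsupport ζ h0)
      have hh : c.height (c.param 0 y) = 0 := by simp
      have ht : (c.param 0 y).1 ∈ Icc 0 T := ⟨hsupp.1.1.1.le, hsupp.1.1.2.le⟩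
      have hmem : c.param 0 y ∈ tube T (interface Ω U) :=
        ⟨ht, (h.partition.mem_interface_iff hc (h.mem_Icc ht) hsupp.1.2 hsupp.2).2 hh⟩
      rw [← hp0, indicator_of_mem hmem, ← ENNReal.ofReal_mul (by positivity),
        Real.enorm_eq_ofReal_abs]
      refine ENNReal.ofReal_le_ofReal ?_
      have hd : DifferentiableAt ℝ c.height (c.param 0 y) := by
        refine c.differentiableAt_height ?_
        rw [hp0, base_graphPoint]
        exact hy
      have hfl := h.abs_flux_sub_flux_le hc hsupp.1 hsupp.2 hh hd hl
      simp only [htr, traceIntegrand, ← mul_sub, abs_mul]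
      rw [mul_assoc]
      exact mul_le_mul (hA _) hfl (abs_nonneg _) hA0
  calc ENNReal.ofReal |∫ y in slab d, (tr 1 y - tr 0 y)|
      = ‖∫ y in slab d, (tr 1 y - tr 0 y)‖ₑ := (Real.enorm_eq_ofReal_abs _).symm
    _ ≤ ∫⁻ y in slab d, ‖tr 1 y - tr 0 y‖ₑ := enorm_integral_le_lintegral_enorm _
    _ ≤ _ := lintegral_mono_ae hpt
    _ ≤ volume (Ioo (1 : ℝ) 2) * _ := lintegral_layer_le (Ioo 1 2) measurableSet_Ioo (by simp)
        fun z => (tube T (interface Ω U)).indicator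
        (fun p => ENNReal.ofReal (A * C) * ENNReal.ofReal (l + interfaceSq T U β D v p / l))
        (z.1, c.graphPoint z.1 z.2)
    _ ≤ volume (Ioo (1 : ℝ) 2) * ∫⁻ t in Icc 0 T, ∫⁻ x in interface Ω U t,
          ENNReal.ofReal (A * C) *
            ENNReal.ofReal (l + interfaceSq T U β D v (t, x) / l) ∂surface d := by
        gcongr
        exact c.lintegral_graph_le
          (fun t ht => h.partition.measurableSet_interface (h.mem_Icc ht)) _
    _ = _ := by
        simp_rw [lintegral_const_mul' _ _ ENNReal.ofReal_ne_top]
        rw [interfaceBound, Real.volume_Ioo]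
        norm_num

end Comparison

/-! ### Localization of the energy production at the interface -/

/-- A compact set covered by finitely many open sets has a subordinate partition of unity by
Lipschitz functions. -/
lemma exists_lipschitz_partition {E : Type*} [NormedAddCommGroup E] [NormedSpace ℝ E]
    [FiniteDimensional ℝ E] {ι : Type} [Fintype ι] {Z : Set E} (hZ : IsCompact Z) (W : ι → Set E)
    (hW : ∀ j, IsOpen (W j)) (hcov : Z ⊆ ⋃ j, W j) :
    ∃ ψ : ι → E → ℝ, (∀ j, ∃ L, LipschitzWith L (ψ j)) ∧ (∀ j, ∃ A, ∀ p, |ψ j p| ≤ A) ∧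
      (∀ j, tsupport (ψ j) ⊆ W j) ∧ (∀ j, ∀ p ∈ Z, |ψ j p| ≤ 1) ∧ ∀ p ∈ Z, ∑ j, ψ j p = 1 := by
  -- The factor `χ` makes the members compactly supported, hence bounded and Lipschitz, and does not
  -- change their values on `Z`.
  obtain ⟨χ, hχ, hχc, -, hχ1⟩ := exists_contDiff_cutoff hZ isOpen_univ (subset_univ Z)
  obtain ⟨f, hf⟩ := SmoothPartitionOfUnity.exists_isSubordinate (modelWithCornersSelf ℝ E)
    hZ.isClosed W hW hcov
  have hc : ∀ j, HasCompactSupport fun p => f j p * χ p := fun j => hχc.mul_left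
  have hd : ∀ j, ContDiff ℝ 1 fun p => f j p * χ p := fun j =>
    ((f j).contMDiff.contDiff.of_le (by norm_num)).mul hχ
  refine ⟨fun j p => f j p * χ p,
    fun j => (hd j).lipschitzWith_of_hasCompactSupport (hc j) one_ne_zero,
    fun j => exists_abs_le_of_hasCompactSupport (hd j).continuous (hc j),
    fun j => (closure_mono ?_).trans (hf j), fun j p hp => ?_, fun p hp => ?_⟩
  · exact fun p hp => (mul_ne_zero_iff.1 hp).1
  · simp only [hχ1 p hp, mul_one]
    rw [abs_of_nonneg (f.nonneg j p)]
    exact f.le_one j p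
  · simp only [hχ1 p hp, mul_one]
    rw [← finsum_eq_sum_of_fintype]
    exact f.sum_eq_one hp

namespace Comparison

variable {T₀ T : ℝ} {Ω : ℝ → Set (Space d)} {U : Fin 2 → ℝ → Set (Space d)} {β : Fin 2 → ℝ}
  {D : ProblemData d} {u v : Fin 2 → ℝ × Space d → ℝ} {K : ℝ≥0} {ζ : ℝ × Space d → ℝ} {L : ℝ≥0}
  {A l : ℝ}

/-- The flux is linear in its covector, and almost everywhere all the test functions are
differentiable at once. -/
lemma totalWeak_sum (h : Comparison T₀ T Ω U β D u v K) {ι : Type} [Fintype ι]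
    {η : ι → ℝ × Space d → ℝ} (hη : ∀ j, ∃ L, LipschitzWith L (η j))
    (hb : ∀ j, ∃ A, ∀ p, |η j p| ≤ A) :
    totalWeak T U β (err u v) (fun p => ∑ j, η j p) = ∑ j, totalWeak T U β (err u v) (η j) := by
  simp only [totalWeak]
  rw [Finset.sum_comm]
  refine Finset.sum_congr rfl fun i _ => ?_
  have hi : ∀ j, IntegrableOn (weakIntegrand (closedTube T (U i)) (β i) (err u v i) (η j))
      (innerTube T (U i)) := by
    intro j
    obtain ⟨L, hL⟩ := hη j
    obtain ⟨A, hA⟩ := hb j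
    exact (h.phase i).integrableOn_weakIntegrand (h.coeff_pos i).le hL hA
  rw [← integral_finsetSum _ fun j _ => hi j]
  refine integral_congr_ae (ae_restrict_of_ae ?_)
  have hd : ∀ᵐ p, ∀ j, DifferentiableAt ℝ (η j) p := by
    refine ae_all_iff.2 fun j => ?_
    obtain ⟨L, hL⟩ := hη j
    exact hL.ae_differentiableAt
  filter_upwards [hd] with p hp
  have hf : ∀ (s : Finset ι) (ξ : ι → Covector d) (b a : ℝ) (B : Covector d),
      flux b a B (∑ j ∈ s, ξ j) = ∑ j ∈ s, flux b a B (ξ j) := by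
    classical
    intro s ξ b a B
    induction s using Finset.induction_on with
    | empty => simp
    | insert x s hx ih => rw [Finset.sum_insert hx, Finset.sum_insert hx, flux_add, ih]
  simp only [weakIntegrand]
  rw [fderiv_fun_sum fun j _ => hp j, hf, Finset.mul_sum, Finset.sum_add_distrib]

lemma weakIntegral_eq_zero_of_disjoint (Q G : Set (ℝ × Space d)) (b : ℝ) (w : ℝ × Space d → ℝ)
    (hd : Disjoint (tsupport ζ) G) :
    ∫ p in G, weakIntegrand Q b w ζ p = 0 := by
  refine setIntegral_eq_zero_of_forall_eq_zero fun p hp => ?_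
  have h0 : p ∉ tsupport ζ := fun h' => disjoint_left.1 hd h' hp
  have h1 : fderiv ℝ ζ p = 0 := by
    by_contra h'
    exact h0 (support_fderiv_subset ℝ h')
  simp [weakIntegrand, h1, image_eq_zero_of_notMem_tsupport h0]

/-- A test function supported in one phase sees no energy production. -/
lemma totalWeak_eq_zero (h : Comparison T₀ T Ω U β D u v K) (i : Fin 2) (hζ : LipschitzWith L ζ)
    (hcs : HasCompactSupport ζ) (hs : tsupport ζ ⊆ innerTube T (U i)) :
    totalWeak T U β (err u v) ζ = 0 := by
  have hdis : ∀ j, j ≠ i → Disjoint (innerTube T (U i)) (innerTube T (U j)) := by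
    intro j hj
    refine disjoint_left.2 fun p hp hp' => ?_
    have h1 : p.2 ∈ U 0 p.1 → p.2 ∉ U 1 p.1 := fun hx =>
      disjoint_left.1 (h.partition.disjoint p.1 (h.mem_Icc ⟨hp.1.1.le, hp.1.2.le⟩)) hx
    have h2 := hp.2
    have h3 := hp'.2
    fin_cases i <;> fin_cases j <;> simp_all
  refine Finset.sum_eq_zero fun j _ => ?_
  by_cases hj : j = i
  · subst hj
    exact (h.phase j).integral_weakIntegrand_eq_zero _ hζ hcs hs
  · exact weakIntegral_eq_zero_of_disjoint _ _ _ _ ((hdis j hj).mono_left hs)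

/-- The energy production at the interface is controlled by the interface residuals. -/
lemma ofReal_abs_totalWeak_le (h : Comparison T₀ T Ω U β D u v K) {m : ℕ}
    {c : Fin m → GraphChart d} {N : Fin m → Set (ℝ × Space d)}
    (hc : ∀ b, (c b).Describes T₀ (U 0) (N b)) (hcov : lateral T₀ (U 0) ⊆ ⋃ b, N b)
    (hζ : LipschitzWith L ζ) (hcs : HasCompactSupport ζ) (hs : tsupport ζ ⊆ innerTube T Ω)
    (hA : ∀ p, |ζ p| ≤ A) (hl : 0 < l) :
    ENNReal.ofReal |totalWeak T U β (err u v) ζ| ≤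
      (∑ b, ENNReal.ofReal (A * (4 * K * (c b).heightLip * (2 + β 0)))) *
        interfaceBound T Ω U β D v l := by
  -- The first phase, the complement of its closure (whose part in `Ω` is in the second phase), and
  -- the charts of the lateral boundary. Only the charts can produce energy.
  set W : Option (Option (Fin m)) → Set (ℝ × Space d) := fun j =>
    j.elim (innerTube T (U 0)) fun j => j.elim (closure (tube T₀ (U 0)))ᶜ N with hWdef
  have hWo : ∀ j, IsOpen (W j) := by
    rintro (_ | _ | b)
    · exact h.isOpen_innerTube 0
    · exact isClosed_closure.isOpen_compl
    · exact (hc b).1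
  have hcov' : tsupport ζ ⊆ ⋃ j, W j := by
    intro p hp
    by_cases h1 : p ∈ closure (tube T₀ (U 0))
    · by_cases h2 : p ∈ tube T₀ (U 0)
      · exact mem_iUnion.2 ⟨none, (hs hp).1, h2.2⟩
      · obtain ⟨b, hb⟩ := mem_iUnion.1 (hcov ⟨h1, h2⟩)
        exact mem_iUnion.2 ⟨some (some b), hb⟩
    · exact mem_iUnion.2 ⟨some none, h1⟩
  obtain ⟨ψ, hψL, hψb, hψW, hψ1, hψsum⟩ := exists_lipschitz_partition hcs W hWo hcov'
  set η : Option (Option (Fin m)) → ℝ × Space d → ℝ := fun j p => ζ p * ψ j p with hη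
  have hηL : ∀ j, ∃ L, LipschitzWith L (η j) := by
    intro j
    obtain ⟨L', hL'⟩ := hψL j
    obtain ⟨B, hB⟩ := hψb j
    exact LipschitzWith.exists_mul hζ hL' hA hB
  have hηA : ∀ j p, |η j p| ≤ A := by
    intro j p
    by_cases hp : p ∈ tsupport ζ
    · rw [hη, abs_mul]
      exact (mul_le_of_le_one_right (abs_nonneg _) (hψ1 j p hp)).trans (hA p)
    · simp only [hη, image_eq_zero_of_notMem_tsupport hp, zero_mul, abs_zero]
      exact (abs_nonneg _).trans (hA p)
  have hηc : ∀ j, HasCompactSupport (η j) := fun j => hcs.mul_right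
  have hη1 : ∀ j, tsupport (η j) ⊆ tsupport ζ := fun j => tsupport_mul_subset_left
  have hη2 : ∀ j, tsupport (η j) ⊆ W j := fun j => tsupport_mul_subset_right.trans (hψW j)
  have hζsum : ζ = fun p => ∑ j, η j p := by
    ext p
    rw [← Finset.mul_sum]
    by_cases hp : p ∈ tsupport ζ
    · rw [hψsum p hp, mul_one]
    · rw [image_eq_zero_of_notMem_tsupport hp, zero_mul]
  have hz : totalWeak T U β (err u v) (η none) = 0 := by
    obtain ⟨L', hL'⟩ := hηL none
    exact h.totalWeak_eq_zero 0 hL' (hηc _) (hη2 none)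
  have hz' : totalWeak T U β (err u v) (η (some none)) = 0 := by
    obtain ⟨L', hL'⟩ := hηL (some none)
    refine h.totalWeak_eq_zero 1 hL' (hηc _) fun p hp => ?_
    have h1 := hs (hη1 _ hp)
    have ht := h.mem_Icc ⟨h1.1.1.le, h1.1.2.le⟩
    exact ⟨h1.1, h.partition.mem_one_of_notMem_closure ht h1.2 fun hcl =>
      hη2 _ hp (IsLipschitzTube.mk_mem_closure ht hcl)⟩
  rw [hζsum, h.totalWeak_sum hηL fun j => ⟨A, hηA j⟩, Fintype.sum_option, Fintype.sum_option, hz,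
    hz', zero_add, zero_add, Finset.sum_mul]
  calc _ ≤ ENNReal.ofReal (∑ b, |totalWeak T U β (err u v) (η (some (some b)))|) :=
        ENNReal.ofReal_le_ofReal (Finset.abs_sum_le_sum_abs _ _)
    _ = ∑ b, ENNReal.ofReal |totalWeak T U β (err u v) (η (some (some b)))| :=
        ENNReal.ofReal_sum_of_nonneg fun _ _ => abs_nonneg _
    _ ≤ _ := by
        refine Finset.sum_le_sum fun b _ => ?_
        obtain ⟨L', hL'⟩ := hηL (some (some b))
        exact h.ofReal_abs_totalWeak_le_of_chart (hc b) hL' (hηc _)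
          (fun p hp => ⟨hs (hη1 _ hp), hη2 _ hp⟩) (hηA _) hl

end Comparison

/-! ### Distance to the exterior of the whole domain -/

/-- The closed complement of a moving domain in `[0, T] × ℝ^d`. -/
def exterior (T : ℝ) (U : ℝ → Set (Space d)) : Set (ℝ × Space d) :=
  {q | q.1 ∈ Icc 0 T ∧ q.2 ∉ U q.1}

/-- The distance to the exterior. -/
def depth (T : ℝ) (U : ℝ → Set (Space d)) (p : ℝ × Space d) : ℝ := Metric.infDist p (exterior T U)

namespace IsLipschitzTube

variable {T : ℝ} {U : ℝ → Set (Space d)}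

lemma isClosed_exterior (h : IsLipschitzTube T U) : IsClosed (exterior T U) := by
  rw [← isOpen_compl_iff, isOpen_iff_mem_nhds]
  intro p hp
  by_cases ht : p.1 ∈ Icc 0 T
  · have hp' : p ∈ tube T U := ⟨ht, by
      by_contra h'
      exact hp ⟨ht, h'⟩⟩
    filter_upwards [h.isOpen p hp'] with q hq hq'
    exact hq'.2 (hq hq'.1).2
  · filter_upwards [(isClosed_Icc.preimage continuous_fst).isOpen_compl.mem_nhds ht] with q hq hq'
    exact hq hq'.1

/-- By convention `Metric.infDist` to the empty set is zero, so the depth would be meaningless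
without this. A bounded tube cannot fill the space at time `0`. -/
lemma exterior_nonempty (h : IsLipschitzTube T U) (hd : 1 ≤ d) (hT : 0 ≤ T) :
    (exterior T U).Nonempty := by
  by_contra hne
  rw [not_nonempty_iff_eq_empty] at hne
  have hU : ∀ x, (0, x) ∈ tube T U := by
    intro x
    by_contra hx
    have : ((0 : ℝ), x) ∈ exterior T U := ⟨⟨le_rfl, hT⟩, fun h' => hx ⟨⟨le_rfl, hT⟩, h'⟩⟩
    rw [hne] at this
    exact this
  obtain ⟨R, hR⟩ := h.isBounded.exists_norm_le
  have h1 := hR _ (hU (EuclideanSpace.single ⟨0, hd⟩ (|R| + 1)))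
  rw [Prod.norm_mk, norm_zero, max_eq_right (norm_nonneg _), PiLp.norm_single,
    Real.norm_eq_abs, abs_of_pos (by positivity)] at h1
  linarith [le_abs_self R]

/-- Points of the tube that are close to the exterior lie in one of the charts, at a height
controlled by their distance to the exterior. -/
lemma exists_height_le (h : IsLipschitzTube T U) (hne : (exterior T U).Nonempty) {m : ℕ}
    {c : Fin m → GraphChart d} {N : Fin m → Set (ℝ × Space d)}
    (hc : ∀ b, (c b).Describes T U (N b)) (hcov : lateral T U ⊆ ⋃ b, N b) :
    ∃ r > 0, ∀ p ∈ tube T U, depth T U p < r →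
      ∃ b, 0 < (c b).height p ∧ (c b).height p ≤ (c b).heightLip * depth T U p := by
  obtain ⟨r₀, hr₀, hleb⟩ := lebesgue_number_lemma_of_metric h.isCompact_lateral
    (fun b => (hc b).1) hcov
  have hY := h.isClosed_exterior
  -- The part of the closed tube away from the lateral boundary is compact and disjoint from the
  -- closed exterior, hence at positive distance from it.
  set C : Set (ℝ × Space d) := closure (tube T U) \ Metric.thickening (r₀ / 2) (lateral T U)
  have hC : IsCompact C := h.isCompact_closure.diff Metric.isOpen_thickening
  have hdis : Disjoint C (exterior T U) := by
    refine disjoint_left.2 fun p hp hp' => hp.2 ?_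
    exact Metric.self_subset_thickening (by positivity) _ ⟨hp.1, fun h' => hp'.2 h'.2⟩
  obtain ⟨r₁, hr₁, hr⟩ := hdis.exists_thickenings hC hY
  refine ⟨min (r₀ / 2) r₁, by positivity, fun p hp hpd => ?_⟩
  -- The nearest exterior point lies in the same chart as `p` by the choice of the Lebesgue number.
  -- Its height is at most zero, so the Lipschitz bound of the height compares `p` with it.
  obtain ⟨q, hq, hpq⟩ := hY.exists_infDist_eq_dist hne p
  have hpq' : depth T U p = dist p q := hpq
  have hpC : p ∉ C := by
    intro hpC
    refine disjoint_left.1 hr (Metric.self_subset_thickening hr₁ _ hpC)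
      (Metric.mem_thickening_iff.2 ⟨q, hq, ?_⟩)
    rw [← hpq']
    exact hpd.trans_le (min_le_right _ _)
  have hpth : p ∈ Metric.thickening (r₀ / 2) (lateral T U) := by
    by_contra h'
    exact hpC ⟨subset_closure hp, h'⟩
  obtain ⟨z, hz, hpz⟩ := Metric.mem_thickening_iff.1 hpth
  obtain ⟨b, hb⟩ := hleb z hz
  have hqN : q ∈ N b := by
    refine hb ?_
    rw [Metric.mem_ball]
    have : dist q z ≤ dist p q + dist p z := by
      rw [dist_comm p q]
      exact dist_triangle _ _ _
    have h3 := hpd.trans_le (min_le_left _ _)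
    linarith
  have hpN : p ∈ N b := hb (by
    rw [Metric.mem_ball]
    linarith)
  refine ⟨b, ((hc b).2 p hpN hp.1).1 hp.2, ?_⟩
  have h1 : (c b).height q ≤ 0 := by
    by_contra! h'
    exact hq.2 (((hc b).2 q hqN hq.1).2 h')
  have h2 := (c b).lipschitzWith_height.dist_le_mul p q
  rw [Real.dist_eq] at h2
  rw [hpq']
  linarith [le_abs_self ((c b).height p - (c b).height q)]

end IsLipschitzTube

/-! ### The test function of the energy estimate -/

/-- The weight in time. -/
def timeWeight (T ε t : ℝ) : ℝ := max 0 (min T (T - ε - t))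

lemma timeWeight_nonneg (T ε t : ℝ) : 0 ≤ timeWeight T ε t := le_max_left _ _

lemma timeWeight_le {T : ℝ} (hT : 0 ≤ T) (ε t : ℝ) : timeWeight T ε t ≤ T :=
  max_le hT (min_le_left _ _)

lemma lipschitzWith_timeWeight (T ε : ℝ) : LipschitzWith 1 (timeWeight T ε) := by
  have h1 : LipschitzWith 1 fun t : ℝ => T - ε - t := by
    simpa using (LipschitzWith.const (α := ℝ) (T - ε)).sub LipschitzWith.id
  exact (h1.const_min T).const_max 0

/-- For positive times the cap `T` is inactive and the only kink is at `T - ε`; the cap merely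
bounds the weight at negative times. -/
lemma hasDerivAt_timeWeight {T ε t : ℝ} (hε : 0 < ε) (ht0 : 0 < t) (ht : t ≠ T - ε) :
    HasDerivAt (timeWeight T ε) (indicator (Iio (T - ε)) (-1) t) t := by
  rcases lt_or_gt_of_ne ht with h | h
  · rw [indicator_of_mem (show t ∈ Iio (T - ε) from h)]
    refine ((hasDerivAt_id t).const_sub (T - ε)).congr_of_eventuallyEq ?_
    filter_upwards [Ioo_mem_nhds ht0 h] with s hs
    rw [timeWeight, min_eq_right (by linarith [hs.1]), max_eq_right (by linarith [hs.2])]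
    rfl
  · rw [indicator_of_notMem (show t ∉ Iio (T - ε) from fun h' => lt_asymm h h')]
    refine (hasDerivAt_const t (0 : ℝ)).congr_of_eventuallyEq ?_
    filter_upwards [Ioi_mem_nhds h] with s hs
    refine max_eq_left ((min_le_right _ _).trans ?_)
    have : T - ε < s := hs
    linarith

/-- The covector `dt`. -/
def dt (d : ℕ) : Covector d := ContinuousLinearMap.fst ℝ ℝ (Space d)

lemma flux_dt (b a : ℝ) (A : Covector d) : flux b a A (dt d) = a ^ 2 := by
  have : spacePart (dt d) = 0 := by
    ext j
    simp [spacePart, dt]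
  rw [flux, this, inner_zero_right, mul_zero, sub_zero]
  simp [dt]

/-- The test function of the energy estimate: it decreases in time like `T - t` and is cut off
near the initial time, the final time and the outer boundary. -/
def testFun (T₀ T : ℝ) (Ω : ℝ → Set (Space d)) (ε : ℝ) (p : ℝ × Space d) : ℝ :=
  timeWeight T ε p.1 * (ramp (p.1 / ε) * ramp (depth T₀ Ω p / ε))

section TestFun

variable {T₀ T ε : ℝ} {Ω : ℝ → Set (Space d)}

lemma testFun_nonneg (p : ℝ × Space d) : 0 ≤ testFun T₀ T Ω ε p :=
  mul_nonneg (timeWeight_nonneg _ _ _) (mul_nonneg (ramp_nonneg _) (ramp_nonneg _))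

lemma testFun_le (hT : 0 ≤ T) (p : ℝ × Space d) : testFun T₀ T Ω ε p ≤ T := by
  have h1 : ramp (p.1 / ε) * ramp (depth T₀ Ω p / ε) ≤ 1 :=
    mul_le_one₀ (ramp_le_one _) (ramp_nonneg _) (ramp_le_one _)
  calc testFun T₀ T Ω ε p ≤ timeWeight T ε p.1 := mul_le_of_le_one_right (timeWeight_nonneg _ _ _) h1
    _ ≤ T := timeWeight_le hT _ _

lemma lipschitzWith_ramp_depth (hε : 0 < ε) :
    LipschitzWith (Real.toNNReal (1 / ε)) fun p : ℝ × Space d => ramp (depth T₀ Ω p / ε) := by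
  refine LipschitzWith.of_dist_le_mul fun p q => ?_
  have h1 := lipschitzWith_ramp.dist_le_mul (depth T₀ Ω p / ε) (depth T₀ Ω q / ε)
  have h2 := (Metric.lipschitz_infDist_pt (exterior T₀ Ω)).dist_le_mul p q
  rw [NNReal.coe_one, one_mul] at h1 h2
  refine h1.trans ?_
  rw [Real.coe_toNNReal _ (by positivity), Real.dist_eq, ← sub_div, abs_div, abs_of_pos hε,
    div_mul_eq_mul_div, one_mul]
  rw [Real.dist_eq] at h2
  exact div_le_div_of_nonneg_right h2 hε.le

lemma lipschitzWith_ramp_time (hε : 0 < ε) :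
    LipschitzWith (Real.toNNReal (1 / ε)) fun p : ℝ × Space d => ramp (p.1 / ε) := by
  refine LipschitzWith.of_dist_le_mul fun p q => ?_
  have h1 := lipschitzWith_ramp.dist_le_mul (p.1 / ε) (q.1 / ε)
  have h2 : dist p.1 q.1 ≤ dist p q := le_max_left _ _
  rw [NNReal.coe_one, one_mul] at h1
  refine h1.trans ?_
  rw [Real.coe_toNNReal _ (by positivity), Real.dist_eq, ← sub_div, abs_div, abs_of_pos hε,
    div_mul_eq_mul_div, one_mul]
  rw [Real.dist_eq] at h2
  exact div_le_div_of_nonneg_right h2 hε.le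

lemma exists_lipschitzWith_testFun (hT : 0 ≤ T) (hε : 0 < ε) :
    ∃ L, LipschitzWith L (testFun T₀ T Ω ε) := by
  obtain ⟨L, hL⟩ := LipschitzWith.exists_mul (lipschitzWith_ramp_time (d := d) hε)
    (lipschitzWith_ramp_depth (T₀ := T₀) (Ω := Ω) hε) (fun p => abs_ramp_le_one _)
    fun p => abs_ramp_le_one _
  refine LipschitzWith.exists_mul ((lipschitzWith_timeWeight T ε).comp LipschitzWith.prod_fst) hL
    (A := T) (B := 1) (fun p => ?_) fun p => ?_
  · rw [abs_of_nonneg (timeWeight_nonneg _ _ _)]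
    exact timeWeight_le hT _ _
  · rw [abs_mul]
    exact mul_le_one₀ (abs_ramp_le_one _) (abs_nonneg _) (abs_ramp_le_one _)

lemma tsupport_testFun_subset (hε : 0 < ε) : tsupport (testFun T₀ T Ω ε) ⊆
    {p | ε ≤ p.1 ∧ p.1 ≤ T - ε ∧ ε ≤ depth T₀ Ω p} := by
  have hcl : IsClosed {p : ℝ × Space d | ε ≤ p.1 ∧ p.1 ≤ T - ε ∧ ε ≤ depth T₀ Ω p} :=
    (isClosed_le continuous_const continuous_fst).inter
      ((isClosed_le continuous_fst continuous_const).inter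
        (isClosed_le continuous_const (Metric.continuous_infDist_pt _)))
  refine closure_minimal (fun p hp => ?_) hcl
  have h1 : timeWeight T ε p.1 ≠ 0 := fun h => hp (by simp [testFun, h])
  have h2 : ramp (p.1 / ε) ≠ 0 := fun h => hp (by simp [testFun, h])
  have h3 : ramp (depth T₀ Ω p / ε) ≠ 0 := fun h => hp (by simp [testFun, h])
  refine ⟨?_, ?_, ?_⟩
  · by_contra! h
    exact h2 (ramp_of_le ((div_le_one hε).2 h.le))
  · by_contra! h
    exact h1 (max_eq_left ((min_le_right _ _).trans (by linarith)))
  · by_contra! h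
    exact h3 (ramp_of_le ((div_le_one hε).2 h.le))

lemma tsupport_testFun_subset_innerTube (hT : T ≤ T₀) (hε : 0 < ε) :
    tsupport (testFun T₀ T Ω ε) ⊆ innerTube T Ω := by
  intro p hp
  obtain ⟨h1, h2, h3⟩ := tsupport_testFun_subset hε hp
  refine ⟨⟨by linarith, by linarith⟩, ?_⟩
  by_contra h'
  have : p ∈ exterior T₀ Ω := ⟨⟨by linarith, by linarith⟩, h'⟩
  rw [depth, Metric.infDist_zero_of_mem this] at h3
  linarith

lemma hasCompactSupport_testFun (hΩ : IsLipschitzTube T₀ Ω) (hT : T ≤ T₀) (hε : 0 < ε) :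
    HasCompactSupport (testFun T₀ T Ω ε) := by
  refine hΩ.isCompact_closure.of_isClosed_subset (isClosed_tsupport _) fun p hp => ?_
  have := tsupport_testFun_subset_innerTube hT hε hp
  exact subset_closure ⟨⟨this.1.1.le, this.1.2.le.trans hT⟩, this.2⟩

lemma ae_fst_ne (a : ℝ) : ∀ᵐ p : ℝ × Space d, p.1 ≠ a :=
  Measure.quasiMeasurePreserving_fst.ae (Measure.ae_ne volume a)

/-- The distance function is 1-Lipschitz, which gives the slope `1 / ε`; beyond depth `2 * ε` the
ramp is locally constant. -/
lemma norm_fderiv_ramp_depth_le (hε : 0 < ε) (p : ℝ × Space d) :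
    ‖fderiv ℝ (fun q => ramp (depth T₀ Ω q / ε)) p‖ ≤
      {q | depth T₀ Ω q ≤ 2 * ε}.indicator (fun _ => 1 / ε) p := by
  by_cases hp : depth T₀ Ω p ≤ 2 * ε
  · rw [indicator_of_mem (by exact hp)]
    have := norm_fderiv_le_of_lipschitz ℝ (lipschitzWith_ramp_depth (T₀ := T₀) (Ω := Ω) hε)
      (x₀ := p)
    rwa [Real.coe_toNNReal _ (by positivity)] at this
  · rw [indicator_of_notMem (by exact hp)]
    have : (fun q => ramp (depth T₀ Ω q / ε)) =ᶠ[𝓝 p] fun _ => 1 := by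
      have hc : Continuous (depth T₀ Ω) := Metric.continuous_infDist_pt _
      filter_upwards [hc.continuousAt.eventually (lt_mem_nhds (not_le.1 hp))] with q hq
      refine ramp_of_ge ?_
      rw [le_div_iff₀ hε]
      exact hq.le
    rw [this.fderiv_eq]
    simp

/-- The derivative of the test function. -/
lemma ae_hasFDerivAt_testFun (hε : 0 < ε) : ∀ᵐ p : ℝ × Space d, 0 < p.1 →
    HasFDerivAt (testFun T₀ T Ω ε)
      ((indicator (Iio (T - ε)) (-1) p.1 * (ramp (p.1 / ε) * ramp (depth T₀ Ω p / ε)) +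
        timeWeight T ε p.1 * ramp (depth T₀ Ω p / ε) *
          (indicator (Ioo 1 2) 1 (p.1 / ε) * (1 / ε))) • dt d +
        (timeWeight T ε p.1 * ramp (p.1 / ε)) • fderiv ℝ (fun q => ramp (depth T₀ Ω q / ε)) p) p := by
  filter_upwards [(lipschitzWith_ramp_depth (d := d) (T₀ := T₀) (Ω := Ω)
    hε).ae_differentiableAt, ae_fst_ne (T - ε), ae_fst_ne ε, ae_fst_ne (2 * ε)]
    with p h1 h2 h3 h4 hp
  have e1 : HasFDerivAt (fun q : ℝ × Space d => q.1) (dt d) p := hasFDerivAt_fst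
  have e2 := (hasDerivAt_timeWeight hε hp h2).comp_hasFDerivAt p e1
  have e3 : HasFDerivAt (fun q : ℝ × Space d => q.1 / ε) ((1 / ε) • dt d) p := by
    have := e1.const_mul (1 / ε)
    refine this.congr_of_eventuallyEq (Eventually.of_forall fun q => ?_)
    simp only
    ring
  have e4 := (hasDerivAt_ramp (r := p.1 / ε) (by
    rw [Ne, div_eq_one_iff_eq hε.ne']
    exact h3) (by
    rw [Ne, div_eq_iff hε.ne']
    exact h4)).comp_hasFDerivAt p e3
  have e5 := e2.mul (e4.mul h1.hasFDerivAt)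
  refine e5.congr_fderiv ?_
  simp only [Function.comp, Pi.mul_apply]
  module

end TestFun

/-! ### The energy inequality with cut-offs -/

/-- The integrand at the initial layer. -/
def timeLayer (T ε : ℝ) (w : ℝ × Space d → ℝ) : ℝ × Space d → ℝ≥0∞ :=
  {p | p.1 ∈ Ioo ε (2 * ε)}.indicator fun p => ENNReal.ofReal (T / ε * w p ^ 2)

/-- The integrand at the layer along the outer boundary. -/
def stripLayer (T₀ : ℝ) (Ω : ℝ → Set (Space d)) (B ε : ℝ) (w : ℝ × Space d → ℝ) :
    ℝ × Space d → ℝ≥0∞ :=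
  {p | depth T₀ Ω p ≤ 2 * ε}.indicator fun p => ENNReal.ofReal (B / ε * |w p|)

/-- The weight of the energy density. -/
def energyWeight (T₀ T : ℝ) (Ω : ℝ → Set (Space d)) (ε : ℝ) (p : ℝ × Space d) : ℝ :=
  indicator (Iio (T - ε)) 1 p.1 * (ramp (p.1 / ε) * ramp (depth T₀ Ω p / ε))

lemma continuous_depth (T₀ : ℝ) (Ω : ℝ → Set (Space d)) : Continuous (depth T₀ Ω) :=
  Metric.continuous_infDist_pt _

lemma energyWeight_nonneg (T₀ T : ℝ) (Ω : ℝ → Set (Space d)) (ε : ℝ) (p : ℝ × Space d) :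
    0 ≤ energyWeight T₀ T Ω ε p :=
  mul_nonneg (indicator_nonneg (fun _ _ => zero_le_one) _)
    (mul_nonneg (ramp_nonneg _) (ramp_nonneg _))

lemma energyWeight_le_one (T₀ T : ℝ) (Ω : ℝ → Set (Space d)) (ε : ℝ) (p : ℝ × Space d) :
    energyWeight T₀ T Ω ε p ≤ 1 :=
  mul_le_one₀ (indicator_le_self' (fun _ _ => zero_le_one) _)
    (mul_nonneg (ramp_nonneg _) (ramp_nonneg _))
    (mul_le_one₀ (ramp_le_one _) (ramp_nonneg _) (ramp_le_one _))

lemma measurable_energyWeight (T₀ T : ℝ) (Ω : ℝ → Set (Space d)) (ε : ℝ) :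
    Measurable (energyWeight T₀ T Ω ε) := by
  have h1 : Measurable fun t : ℝ => indicator (Iio (T - ε)) (1 : ℝ → ℝ) t :=
    measurable_one.indicator measurableSet_Iio
  have h2 : Measurable ramp := lipschitzWith_ramp.continuous.measurable
  exact (h1.comp measurable_fst).mul ((h2.comp (measurable_fst.div_const _)).mul
    (h2.comp ((continuous_depth T₀ Ω).measurable.div_const _)))

/-- Passing to the positive part can only increase the integral, and without integrability the left
side is `0` by convention. -/
lemma ofReal_integral_le_lintegral {α : Type*} [MeasurableSpace α] {μ : Measure α} (f : α → ℝ) :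
    ENNReal.ofReal (∫ x, f x ∂μ) ≤ ∫⁻ x, ENNReal.ofReal (f x) ∂μ := by
  by_cases hf : Integrable f μ
  · calc ENNReal.ofReal (∫ x, f x ∂μ) ≤ ENNReal.ofReal (∫ x, max (f x) 0 ∂μ) :=
          ENNReal.ofReal_le_ofReal (integral_mono hf hf.pos_part fun x => le_max_left _ _)
      _ = ∫⁻ x, ENNReal.ofReal (max (f x) 0) ∂μ :=
          ofReal_integral_eq_lintegral_ofReal hf.pos_part (ae_of_all _ fun x => le_max_right _ _)
      _ = _ := by simp
  · simp [integral_undef hf]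

namespace Comparison

variable {T₀ T : ℝ} {Ω : ℝ → Set (Space d)} {U : Fin 2 → ℝ → Set (Space d)} {β : Fin 2 → ℝ}
  {D : ProblemData d} {u v : Fin 2 → ℝ × Space d → ℝ} {K : ℝ≥0} {ε : ℝ}

lemma interiorResidual_eq (h : Comparison T₀ T Ω U β D u v K) {i : Fin 2} {p : ℝ × Space d}
    (hp : p ∈ innerTube T (U i)) : interiorResidual T U β D v i p =
      -(timeDeriv (closedTube T (U i)) (err u v i) p -
        β i * spaceLaplacian (closedTube T (U i)) (err u v i) p) := by
  have h1 := h.solution.equation i p.1 ⟨hp.1.1, hp.1.2.le⟩ p.2 hp.2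
  rw [Prod.mk.eta] at h1
  have h2 := h.fderivWithin_err (innerTube_subset_closedTube _ hp)
    (uniqueDiffWithinAt_of_mem_nhds (h.closedTube_mem_nhds hp))
  have h3 := h.iteratedFDerivWithin_err hp
  simp only [interiorResidual, timeDeriv, spaceLaplacian] at h1 ⊢
  rw [h2, h3]
  simp only [sub_apply, Finset.sum_sub_distrib]
  linarith

/-- The pointwise energy inequality behind the stability estimate. -/
lemma ae_energy_le (h : Comparison T₀ T Ω U β D u v K) (i : Fin 2) (hε : 0 < ε) :
    ∀ᵐ p ∂volume.restrict (innerTube T (U i)),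
      ENNReal.ofReal (err u v i p ^ 2 * energyWeight T₀ T Ω ε p +
        weakIntegrand (closedTube T (U i)) (β i) (err u v i) (testFun T₀ T Ω ε) p) ≤
      ENNReal.ofReal (4 * K * T * |interiorResidual T U β D v i p|) + timeLayer T ε (err u v i) p +
        stripLayer T₀ Ω (T * ((1 + 2 * β i) * (2 * K))) ε (err u v i) p := by
  filter_upwards [ae_restrict_of_ae (ae_hasFDerivAt_testFun (d := d) (T₀ := T₀) (T := T) (Ω := Ω) hε),
    ae_restrict_mem (h.isOpen_innerTube i).measurableSet] with p hp hpG
  have hT := h.pos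
  have hK0 : (0 : ℝ) ≤ K := K.coe_nonneg
  have hβ := (h.coeff_pos i).le
  have hpQ := innerTube_subset_closedTube (U i) hpG
  have hw := h.abs_err_le hpQ
  have hf := (hp hpG.1.1).fderiv
  set Q := closedTube T (U i)
  set w := err u v i with hwdef
  set θ := ramp (p.1 / ε)
  set κ := ramp (depth T₀ Ω p / ε)
  set ω := timeWeight T ε p.1
  have hθ0 : 0 ≤ θ := ramp_nonneg _
  have hθ1 : θ ≤ 1 := ramp_le_one _
  have hκ0 : 0 ≤ κ := ramp_nonneg _
  have hκ1 : κ ≤ 1 := ramp_le_one _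
  have hω0 : 0 ≤ ω := timeWeight_nonneg _ _ _
  have hω1 : ω ≤ T := timeWeight_le hT.le _ _
  set ξ := fderiv ℝ (fun q => ramp (depth T₀ Ω q / ε)) p
  set A := fderivWithin ℝ w Q p
  set R := interiorResidual T U β D v i p with hR
  have hRe : timeDeriv Q w p - β i * spaceLaplacian Q w p = -R := by
    rw [hR, h.interiorResidual_eq hpG, neg_neg]
  have hξ : ‖ξ‖ ≤ {q | depth T₀ Ω q ≤ 2 * ε}.indicator (fun _ => 1 / ε) p :=
    norm_fderiv_ramp_depth_le hε p
  have hζ0 : 0 ≤ testFun T₀ T Ω ε p := testFun_nonneg p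
  have hζ1 : testFun T₀ T Ω ε p ≤ T := testFun_le hT.le p
  -- The gradient term is nonpositive and is dropped; the remaining factor `2 |w|` is at most `4 *
  -- K`.
  have b1 : density Q (β i) w p * testFun T₀ T Ω ε p ≤ 4 * K * T * |R| := by
    have e1 : density Q (β i) w p ≤ 4 * K * |R| := by
      rw [density, hRe]
      have : 2 * w p * -R ≤ 4 * K * |R| := by
        refine (le_abs_self _).trans ?_
        rw [abs_mul, abs_neg, abs_mul, abs_two]
        exact mul_le_mul_of_nonneg_right (by linarith) (abs_nonneg _)
      nlinarith [mul_nonneg hβ (sq_nonneg ‖spaceGrad Q w p‖)]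
    calc _ ≤ 4 * K * |R| * testFun T₀ T Ω ε p := mul_le_mul_of_nonneg_right e1 hζ0
      _ ≤ 4 * K * |R| * T := mul_le_mul_of_nonneg_left hζ1 (by positivity)
      _ = _ := by ring
  have b2 : ENNReal.ofReal (w p ^ 2 * (ω * κ * (indicator (Ioo 1 2) 1 (p.1 / ε) * (1 / ε)))) ≤
      timeLayer T ε w p := by
    unfold timeLayer
    by_cases ht : p.1 ∈ Ioo ε (2 * ε)
    · have ht' : p.1 / ε ∈ Ioo (1 : ℝ) 2 := ⟨(one_lt_div hε).2 ht.1, (div_lt_iff₀ hε).2 ht.2⟩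
      rw [indicator_of_mem ht', indicator_of_mem (show p ∈ {p | p.1 ∈ Ioo ε (2 * ε)} from ht)]
      refine ENNReal.ofReal_le_ofReal ?_
      rw [Pi.one_apply, one_mul, mul_comm, mul_one_div]
      have : ω * κ ≤ T := (mul_le_of_le_one_right hω0 hκ1).trans hω1
      gcongr
    · have ht' : p.1 / ε ∉ Ioo (1 : ℝ) 2 := fun h' =>
        ht ⟨(one_lt_div hε).1 h'.1, (div_lt_iff₀ hε).1 h'.2⟩
      rw [indicator_of_notMem ht']
      simp
  -- Only the cut-off by depth contributes here. Its derivative vanishes off the strip and is at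
  -- most `1 / ε` on it, and the flux keeps one factor `|w p|`.
  have b3 : ENNReal.ofReal (ω * θ * flux (β i) (w p) A ξ) ≤
      stripLayer T₀ Ω (T * ((1 + 2 * β i) * (2 * K))) ε w p := by
    have e1 : |flux (β i) (w p) A ξ| ≤ (1 + 2 * β i) * (2 * K) * |w p| * ‖ξ‖ :=
      abs_flux_le hβ hw ((h.phase i).norm_fderiv_le p hpG) ξ
    have e2 : ω * θ ≤ T := (mul_le_of_le_one_right hω0 hθ1).trans hω1
    unfold stripLayer
    by_cases hd : depth T₀ Ω p ≤ 2 * ε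
    · rw [indicator_of_mem (show p ∈ {p | depth T₀ Ω p ≤ 2 * ε} from hd)] at hξ ⊢
      refine ENNReal.ofReal_le_ofReal ((le_abs_self _).trans ?_)
      rw [abs_mul, abs_of_nonneg (mul_nonneg hω0 hθ0)]
      calc _ ≤ T * ((1 + 2 * β i) * (2 * K) * |w p| * (1 / ε)) := by
            refine mul_le_mul e2 (e1.trans ?_) (abs_nonneg _) hT.le
            gcongr
        _ = _ := by ring
    · rw [indicator_of_notMem (show p ∉ {p | depth T₀ Ω p ≤ 2 * ε} from hd)] at hξ ⊢
      rw [norm_le_zero_iff.1 hξ, flux_zero, mul_zero, ENNReal.ofReal_zero]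
  -- The derivative `-1` of the time weight produces `-w²` times the energy weight, which the added
  -- term cancels.
  have e : w p ^ 2 * energyWeight T₀ T Ω ε p + weakIntegrand Q (β i) w (testFun T₀ T Ω ε) p =
      density Q (β i) w p * testFun T₀ T Ω ε p +
        w p ^ 2 * (ω * κ * (indicator (Ioo 1 2) 1 (p.1 / ε) * (1 / ε))) +
        ω * θ * flux (β i) (w p) A ξ := by
    have e2 : indicator (Iio (T - ε)) (-1 : ℝ → ℝ) p.1 = -indicator (Iio (T - ε)) 1 p.1 := by
      exact congr_fun (indicator_neg (Iio (T - ε)) (1 : ℝ → ℝ)) p.1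
    rw [weakIntegrand, hf, flux_add, flux_smul, flux_smul, flux_dt, e2, energyWeight]
    ring
  rw [e]
  refine ENNReal.ofReal_add_le.trans (add_le_add (ENNReal.ofReal_add_le.trans (add_le_add ?_ b2)) b3)
  exact ENNReal.ofReal_le_ofReal b1

lemma aemeasurable_err (h : Comparison T₀ T Ω U β D u v K) (i : Fin 2) :
    AEMeasurable (err u v i) (volume.restrict (innerTube T (U i))) :=
  (((h.phase i).contDiffOn_interior).continuousOn).aemeasurable (h.isOpen_innerTube i).measurableSet

lemma integrableOn_energy (h : Comparison T₀ T Ω U β D u v K) (i : Fin 2) (ε : ℝ) :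
    IntegrableOn (fun p => err u v i p ^ 2 * energyWeight T₀ T Ω ε p) (innerTube T (U i)) := by
  refine (h.phase i).integrableOn (C := (2 * K) ^ 2) ?_ (ae_of_all _ fun p hp => ?_)
  · exact (((h.aemeasurable_err i).pow_const 2).mul
      (measurable_energyWeight T₀ T Ω ε).aemeasurable).aestronglyMeasurable
  · rw [abs_mul, abs_of_nonneg (energyWeight_nonneg _ _ _ _ _), abs_of_nonneg (sq_nonneg _)]
    have h1 := h.abs_err_le (innerTube_subset_closedTube _ hp)
    calc _ ≤ err u v i p ^ 2 * 1 :=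
          mul_le_mul_of_nonneg_left (energyWeight_le_one _ _ _ _ _) (sq_nonneg _)
      _ ≤ _ := by
          rw [mul_one, ← sq_abs]
          gcongr

/-- The energy inequality with a cut-off at distance `ε`. -/
lemma ofReal_sum_energy_le (h : Comparison T₀ T Ω U β D u v K) (hε : 0 < ε) :
    ENNReal.ofReal (∑ i, ∫ p in innerTube T (U i), err u v i p ^ 2 * energyWeight T₀ T Ω ε p) ≤
      ENNReal.ofReal |totalWeak T U β (err u v) (testFun T₀ T Ω ε)| +
      ∑ i, ((∫⁻ p in innerTube T (U i),
          ENNReal.ofReal (4 * K * T * |interiorResidual T U β D v i p|)) +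
        (∫⁻ p in innerTube T (U i), timeLayer T ε (err u v i) p) +
        ∫⁻ p in innerTube T (U i),
          stripLayer T₀ Ω (T * ((1 + 2 * β i) * (2 * K))) ε (err u v i) p) := by
  obtain ⟨L, hL⟩ := exists_lipschitzWith_testFun (T₀ := T₀) (Ω := Ω) h.pos.le hε
  have hi : ∀ i, IntegrableOn (weakIntegrand (closedTube T (U i)) (β i) (err u v i)
      (testFun T₀ T Ω ε)) (innerTube T (U i)) := fun i =>
    (h.phase i).integrableOn_weakIntegrand (h.coeff_pos i).le hL (C := T) fun p => by
      rw [abs_of_nonneg (testFun_nonneg p)]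
      exact testFun_le h.pos.le p
  have hle : ∀ i, ENNReal.ofReal (∫ p in innerTube T (U i),
      (err u v i p ^ 2 * energyWeight T₀ T Ω ε p +
        weakIntegrand (closedTube T (U i)) (β i) (err u v i) (testFun T₀ T Ω ε) p)) ≤
      (∫⁻ p in innerTube T (U i), ENNReal.ofReal (4 * K * T * |interiorResidual T U β D v i p|)) +
        (∫⁻ p in innerTube T (U i), timeLayer T ε (err u v i) p) +
        ∫⁻ p in innerTube T (U i),
          stripLayer T₀ Ω (T * ((1 + 2 * β i) * (2 * K))) ε (err u v i) p := by
    intro i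
    refine (ofReal_integral_le_lintegral _).trans
      ((lintegral_mono_ae (h.ae_energy_le i hε)).trans_eq ?_)
    have m1 : AEMeasurable (timeLayer T ε (err u v i)) (volume.restrict (innerTube T (U i))) :=
      ((((h.aemeasurable_err i).pow_const 2).const_mul (T / ε)).ennreal_ofReal).indicator
        (measurable_fst measurableSet_Ioo)
    have m2 : AEMeasurable (stripLayer T₀ Ω (T * ((1 + 2 * β i) * (2 * K))) ε (err u v i))
        (volume.restrict (innerTube T (U i))) :=
      (((h.aemeasurable_err i).abs.const_mul _).ennreal_ofReal).indicator
        (measurableSet_le (continuous_depth T₀ Ω).measurable measurable_const)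
    rw [lintegral_add_right' _ m2, lintegral_add_right' _ m1]
  have e : ∑ i, ∫ p in innerTube T (U i), err u v i p ^ 2 * energyWeight T₀ T Ω ε p =
      (∑ i, ∫ p in innerTube T (U i), (err u v i p ^ 2 * energyWeight T₀ T Ω ε p +
        weakIntegrand (closedTube T (U i)) (β i) (err u v i) (testFun T₀ T Ω ε) p)) -
      totalWeak T U β (err u v) (testFun T₀ T Ω ε) := by
    rw [totalWeak, ← Finset.sum_sub_distrib]
    refine Finset.sum_congr rfl fun i _ => ?_
    rw [integral_add (h.integrableOn_energy i ε) (hi i), add_sub_cancel_right]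
  rw [e, sub_eq_add_neg, add_comm]
  refine ENNReal.ofReal_add_le.trans (add_le_add
    (ENNReal.ofReal_le_ofReal (neg_le_abs _)) ?_)
  rw [Fin.sum_univ_two, Fin.sum_univ_two]
  refine ENNReal.ofReal_add_le.trans (add_le_add (hle 0) (hle 1))

end Comparison

/-! ### Removing the cut-offs: bulk and initial layer -/

/-- At a fixed time, the graph of a chart is a null set. -/
lemma GraphChart.ae_height_slice_ne (c : GraphChart d) (t : ℝ) :
    ∀ᵐ x : Space d, c.height (t, x) ≠ 0 := by
  -- The profile is frozen at time `t`. The graph of the frozen chart is null in space-time, so some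
  -- time slice of it is null, and all its slices are equal.
  let c' : GraphChart d :=
    { frame := c.frame
      profile := fun z => c.profile (t, z.2)
      lip := c.lip
      lipschitz := by
        refine LipschitzWith.of_dist_le_mul fun z z' => (c.lipschitz.dist_le_mul _ _).trans ?_
        refine mul_le_mul_of_nonneg_left ?_ c.lip.coe_nonneg
        rw [Prod.dist_eq, dist_self, max_eq_right dist_nonneg]
        exact le_max_right _ _ }
  have h := c'.ae_height_ne 0
  rw [Measure.volume_eq_prod] at h
  obtain ⟨s, hs⟩ := (Measure.ae_ae_of_ae_prod h).exists
  exact hs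

namespace IsLipschitzTube

variable {T : ℝ} {U : ℝ → Set (Space d)}

lemma ae_notMem_lateral (h : IsLipschitzTube T U) (t : ℝ) :
    ∀ᵐ x : Space d, (t, x) ∉ lateral T U := by
  obtain ⟨m, c, N, hc, hcov⟩ := h.exists_charts
  filter_upwards [ae_all_iff.2 fun b => (c b).ae_height_slice_ne t] with x hx hxl
  obtain ⟨b, hb⟩ := mem_iUnion.1 (hcov hxl)
  exact hx b (height_eq_zero (hc b) hxl hb)

end IsLipschitzTube

/-- The cut-off distances. -/
def cutoff (n : ℕ) : ℝ := 1 / ((n : ℝ) + 1)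

lemma cutoff_pos (n : ℕ) : 0 < cutoff n := by
  unfold cutoff
  positivity

lemma tendsto_cutoff : Tendsto cutoff atTop (𝓝 0) := tendsto_one_div_add_atTop_nhds_zero_nat

namespace Comparison

variable {T₀ T : ℝ} {Ω : ℝ → Set (Space d)} {U : Fin 2 → ℝ → Set (Space d)} {β : Fin 2 → ℝ}
  {D : ProblemData d} {u v : Fin 2 → ℝ × Space d → ℝ} {K : ℝ≥0}

/-- A point of the phase with `0 < p.1 < T` has positive distance to both end times and to the
exterior, so all factors are eventually `1`. -/
lemma tendsto_energyWeight (h : Comparison T₀ T Ω U β D u v K) (hd : 1 ≤ d) {i : Fin 2}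
    {p : ℝ × Space d} (hp : p ∈ innerTube T (U i)) :
    Tendsto (fun n => energyWeight T₀ T Ω (cutoff n) p) atTop (𝓝 1) := by
  have hT₀ : 0 ≤ T₀ := h.pos.le.trans h.le
  have ht : p.1 ∈ Icc 0 T := ⟨hp.1.1.le, hp.1.2.le⟩
  have hdep : 0 < depth T₀ Ω p :=
    (h.partition.domain.isClosed_exterior.notMem_iff_infDist_pos
      (h.partition.domain.exterior_nonempty hd hT₀)).1
      fun h' => h'.2 (h.partition.subset i p.1 (h.mem_Icc ht) hp.2)
  refine tendsto_const_nhds.congr' ?_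
  have h1 := hp.1.1
  have h2 := hp.1.2
  filter_upwards [tendsto_cutoff.eventually (gt_mem_nhds (show 0 < T - p.1 by linarith)),
    tendsto_cutoff.eventually (gt_mem_nhds (show 0 < p.1 / 2 by linarith)),
    tendsto_cutoff.eventually (gt_mem_nhds (half_pos hdep))] with n e1 e2 e3
  have hε := cutoff_pos n
  rw [energyWeight, indicator_of_mem (show p.1 ∈ Iio (T - cutoff n) by
    rw [mem_Iio]
    linarith), ramp_of_ge ((le_div_iff₀ hε).2 (by linarith)),
    ramp_of_ge ((le_div_iff₀ hε).2 (by linarith))]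
  simp

lemma integrableOn_sq (h : Comparison T₀ T Ω U β D u v K) (i : Fin 2) :
    IntegrableOn (fun p => err u v i p ^ 2) (innerTube T (U i)) :=
  (h.phase i).integrableOn (C := (2 * K) ^ 2)
    ((h.aemeasurable_err i).pow_const 2).aestronglyMeasurable
    (ae_of_all _ fun p hp => by
      rw [abs_pow]
      gcongr
      exact h.abs_err_le (innerTube_subset_closedTube _ hp))

lemma tendsto_energy (h : Comparison T₀ T Ω U β D u v K) (hd : 1 ≤ d) (i : Fin 2) :
    Tendsto (fun n => ∫ p in innerTube T (U i),
      err u v i p ^ 2 * energyWeight T₀ T Ω (cutoff n) p) atTop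
      (𝓝 (∫ p in innerTube T (U i), err u v i p ^ 2)) := by
  refine tendsto_integral_of_dominated_convergence _
    (fun n => (h.integrableOn_energy i (cutoff n)).aestronglyMeasurable) (h.integrableOn_sq i)
    (fun n => ?_) ?_
  · refine ae_of_all _ fun p => ?_
    rw [Real.norm_eq_abs, abs_of_nonneg (mul_nonneg (sq_nonneg _) (energyWeight_nonneg _ _ _ _ _))]
    exact mul_le_of_le_one_right (sq_nonneg _) (energyWeight_le_one _ _ _ _ _)
  · filter_upwards [ae_restrict_mem (h.isOpen_innerTube i).measurableSet] with p hp
    simpa using (h.tendsto_energyWeight hd hp).const_mul (err u v i p ^ 2)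

lemma continuousOn_err_slice (h : Comparison T₀ T Ω U β D u v K) (i : Fin 2) {t : ℝ}
    (ht : t ∈ Icc 0 T) : ContinuousOn (fun x => err u v i (t, x)) (U i t) :=
  (h.contDiffOn_err i).continuousOn.comp (Continuous.prodMk_right t).continuousOn
    fun _ hx => ⟨ht, subset_closure hx⟩

lemma measurableSet_slice (h : Comparison T₀ T Ω U β D u v K) (i : Fin 2) {t : ℝ}
    (ht : t ∈ Icc 0 T) : MeasurableSet (U i t) :=
  ((h.partition.subdomain i).isOpen_slice (h.mem_Icc ht)).measurableSet

/-- The spatial energy is continuous at the initial time. -/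
lemma tendsto_sliceEnergy (h : Comparison T₀ T Ω U β D u v K) (i : Fin 2) :
    Tendsto (fun t => ∫⁻ x in U i t, ENNReal.ofReal (err u v i (t, x) ^ 2)) (𝓝[>] 0)
      (𝓝 (∫⁻ x in U i 0, ENNReal.ofReal (err u v i (0, x) ^ 2))) := by
  have hL := h.partition.subdomain i
  have h0 : (0 : ℝ) ∈ Icc 0 T := ⟨le_rfl, h.pos.le⟩
  obtain ⟨R, hR⟩ := hL.isBounded.exists_norm_le
  set F : ℝ → Space d → ℝ≥0∞ := fun t =>
    (U i t).indicator fun x => ENNReal.ofReal (err u v i (t, x) ^ 2) with hF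
  have hIoo : ∀ᶠ t in 𝓝[>] (0 : ℝ), t ∈ Ioo 0 T := Ioo_mem_nhdsGT h.pos
  have hFe : ∀ t ∈ Icc 0 T, ∫⁻ x in U i t, ENNReal.ofReal (err u v i (t, x) ^ 2) = ∫⁻ x, F t x :=
    fun t ht => (lintegral_indicator (h.measurableSet_slice i ht) _).symm
  rw [hFe 0 h0]
  refine Tendsto.congr' (f₁ := fun t => ∫⁻ x, F t x)
    (hIoo.mono fun t ht => (hFe t ⟨ht.1.le, ht.2.le⟩).symm) ?_
  refine tendsto_lintegral_filter_of_dominated_convergence'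
    ((Metric.closedBall (0 : Space d) R).indicator fun _ => ENNReal.ofReal ((2 * K) ^ 2)) ?_ ?_ ?_ ?_
  · filter_upwards [hIoo] with t ht
    have ht' : t ∈ Icc 0 T := ⟨ht.1.le, ht.2.le⟩
    exact (aemeasurable_indicator_iff (h.measurableSet_slice i ht')).2
      ((((h.continuousOn_err_slice i ht').aemeasurable (h.measurableSet_slice i ht')).pow_const
        2).ennreal_ofReal)
  · filter_upwards [hIoo] with t ht
    have ht' : t ∈ Icc 0 T := ⟨ht.1.le, ht.2.le⟩
    refine ae_of_all _ fun x => ?_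
    by_cases hx : x ∈ U i t
    · have hxR : x ∈ Metric.closedBall (0 : Space d) R := by
        rw [mem_closedBall_zero_iff]
        exact (le_max_right _ _).trans (hR (t, x) ⟨h.mem_Icc ht', hx⟩)
      rw [hF, indicator_of_mem hxR]
      dsimp only
      rw [indicator_of_mem hx]
      refine ENNReal.ofReal_le_ofReal ?_
      rw [← sq_abs]
      gcongr
      exact h.abs_err_le ⟨ht', subset_closure hx⟩
    · rw [hF]
      dsimp only
      rw [indicator_of_notMem hx]
      exact zero_le
  · rw [lintegral_indicator_const Metric.isClosed_closedBall.measurableSet]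
    exact ENNReal.mul_ne_top ENNReal.ofReal_ne_top measure_closedBall_lt_top.ne
  -- Off the lateral boundary, which has null slices, `x` lies in the tube at time `0` or outside
  -- its closure. In either case membership in `U i t` is settled for all small positive times.
  · filter_upwards [hL.ae_notMem_lateral 0] with x hx
    have hslice : Tendsto (fun t : ℝ => (t, x)) (𝓝[>] 0) (𝓝 (0, x)) :=
      ((Continuous.prodMk_left x).tendsto 0).mono_left nhdsWithin_le_nhds
    by_cases hxU : x ∈ U i 0
    · have h1 : ∀ᶠ t in 𝓝[>] (0 : ℝ), x ∈ U i t := by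
        filter_upwards [hslice.eventually (hL.isOpen (0, x) ⟨h.mem_Icc h0, hxU⟩), hIoo] with t ht ht'
        exact (ht (h.mem_Icc ⟨ht'.1.le, ht'.2.le⟩)).2
      have h2 : Tendsto (fun t => err u v i (t, x)) (𝓝[>] 0) (𝓝 (err u v i (0, x))) := by
        have hc := (h.contDiffOn_err i).continuousOn (0, x) ⟨h0, subset_closure hxU⟩
        refine Tendsto.comp hc (tendsto_nhdsWithin_iff.2 ⟨hslice, ?_⟩)
        filter_upwards [h1, hIoo] with t ht ht'
        exact ⟨⟨ht'.1.le, ht'.2.le⟩, subset_closure ht⟩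
      rw [hF]
      dsimp only
      rw [indicator_of_mem hxU]
      refine Tendsto.congr' (h1.mono fun t ht => (indicator_of_mem ht _).symm) ?_
      exact (ENNReal.continuous_ofReal.tendsto _).comp (h2.pow 2)
    · have h1 : (0, x) ∉ closure (tube T₀ (U i)) := fun h' => hx ⟨h', fun h'' => hxU h''.2⟩
      have h2 : ∀ᶠ t in 𝓝[>] (0 : ℝ), x ∉ U i t := by
        filter_upwards [hslice.eventually (isClosed_closure.isOpen_compl.mem_nhds h1), hIoo]
          with t ht ht' hxt
        exact ht (subset_closure ⟨h.mem_Icc ⟨ht'.1.le, ht'.2.le⟩, hxt⟩)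
      rw [hF]
      dsimp only
      rw [indicator_of_notMem hxU]
      exact tendsto_const_nhds.congr' (h2.mono fun t ht => (indicator_of_notMem ht _).symm)

/-- The initial layer contributes the initial energy. -/
lemma eventually_timeLayer_le (h : Comparison T₀ T Ω U β D u v K) (i : Fin 2) {δ : ℝ≥0∞}
    (hδ : ∫⁻ x in U i 0, ENNReal.ofReal (err u v i (0, x) ^ 2) < δ) :
    ∀ᶠ n in atTop, ∫⁻ p in innerTube T (U i), timeLayer T (cutoff n) (err u v i) p ≤
      ENNReal.ofReal T * δ := by
  have h1 := (h.tendsto_sliceEnergy i).eventually (gt_mem_nhds hδ)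
  obtain ⟨r, hr, hr'⟩ := mem_nhdsGT_iff_exists_Ioo_subset.1 h1
  filter_upwards [tendsto_cutoff.eventually (gt_mem_nhds (half_pos (show (0 : ℝ) < r from hr)))]
    with n hn
  have hε := cutoff_pos n
  set ε := cutoff n
  rw [← lintegral_indicator (h.isOpen_innerTube i).measurableSet, Measure.volume_eq_prod]
  refine (lintegral_prod_le_lintegral_lintegral _).trans ?_
  -- The layer lasts for a time `ε` and carries the weight `T / ε`, so an energy bound `δ` on its
  -- slices integrates to `T * δ`.
  have hpt : ∀ t : ℝ, ∫⁻ x, (innerTube T (U i)).indicator (timeLayer T ε (err u v i)) (t, x) ≤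
      (Ioo ε (2 * ε)).indicator (fun _ => ENNReal.ofReal (T / ε) * δ) t := by
    intro t
    by_cases ht : t ∈ Ioo ε (2 * ε) ∩ Ioo 0 T
    · rw [indicator_of_mem ht.1]
      have ht' : t ∈ Icc 0 T := ⟨ht.2.1.le, ht.2.2.le⟩
      calc _ ≤ ∫⁻ x, (U i t).indicator (fun x => ENNReal.ofReal (T / ε) *
            ENNReal.ofReal (err u v i (t, x) ^ 2)) x := by
            refine lintegral_mono fun x => ?_
            by_cases hx : x ∈ U i t
            · rw [indicator_of_mem (show (t, x) ∈ innerTube T (U i) from ⟨ht.2, hx⟩),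
                indicator_of_mem hx, timeLayer,
                indicator_of_mem (show (t, x) ∈ {p : ℝ × Space d | p.1 ∈ Ioo ε (2 * ε)} from ht.1),
                ENNReal.ofReal_mul (div_nonneg h.pos.le hε.le)]
            · rw [indicator_of_notMem fun h' => hx h'.2]
              exact zero_le
        _ = ENNReal.ofReal (T / ε) * ∫⁻ x in U i t, ENNReal.ofReal (err u v i (t, x) ^ 2) := by
            rw [lintegral_indicator (h.measurableSet_slice i ht'),
              lintegral_const_mul' _ _ ENNReal.ofReal_ne_top]
        _ ≤ _ := by
            gcongr
            exact (hr' ⟨ht.2.1, ht.1.2.trans (by linarith)⟩ : _ < δ).le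
    · refine (lintegral_eq_zero_of_ae_eq_zero (ae_of_all _ fun x => ?_)).le.trans zero_le
      by_cases hx : (t, x) ∈ innerTube T (U i)
      · rw [indicator_of_mem hx, timeLayer]
        exact indicator_of_notMem (show (t, x) ∉ {p : ℝ × Space d | p.1 ∈ Ioo ε (2 * ε)} from
        fun h' => ht ⟨h', hx.1⟩) _
      · exact indicator_of_notMem hx _
  refine (lintegral_mono hpt).trans ?_
  rw [lintegral_indicator_const measurableSet_Ioo, Real.volume_Ioo, mul_right_comm,
    ← ENNReal.ofReal_mul (div_nonneg h.pos.le hε.le)]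
  refine le_of_eq ?_
  congr 2
  field_simp
  ring

end Comparison

/-! ### Removing the cut-offs: the strip along the outer boundary -/

/-- Along a convergent sequence, a continuous function cut off by sets is asymptotically at most
its value at the limit, which has to be a limit point of these sets. -/
lemma limsup_indicator_le {X : Type*} [TopologicalSpace X] {f : X → ℝ≥0∞} {Q C : Set X}
    {S : ℕ → Set X} {p : ℕ → X} {x : X} (hp : Tendsto p atTop (𝓝 x)) (hS : ∀ n, S n ⊆ Q)
    (hC : (∃ᶠ n in atTop, p n ∈ S n) → x ∈ C) (hf : x ∈ C → ContinuousWithinAt f Q x) :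
    limsup (fun n => (S n).indicator f (p n)) atTop ≤ C.indicator f x := by
  by_cases hx : ∃ᶠ n in atTop, p n ∈ S n
  · rw [indicator_of_mem (hC hx)]
    refine le_of_forall_gt_imp_ge_of_dense fun a ha => ?_
    have h1 : ∀ᶠ y in 𝓝 x, y ∈ Q → f y < a :=
      eventually_nhdsWithin_iff.1 ((hf (hC hx)).eventually (gt_mem_nhds ha))
    refine limsup_le_of_le (by isBoundedDefault) ?_
    filter_upwards [hp.eventually h1] with n hn
    by_cases hn' : p n ∈ S n
    · rw [indicator_of_mem hn']
      exact (hn (hS n hn')).le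
    · rw [indicator_of_notMem hn']
      exact zero_le
  · rw [not_frequently] at hx
    refine (limsup_le_of_le (by isBoundedDefault) ?_ : _ ≤ (0 : ℝ≥0∞)).trans zero_le
    filter_upwards [hx] with n hn
    rw [indicator_of_notMem hn]

lemma limsup_add_le_add (f g : ℕ → ℝ≥0∞) :
    limsup (fun n => f n + g n) atTop ≤ limsup f atTop + limsup g atTop := by
  refine ENNReal.le_of_forall_pos_le_add fun δ hδ hfin => ?_
  obtain ⟨h1, h2⟩ := ENNReal.add_lt_top.1 hfin
  have hδ' : ((δ / 2 : ℝ≥0) : ℝ≥0∞) ≠ 0 := by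
    rw [ENNReal.coe_ne_zero]
    positivity
  have e : limsup f atTop + limsup g atTop + δ =
      (limsup f atTop + (δ / 2 : ℝ≥0)) + (limsup g atTop + (δ / 2 : ℝ≥0)) := by
    rw [add_add_add_comm, ← ENNReal.coe_add, add_halves]
  rw [e]
  refine limsup_le_of_le (by isBoundedDefault) ?_
  filter_upwards [eventually_lt_of_limsup_lt (ENNReal.lt_add_right h1.ne hδ'),
    eventually_lt_of_limsup_lt (ENNReal.lt_add_right h2.ne hδ')] with n hn hn'
  exact (ENNReal.add_lt_add hn hn').le

lemma limsup_sum_le {ι : Type*} (s : Finset ι) (f : ι → ℕ → ℝ≥0∞) :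
    limsup (fun n => ∑ j ∈ s, f j n) atTop ≤ ∑ j ∈ s, limsup (f j) atTop := by
  classical
  induction s using Finset.induction_on with
  | empty => simp
  | insert x s hx ih =>
    simp only [Finset.sum_insert hx]
    exact (limsup_add_le_add _ _).trans (add_le_add le_rfl ih)

/-- The part of a tube that is close to the outer boundary and above the graph of a chart. -/
def stripSet (T₀ T : ℝ) (Ω U : ℝ → Set (Space d)) (c : GraphChart d) (ε : ℝ) :
    Set (ℝ × Space d) :=
  innerTube T U ∩ {p | depth T₀ Ω p ≤ 2 * ε ∧ 0 < c.height p ∧ c.height p ≤ 2 * c.heightLip * ε}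

namespace Comparison

variable {T₀ T : ℝ} {Ω : ℝ → Set (Space d)} {U : Fin 2 → ℝ → Set (Space d)} {β : Fin 2 → ℝ}
  {D : ProblemData d} {u v : Fin 2 → ℝ × Space d → ℝ} {K : ℝ≥0} {B : ℝ}

lemma measurableSet_stripSet (h : Comparison T₀ T Ω U β D u v K) (i : Fin 2) (c : GraphChart d)
    (ε : ℝ) : MeasurableSet (stripSet T₀ T Ω (U i) c ε) := by
  have h1 := c.continuous_height.measurable
  have h2 := (continuous_depth T₀ Ω).measurable
  exact (h.isOpen_innerTube i).measurableSet.inter ((measurableSet_le h2 measurable_const).inter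
    ((measurableSet_lt measurable_const h1).inter (measurableSet_le h1 measurable_const)))

/-- The error is arbitrary off the closed tube, so measurability comes from continuity on the open
tube and extension by zero. It is needed everywhere, not just almost everywhere, for reverse Fatou
in graph coordinates. -/
lemma measurable_stripSet_indicator (h : Comparison T₀ T Ω U β D u v K) (i : Fin 2)
    (c : GraphChart d) (ε : ℝ) (B : ℝ) :
    Measurable ((stripSet T₀ T Ω (U i) c ε).indicator
      fun p => ENNReal.ofReal (B * |err u v i p|)) := by
  have h1 : Measurable ((innerTube T (U i)).indicator
      fun p => ENNReal.ofReal (B * |err u v i p|)) := by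
    classical
    rw [← piecewise_eq_indicator]
    refine ContinuousOn.measurable_piecewise ?_ continuousOn_const
      (h.isOpen_innerTube i).measurableSet
    exact ENNReal.continuous_ofReal.comp_continuousOn
      (((h.phase i).contDiffOn_interior.continuousOn.abs).const_mul B)
  have h2 := h1.indicator (h.measurableSet_stripSet i c ε)
  rw [indicator_indicator] at h2
  rwa [inter_eq_self_of_subset_left] at h2
  exact inter_subset_left

/-- The strip integral, in the coordinates of a chart. -/
lemma lintegral_stripSet_eq (i : Fin 2) (c : GraphChart d)
    {ε : ℝ} (hε : 0 < ε) :
    ∫⁻ p, (stripSet T₀ T Ω (U i) c ε).indicator (fun p => ENNReal.ofReal (B / ε * |err u v i p|)) p =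
      ∫⁻ y, (stripSet T₀ T Ω (U i) c ε).indicator (fun p => ENNReal.ofReal (B * |err u v i p|))
        (c.param ε y) := by
  rw [c.lintegral_param hε.ne', abs_of_pos (inv_pos.2 hε),
    ← lintegral_const_mul' _ _ ENNReal.ofReal_ne_top]
  refine lintegral_congr fun p => ?_
  by_cases hp : p ∈ stripSet T₀ T Ω (U i) c ε
  · rw [indicator_of_mem hp, indicator_of_mem hp, ← ENNReal.ofReal_mul (inv_nonneg.2 hε.le)]
    congr 1
    ring
  · rw [indicator_of_notMem hp, indicator_of_notMem hp, mul_zero]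

/-- Once `2 * cutoff n` is below the radius of `exists_height_le`, every point of the strip has a
small positive height in at least one chart; overlaps only increase the sum. -/
lemma eventually_lintegral_stripLayer_le (h : Comparison T₀ T Ω U β D u v K) (hd : 1 ≤ d)
    (i : Fin 2) {m : ℕ} {c : Fin m → GraphChart d} {N : Fin m → Set (ℝ × Space d)}
    (hc : ∀ b, (c b).Describes T₀ Ω (N b)) (hcov : lateral T₀ Ω ⊆ ⋃ b, N b) :
    ∀ᶠ n in atTop, ∫⁻ p in innerTube T (U i), stripLayer T₀ Ω B (cutoff n) (err u v i) p ≤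
      ∑ b, ∫⁻ y, (stripSet T₀ T Ω (U i) (c b) (cutoff n)).indicator
        (fun p => ENNReal.ofReal (B * |err u v i p|)) ((c b).param (cutoff n) y) := by
  have hT₀ : 0 ≤ T₀ := h.pos.le.trans h.le
  obtain ⟨r, hr, hr'⟩ := h.partition.domain.exists_height_le
    (h.partition.domain.exterior_nonempty hd hT₀) hc hcov
  filter_upwards [tendsto_cutoff.eventually (gt_mem_nhds (half_pos hr))] with n hn
  have hε := cutoff_pos n
  set ε := cutoff n
  rw [Finset.sum_congr rfl fun b _ => (lintegral_stripSet_eq i (c b) hε).symm, ← lintegral_finsetSum _ fun b _ => h.measurable_stripSet_indicator i (c b) ε (B / ε),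
    ← lintegral_indicator (h.isOpen_innerTube i).measurableSet]
  refine lintegral_mono fun p => ?_
  by_cases hp : p ∈ innerTube T (U i)
  · rw [indicator_of_mem hp]
    by_cases hpd : depth T₀ Ω p ≤ 2 * ε
    · have ht : p.1 ∈ Icc 0 T₀ := h.mem_Icc ⟨hp.1.1.le, hp.1.2.le⟩
      obtain ⟨b, hb0, hb⟩ := hr' p ⟨ht, h.partition.subset i p.1 ht hp.2⟩ (by linarith)
      have hpS : p ∈ stripSet T₀ T Ω (U i) (c b) ε := by
        refine ⟨hp, hpd, hb0, hb.trans ?_⟩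
        have := mul_le_mul_of_nonneg_left hpd (c b).heightLip.coe_nonneg
        linarith
      rw [stripLayer, indicator_of_mem (show p ∈ {p | depth T₀ Ω p ≤ 2 * ε} from hpd)]
      refine le_trans (le_of_eq ?_) (Finset.single_le_sum (fun b _ => zero_le) (Finset.mem_univ b))
      rw [indicator_of_mem hpS]
    · rw [stripLayer, indicator_of_notMem (show p ∉ {p | depth T₀ Ω p ≤ 2 * ε} from hpd)]
      exact zero_le
  · rw [indicator_of_notMem hp]
    exact zero_le

/-- If the strips are visited infinitely often, the limit point lies in the closure of `U i` and has
depth zero, hence lies outside `Ω`. So it is in the frontier but not on the interface, which is part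
of `Ω`. -/
lemma limsup_strip_pointwise_le (h : Comparison T₀ T Ω U β D u v K) (hd : 1 ≤ d) (i : Fin 2)
    (c : GraphChart d) (y : (ℝ × Base d) × ℝ) :
    limsup (fun n => (stripSet T₀ T Ω (U i) c (cutoff n)).indicator
        (fun p => ENNReal.ofReal (B * |err u v i p|)) (c.param (cutoff n) y)) atTop ≤
      {y : (ℝ × Base d) × ℝ | y.2 ∈ Ioc 0 (2 * (c.heightLip : ℝ))}.indicator (fun y =>
        (tube T (outerBoundary Ω U i)).indicator (fun p => ENNReal.ofReal (B * |err u v i p|))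
          (y.1.1, c.graphPoint y.1.1 y.1.2)) y := by
  by_cases hy : y.2 ∈ Ioc 0 (2 * (c.heightLip : ℝ))
  · rw [indicator_of_mem (show y ∈ {y : (ℝ × Base d) × ℝ | y.2 ∈ Ioc 0 (2 * (c.heightLip : ℝ))} from hy),
      ← c.param_zero]
    have hlim : Tendsto (fun n => c.param (cutoff n) y) atTop (𝓝 (c.param 0 y)) :=
      (c.continuous_param_uncurry.comp (Continuous.prodMk_left y)).continuousAt.tendsto.comp
        tendsto_cutoff
    refine limsup_indicator_le (Q := closedTube T (U i)) hlim
      (fun n p hp => innerTube_subset_closedTube _ hp.1) (fun hfr => ?_) fun hC => ?_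
    · have ht : y.1.1 ∈ Ioo 0 T := by
        obtain ⟨n, hn⟩ := hfr.exists
        exact hn.1.1
      have ht' : y.1.1 ∈ Icc 0 T := ⟨ht.1.le, ht.2.le⟩
      have hdep : depth T₀ Ω (c.param 0 y) ≤ 0 := by
        have h1 : Tendsto (fun n => depth T₀ Ω (c.param (cutoff n) y) - 2 * cutoff n) atTop
            (𝓝 (depth T₀ Ω (c.param 0 y) - 2 * 0)) :=
          (((continuous_depth T₀ Ω).tendsto _).comp hlim).sub (tendsto_cutoff.const_mul 2)
        have h2 := le_of_tendsto_of_frequently h1 (hfr.mono fun n hn => sub_nonpos.2 hn.2.1)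
        linarith
      have hext : c.param 0 y ∈ exterior T₀ Ω := by
        by_contra h'
        have := (h.partition.domain.isClosed_exterior.notMem_iff_infDist_pos
          (h.partition.domain.exterior_nonempty hd (h.pos.le.trans h.le))).1 h'
        exact absurd hdep (not_le.2 this)
      have hcl : (c.param 0 y).2 ∈ closure (U i y.1.1) :=
        mem_closure_of_frequently_of_tendsto (hfr.mono fun n hn => hn.1.2)
          ((continuous_snd.tendsto _).comp hlim)
      refine ⟨ht', ⟨hcl, fun hint => ?_⟩, fun hΓ => hext.2 hΓ.1⟩
      exact hext.2 (h.partition.subset i _ (h.mem_Icc ht') (interior_subset hint))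
    · have := (h.contDiffOn_err i).continuousOn (c.param 0 y) ⟨hC.1, frontier_subset_closure hC.2.1⟩
      exact (ENNReal.continuous_ofReal.tendsto _).comp (this.abs.const_mul B)
  · refine (limsup_le_of_le (by isBoundedDefault) ?_ : _ ≤ (0 : ℝ≥0∞)).trans zero_le
    refine Eventually.of_forall fun n => le_of_eq (indicator_of_notMem (fun hn => hy ?_) _)
    have h1 := hn.2.2
    rw [c.height_param] at h1
    have hε := cutoff_pos n
    exact ⟨pos_of_mul_pos_right h1.1 hε.le, by nlinarith [h1.2]⟩

/-- The boundary layer contributes an integral of the error over the outer boundary. -/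
lemma limsup_lintegral_stripLayer_le (h : Comparison T₀ T Ω U β D u v K) (hd : 1 ≤ d)
    (i : Fin 2) {m : ℕ} {c : Fin m → GraphChart d} {N : Fin m → Set (ℝ × Space d)}
    (hc : ∀ b, (c b).Describes T₀ Ω (N b)) (hcov : lateral T₀ Ω ⊆ ⋃ b, N b) (hB : 0 ≤ B) :
    limsup (fun n => ∫⁻ p in innerTube T (U i), stripLayer T₀ Ω B (cutoff n) (err u v i) p) atTop ≤
      (∑ b, ENNReal.ofReal (2 * (c b).heightLip)) *
        ∫⁻ t in Icc 0 T, ∫⁻ x in outerBoundary Ω U i t,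
          ENNReal.ofReal (B * |err u v i (t, x)|) ∂surface d := by
  refine (limsup_le_limsup (h.eventually_lintegral_stripLayer_le hd i hc hcov)).trans
    ((limsup_sum_le _ _).trans ?_)
  rw [Finset.sum_mul]
  refine Finset.sum_le_sum fun b _ => ?_
  obtain ⟨E, hE, hEv, hEm⟩ := exists_isBounded_param (c b) h.partition.domain.isCompact_closure
    (2 * (c b).heightLip)
  -- Reverse Fatou: in the coordinates scaled by the cut-off distance all strips lie in one set `E`
  -- of finite measure, on which the integrand is bounded by a constant.
  refine (limsup_lintegral_le (E.indicator fun _ => ENNReal.ofReal (B * (2 * K)))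
    (fun n => (h.measurable_stripSet_indicator i (c b) _ B).comp
      ((c b).continuous_param _).measurable) (fun n => ae_of_all _ fun y => ?_) ?_).trans ?_
  · rw [Function.comp_apply]
    by_cases hy : (c b).param (cutoff n) y ∈ stripSet T₀ T Ω (U i) (c b) (cutoff n)
    · rw [indicator_of_mem hy]
      have ht : ((c b).param (cutoff n) y).1 ∈ Icc 0 T := ⟨hy.1.1.1.le, hy.1.1.2.le⟩
      have hyE : y ∈ E := by
        refine hEm (cutoff n) y (subset_closure
          ⟨h.mem_Icc ht, h.partition.subset i _ (h.mem_Icc ht) hy.1.2⟩) ?_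
        have h1 := hy.2.2
        rw [(c b).height_param] at h1
        have hε := cutoff_pos n
        rw [abs_of_pos (pos_of_mul_pos_right h1.1 hε.le)]
        nlinarith [h1.2]
      rw [indicator_of_mem hyE]
      refine ENNReal.ofReal_le_ofReal (mul_le_mul_of_nonneg_left ?_ hB)
      exact h.abs_err_le (innerTube_subset_closedTube _ hy.1)
    · rw [indicator_of_notMem hy]
      exact zero_le
  · rw [lintegral_indicator_const hE]
    exact ENNReal.mul_ne_top ENNReal.ofReal_ne_top hEv
  · refine (lintegral_mono fun y => h.limsup_strip_pointwise_le hd i (c b) y).trans ?_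
    refine (lintegral_indicator_le _ _).trans ?_
    refine (GraphChart.lintegral_layer_le (Ioc 0 (2 * ((c b).heightLip : ℝ))) measurableSet_Ioc
      measure_Ioc_lt_top.ne fun z => (tube T (outerBoundary Ω U i)).indicator
        (fun p => ENNReal.ofReal (B * |err u v i p|)) (z.1, (c b).graphPoint z.1 z.2)).trans ?_
    rw [Real.volume_Ioc, sub_zero]
    gcongr
    exact (c b).lintegral_graph_le
      (fun t ht => h.partition.measurableSet_outerBoundary i (h.mem_Icc ht)) _

end Comparison

/-! ### The energy estimate and iterated integrals -/

/-- A space-time integral of a linear expression in terms of a weight `l`. -/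
lemma lintegral_add_div_le {T : ℝ} {m : Measure (Space d)} {S : ℝ → Set (Space d)} {s : ℝ≥0∞}
    (hs : ∀ t ∈ Icc 0 T, m (S t) ≤ s) (g : ℝ × Space d → ℝ) {l : ℝ} (hl : 0 < l) :
    ∫⁻ t in Icc 0 T, ∫⁻ x in S t, ENNReal.ofReal (l + g (t, x) / l) ∂m ≤
      ENNReal.ofReal l * s * ENNReal.ofReal T + ENNReal.ofReal l⁻¹ * stIntegral T m S g := by
  have h1 : ∀ t ∈ Icc 0 T, ∫⁻ x in S t, ENNReal.ofReal (l + g (t, x) / l) ∂m ≤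
      ENNReal.ofReal l * s + ENNReal.ofReal l⁻¹ * ∫⁻ x in S t, ENNReal.ofReal (g (t, x)) ∂m := by
    intro t ht
    calc ∫⁻ x in S t, ENNReal.ofReal (l + g (t, x) / l) ∂m
        ≤ ∫⁻ x in S t, (ENNReal.ofReal l + ENNReal.ofReal l⁻¹ * ENNReal.ofReal (g (t, x))) ∂m := by
          refine lintegral_mono fun x => ENNReal.ofReal_add_le.trans (add_le_add le_rfl (le_of_eq ?_))
          rw [← ENNReal.ofReal_mul (inv_nonneg.2 hl.le), div_eq_inv_mul]
      _ = ENNReal.ofReal l * m (S t) +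
            ENNReal.ofReal l⁻¹ * ∫⁻ x in S t, ENNReal.ofReal (g (t, x)) ∂m := by
          rw [lintegral_add_left measurable_const, setLIntegral_const,
            lintegral_const_mul' _ _ ENNReal.ofReal_ne_top]
      _ ≤ _ := by
          gcongr
          exact hs t ht
  refine (setLIntegral_mono' measurableSet_Icc h1).trans (le_of_eq ?_)
  rw [lintegral_add_left measurable_const, setLIntegral_const, Real.volume_Icc, sub_zero,
    lintegral_const_mul' _ _ ENNReal.ofReal_ne_top]
  rfl

/-- The end times are null, so a bound at the inner times suffices; at those times the regularity of
the closed tubes at the interface is at hand. -/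
lemma stIntegral_le {T : ℝ} {m : Measure (Space d)} {S : ℝ → Set (Space d)} {s : ℝ≥0∞}
    (hs : ∀ t ∈ Icc 0 T, m (S t) ≤ s) {g : ℝ × Space d → ℝ} {C : ℝ}
    (hg : ∀ t ∈ Ioo 0 T, ∀ᵐ x ∂m.restrict (S t), g (t, x) ≤ C) :
    stIntegral T m S g ≤ ENNReal.ofReal C * s * ENNReal.ofReal T := by
  have h1 : ∀ t ∈ Ioo 0 T, ∫⁻ x in S t, ENNReal.ofReal (g (t, x)) ∂m ≤ ENNReal.ofReal C * s := by
    intro t ht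
    calc ∫⁻ x in S t, ENNReal.ofReal (g (t, x)) ∂m ≤ ∫⁻ x in S t, ENNReal.ofReal C ∂m :=
          lintegral_mono_ae ((hg t ht).mono fun x hx => ENNReal.ofReal_le_ofReal hx)
      _ = ENNReal.ofReal C * m (S t) := setLIntegral_const _ _
      _ ≤ _ := by
          gcongr
          exact hs t ⟨ht.1.le, ht.2.le⟩
  unfold stIntegral
  rw [← Measure.restrict_congr_set Ioo_ae_eq_Icc]
  refine (setLIntegral_mono' measurableSet_Ioo h1).trans (le_of_eq ?_)
  rw [setLIntegral_const, Real.volume_Ioo, sub_zero]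

namespace Comparison

variable {T₀ T : ℝ} {Ω : ℝ → Set (Space d)} {U : Fin 2 → ℝ → Set (Space d)} {β : Fin 2 → ℝ}
  {D : ProblemData d} {u v : Fin 2 → ℝ × Space d → ℝ} {K : ℝ≥0} {l : ℝ}

lemma limsup_timeLayer_le (h : Comparison T₀ T Ω U β D u v K) (i : Fin 2) :
    limsup (fun n => ∫⁻ p in innerTube T (U i), timeLayer T (cutoff n) (err u v i) p) atTop ≤
      ENNReal.ofReal T * ∫⁻ x in U i 0, ENNReal.ofReal (err u v i (0, x) ^ 2) := by
  have hT0 : ENNReal.ofReal T ≠ 0 := by simpa using h.pos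
  rw [← ENNReal.div_le_iff' hT0 ENNReal.ofReal_ne_top]
  refine le_of_forall_gt_imp_ge_of_dense fun δ hδ => ?_
  rw [ENNReal.div_le_iff' hT0 ENNReal.ofReal_ne_top]
  exact limsup_le_of_le (by isBoundedDefault) (h.eventually_timeLayer_le i hδ)

/-- The energy estimate, before the choice of the weight `l`. -/
lemma energy_estimate (h : Comparison T₀ T Ω U β D u v K) (hd : 1 ≤ d)
    {m : ℕ} {c : Fin m → GraphChart d} {N : Fin m → Set (ℝ × Space d)}
    (hc : ∀ b, (c b).Describes T₀ (U 0) (N b)) (hcov : lateral T₀ (U 0) ⊆ ⋃ b, N b)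
    {m' : ℕ} {c' : Fin m' → GraphChart d} {N' : Fin m' → Set (ℝ × Space d)}
    (hc' : ∀ b, (c' b).Describes T₀ Ω (N' b)) (hcov' : lateral T₀ Ω ⊆ ⋃ b, N' b) (hl : 0 < l) :
    ENNReal.ofReal (∑ i, ∫ p in innerTube T (U i), err u v i p ^ 2) ≤
      (∑ b, ENNReal.ofReal (T * (4 * K * (c b).heightLip * (2 + β 0)))) *
        interfaceBound T Ω U β D v l +
      ∑ i, ((∫⁻ p in innerTube T (U i),
          ENNReal.ofReal (4 * K * T * |interiorResidual T U β D v i p|)) +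
        ENNReal.ofReal T * (∫⁻ x in U i 0, ENNReal.ofReal (err u v i (0, x) ^ 2)) +
        (∑ b, ENNReal.ofReal (2 * (c' b).heightLip)) *
          ∫⁻ t in Icc 0 T, ∫⁻ x in outerBoundary Ω U i t,
            ENNReal.ofReal (T * ((1 + 2 * β i) * (2 * K)) * |err u v i (t, x)|) ∂surface d) := by
  have hlim : Tendsto (fun n => ENNReal.ofReal (∑ i, ∫ p in innerTube T (U i),
      err u v i p ^ 2 * energyWeight T₀ T Ω (cutoff n) p)) atTop
      (𝓝 (ENNReal.ofReal (∑ i, ∫ p in innerTube T (U i), err u v i p ^ 2))) :=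
    (ENNReal.continuous_ofReal.tendsto _).comp (tendsto_finsetSum _ fun i _ => h.tendsto_energy hd i)
  rw [← hlim.limsup_eq]
  set A : ℝ≥0∞ := (∑ b, ENNReal.ofReal (T * (4 * K * (c b).heightLip * (2 + β 0)))) *
    interfaceBound T Ω U β D v l
  have hle : ∀ n, ENNReal.ofReal (∑ i, ∫ p in innerTube T (U i),
      err u v i p ^ 2 * energyWeight T₀ T Ω (cutoff n) p) ≤ A +
      ∑ i, ((∫⁻ p in innerTube T (U i),
          ENNReal.ofReal (4 * K * T * |interiorResidual T U β D v i p|)) +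
        (∫⁻ p in innerTube T (U i), timeLayer T (cutoff n) (err u v i) p) +
        ∫⁻ p in innerTube T (U i),
          stripLayer T₀ Ω (T * ((1 + 2 * β i) * (2 * K))) (cutoff n) (err u v i) p) := by
    intro n
    have hε := cutoff_pos n
    refine (h.ofReal_sum_energy_le hε).trans (add_le_add ?_ le_rfl)
    obtain ⟨L, hL⟩ := exists_lipschitzWith_testFun (T₀ := T₀) (Ω := Ω) h.pos.le hε
    exact h.ofReal_abs_totalWeak_le hc hcov hL (hasCompactSupport_testFun h.partition.domain h.le hε)
      (tsupport_testFun_subset_innerTube h.le hε)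
      (fun p => (abs_of_nonneg (testFun_nonneg p)).trans_le (testFun_le h.pos.le p)) hl
  refine (limsup_le_limsup (Eventually.of_forall hle)).trans ((limsup_add_le_add _ _).trans
    (add_le_add (limsup_const A).le ((limsup_sum_le _ _).trans (Finset.sum_le_sum fun i _ => ?_))))
  refine (limsup_add_le_add _ _).trans (add_le_add ((limsup_add_le_add _ _).trans
    (add_le_add (limsup_const _).le (h.limsup_timeLayer_le i))) ?_)
  have hβ := (h.coeff_pos i).le
  have hT := h.pos.le
  exact h.limsup_lintegral_stripLayer_le hd i hc' hcov' (by positivity)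

lemma lintegral_innerTube_le (h : Comparison T₀ T Ω U β D u v K) (i : Fin 2)
    (F : ℝ × Space d → ℝ≥0∞) :
    ∫⁻ p in innerTube T (U i), F p ≤ ∫⁻ t in Icc 0 T, ∫⁻ x in U i t, F (t, x) := by
  rw [← lintegral_indicator (h.isOpen_innerTube i).measurableSet, Measure.volume_eq_prod]
  refine (lintegral_prod_le_lintegral_lintegral _).trans ?_
  rw [← lintegral_indicator measurableSet_Icc]
  refine lintegral_mono fun t => ?_
  by_cases ht : t ∈ Icc 0 T
  · rw [indicator_of_mem ht, ← lintegral_indicator (h.measurableSet_slice i ht)]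
    refine lintegral_mono fun x => ?_
    by_cases hx : (t, x) ∈ innerTube T (U i)
    · rw [indicator_of_mem hx, indicator_of_mem hx.2]
    · rw [indicator_of_notMem hx]
      exact zero_le
  · refine (lintegral_eq_zero_of_ae_eq_zero (ae_of_all _ fun x => ?_)).le.trans zero_le
    exact indicator_of_notMem (fun h' => ht ⟨h'.1.1.le, h'.1.2.le⟩) _

/-- This direction of Tonelli's theorem does need measurability, which holds since the error is
continuous on the open tube. -/
lemma stIntegral_sq_le (h : Comparison T₀ T Ω U β D u v K) (i : Fin 2) :
    stIntegral T volume (U i) (fun p => err u v i p ^ 2) ≤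
      ENNReal.ofReal (∫ p in innerTube T (U i), err u v i p ^ 2) := by
  have hm : MeasurableSet (innerTube T (U i)) := (h.isOpen_innerTube i).measurableSet
  have ha : AEMeasurable ((innerTube T (U i)).indicator fun p =>
      ENNReal.ofReal (err u v i p ^ 2)) volume :=
    (aemeasurable_indicator_iff hm).2 ((h.aemeasurable_err i).pow_const 2).ennreal_ofReal
  rw [ofReal_integral_eq_lintegral_ofReal (h.integrableOn_sq i) (ae_of_all _ fun p => sq_nonneg _),
    ← lintegral_indicator hm, Measure.volume_eq_prod, lintegral_prod _ (by
      rwa [Measure.volume_eq_prod] at ha)]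
  unfold stIntegral
  rw [← Measure.restrict_congr_set Ioo_ae_eq_Icc, ← lintegral_indicator measurableSet_Ioo]
  refine lintegral_mono fun t => ?_
  by_cases ht : t ∈ Ioo 0 T
  · rw [indicator_of_mem ht, ← lintegral_indicator (h.measurableSet_slice i ⟨ht.1.le, ht.2.le⟩)]
    refine lintegral_mono fun x => ?_
    by_cases hx : x ∈ U i t
    · rw [indicator_of_mem hx, indicator_of_mem (show (t, x) ∈ innerTube T (U i) from ⟨ht, hx⟩)]
    · rw [indicator_of_notMem hx]
      exact zero_le
  · rw [indicator_of_notMem ht]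
    exact zero_le

end Comparison

/-! ### From linear terms to residual integrals -/

/-- The measures of the slices of the subdomains and of their boundaries are at most `s`. -/
structure SliceBound (T₀ : ℝ) (U : Fin 2 → ℝ → Set (Space d)) (s : ℝ≥0) : Prop where
  volume_le : ∀ i, ∀ t ∈ Icc 0 T₀, volume (U i t) ≤ s
  surface_le : ∀ i, ∀ t ∈ Icc 0 T₀, surface d (frontier (U i t)) ≤ s

lemma IsMovingPartition.exists_sliceBound {T₀ : ℝ} {Ω : ℝ → Set (Space d)}
    {U : Fin 2 → ℝ → Set (Space d)} (hP : IsMovingPartition T₀ Ω U) :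
    ∃ s, SliceBound T₀ U s := by
  have h1 : ∀ i, ∃ s : ℝ≥0, ∀ t ∈ Icc 0 T₀, volume (U i t) ≤ s := by
    intro i
    obtain ⟨R, hR⟩ := (hP.subdomain i).isBounded.exists_norm_le
    refine ⟨(volume (Metric.closedBall (0 : Space d) R)).toNNReal, fun t ht => ?_⟩
    rw [ENNReal.coe_toNNReal measure_closedBall_lt_top.ne]
    refine measure_mono fun x hx => ?_
    rw [mem_closedBall_zero_iff]
    exact (le_max_right _ _).trans (hR (t, x) ⟨ht, hx⟩)
  choose s hs using h1
  choose S hS using fun i => (hP.subdomain i).exists_surface_frontier_le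
  refine ⟨∑ i, (s i + S i), fun i t ht => (hs i t ht).trans ?_, fun i t ht => (hS i t ht).trans ?_⟩
  · rw [ENNReal.coe_le_coe]
    exact le_self_add.trans (Finset.single_le_sum (f := fun i => s i + S i)
      (fun _ _ => zero_le) (Finset.mem_univ i))
  · rw [ENNReal.coe_le_coe]
    exact le_add_self.trans (Finset.single_le_sum (f := fun i => s i + S i)
      (fun _ _ => zero_le) (Finset.mem_univ i))

lemma ofReal_add_div_eq {l T : ℝ} {s : ℝ≥0} {I : ℝ≥0∞} (hl : 0 < l) (hT : 0 ≤ T) (hI : I ≠ ∞) :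
    ENNReal.ofReal (l * s * T + I.toReal / l) =
      ENNReal.ofReal l * s * ENNReal.ofReal T + ENNReal.ofReal l⁻¹ * I := by
  rw [ENNReal.ofReal_add (by positivity) (by positivity), ENNReal.ofReal_mul (by positivity),
    ENNReal.ofReal_mul hl.le, ENNReal.ofReal_coe_nnreal, div_eq_inv_mul,
    ENNReal.ofReal_mul (inv_nonneg.2 hl.le), ENNReal.ofReal_toReal hI]

namespace Comparison

variable {T₀ T : ℝ} {Ω : ℝ → Set (Space d)} {U : Fin 2 → ℝ → Set (Space d)} {β : Fin 2 → ℝ}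
  {D : ProblemData d} {u v : Fin 2 → ℝ × Space d → ℝ} {K s : ℝ≥0} {l : ℝ}

lemma surface_outerBoundary_le (h : Comparison T₀ T Ω U β D u v K) (hs : SliceBound T₀ U s)
    (i : Fin 2) {t : ℝ} (ht : t ∈ Icc 0 T) : surface d (outerBoundary Ω U i t) ≤ s :=
  (measure_mono sdiff_subset).trans (hs.surface_le i t (h.mem_Icc ht))

lemma surface_interface_le (h : Comparison T₀ T Ω U β D u v K) (hs : SliceBound T₀ U s)
    {t : ℝ} (ht : t ∈ Icc 0 T) : surface d (interface Ω U t) ≤ s :=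
  (measure_mono (h.partition.interface_subset_frontier 0 (h.mem_Icc ht))).trans
    (hs.surface_le 0 t (h.mem_Icc ht))

lemma boundaryResidual_eq (h : Comparison T₀ T Ω U β D u v K) {i : Fin 2} {t : ℝ}
    (ht : t ∈ Icc 0 T) {x : Space d} (hx : x ∈ outerBoundary Ω U i t) :
    boundaryResidual D v i (t, x) = -err u v i (t, x) := by
  have := h.solution.boundary i t ht x hx
  simp only [boundaryResidual, err] at this ⊢
  linarith

lemma initialResidual_eq (h : Comparison T₀ T Ω U β D u v K) {i : Fin 2} {x : Space d}
    (hx : x ∈ U i 0) : initialResidual D v i x = -err u v i (0, x) := by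
  have := h.solution.initial i x hx
  simp only [initialResidual, err] at this ⊢
  linarith

/-- The residual integrals are defined through `ENNReal.toReal`, which sends `∞` to `0`; finiteness
makes them the true integrals. For this and the other residuals it follows from the `C²` bounds and
the bounded slices. -/
lemma interior_ne_top (h : Comparison T₀ T Ω U β D u v K) (hs : SliceBound T₀ U s) (i : Fin 2) :
    stIntegral T volume (U i) (fun p => interiorResidual T U β D v i p ^ 2) ≠ ∞ := by
  have hβ := (h.coeff_pos i).le
  refine ne_top_of_le_ne_top ?_ (stIntegral_le (s := s) (C := (2 * K + β i * (d * (2 * K))) ^ 2)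
    (fun t ht => hs.volume_le i t (h.mem_Icc ht)) fun t ht => ?_)
  · exact ENNReal.mul_ne_top (ENNReal.mul_ne_top ENNReal.ofReal_ne_top ENNReal.coe_ne_top)
      ENNReal.ofReal_ne_top
  · filter_upwards [ae_restrict_mem (h.measurableSet_slice i ⟨ht.1.le, ht.2.le⟩)] with x hx
    have hp : (t, x) ∈ innerTube T (U i) := ⟨ht, hx⟩
    rw [h.interiorResidual_eq hp, neg_sq, ← sq_abs]
    have h1 := (h.phase i).abs_timeDeriv_le hp
    have h2 := (h.phase i).abs_spaceLaplacian_le hp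
    refine pow_le_pow_left₀ (abs_nonneg _) ((abs_sub _ _).trans (add_le_add h1 ?_)) 2
    rw [abs_mul, abs_of_nonneg hβ]
    exact mul_le_mul_of_nonneg_left h2 hβ

lemma boundary_ne_top (h : Comparison T₀ T Ω U β D u v K) (hs : SliceBound T₀ U s) (i : Fin 2) :
    stIntegral T (surface d) (outerBoundary Ω U i) (fun p => boundaryResidual D v i p ^ 2) ≠ ∞ := by
  refine ne_top_of_le_ne_top ?_ (stIntegral_le (s := s) (C := (2 * K) ^ 2)
    (fun t ht => h.surface_outerBoundary_le hs i ht) fun t ht => ?_)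
  · exact ENNReal.mul_ne_top (ENNReal.mul_ne_top ENNReal.ofReal_ne_top ENNReal.coe_ne_top)
      ENNReal.ofReal_ne_top
  · have ht' : t ∈ Icc 0 T := ⟨ht.1.le, ht.2.le⟩
    filter_upwards [ae_restrict_mem (h.partition.measurableSet_outerBoundary i (h.mem_Icc ht'))]
      with x hx
    rw [h.boundaryResidual_eq ht' hx, neg_sq, ← sq_abs]
    exact pow_le_pow_left₀ (abs_nonneg _)
      (h.abs_err_le ⟨ht', frontier_subset_closure hx.1⟩) 2

lemma initial_ne_top (h : Comparison T₀ T Ω U β D u v K) (hs : SliceBound T₀ U s) (i : Fin 2) :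
    ∫⁻ x in U i 0, ENNReal.ofReal (initialResidual D v i x ^ 2) ≠ ∞ := by
  have h0 : (0 : ℝ) ∈ Icc 0 T := ⟨le_rfl, h.pos.le⟩
  have h1 : ∫⁻ x in U i 0, ENNReal.ofReal (initialResidual D v i x ^ 2) ≤
      ∫⁻ x in U i 0, ENNReal.ofReal ((2 * K) ^ 2) := by
    refine setLIntegral_mono' (h.measurableSet_slice i h0) fun x hx => ENNReal.ofReal_le_ofReal ?_
    rw [h.initialResidual_eq hx, neg_sq, ← sq_abs]
    exact pow_le_pow_left₀ (abs_nonneg _) (h.abs_err_le ⟨h0, subset_closure hx⟩) 2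
  refine ne_top_of_le_ne_top ?_ h1
  rw [setLIntegral_const]
  exact ENNReal.mul_ne_top ENNReal.ofReal_ne_top
    (ne_top_of_le_ne_top ENNReal.coe_ne_top (hs.volume_le i 0 (h.mem_Icc h0)))

lemma interfaceSq_le (h : Comparison T₀ T Ω U β D u v K) {t : ℝ} (ht : t ∈ Ioo 0 T) {x n : Space d}
    (hx : x ∈ interface Ω U t) (hn : IsOuterNormal (U 0 t) x n) :
    interfaceSq T U β D v (t, x) ≤ (4 * K) ^ 2 + ((β 0 + β 1) * (2 * K)) ^ 2 := by
  have ht' : t ∈ Icc 0 T := ⟨ht.1.le, ht.2.le⟩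
  have hq : (t, x) ∈ innerTube T Ω := ⟨ht, hx.1⟩
  have hQ : ∀ i, (t, x) ∈ closedTube T (U i) := fun i =>
    ⟨ht', h.partition.interface_subset i t (h.mem_Icc ht') hx⟩
  obtain ⟨m, c, N, hc, hcov⟩ := (h.partition.subdomain 0).exists_charts
  obtain ⟨b, hb⟩ := mem_iUnion.1 (hcov (IsLipschitzTube.mk_mem_lateral
    (h.partition.subdomain 0) (h.mem_Icc ht')
    (h.partition.interface_subset_frontier 0 (h.mem_Icc ht') hx)))
  have hud := fun i => h.uniqueDiffWithinAt_closedTube (hc b) i hq hb (hQ i)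
  have hgrad : ∀ i, |⟪spaceGrad (closedTube T (U i)) (u i) (t, x), n⟫_ℝ -
      ⟪spaceGrad (closedTube T (U i)) (v i) (t, x), n⟫_ℝ| ≤ 2 * K := by
    intro i
    have h1 : ∀ w : ℝ × Space d → ℝ, c2Norm (closedTube T (U i)) w ≤ K →
        |⟪spaceGrad (closedTube T (U i)) w (t, x), n⟫_ℝ| ≤ K := by
      intro w hw
      refine (abs_real_inner_le_norm _ _).trans ?_
      rw [hn.1, mul_one]
      refine (norm_spacePart_le _).trans ?_
      rw [← norm_iteratedFDerivWithin_one _ (hud i)]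
      exact abs_le_of_c2Norm_le hw (by norm_num) (hQ i)
    refine (abs_sub _ _).trans ?_
    linarith [h1 _ (h.norm_u i), h1 _ (h.norm_v i)]
  have hjump : |jumpResidual D v (t, x)| ≤ 4 * K := by
    have h1 := h.solution.jump t ht' x hx
    have h2 : jumpResidual D v (t, x) = err u v 1 (t, x) - err u v 0 (t, x) := by
      simp only [jumpResidual, err] at h1 ⊢
      linarith
    rw [h2]
    refine (abs_sub _ _).trans ?_
    linarith [h.abs_err_le (hQ 0), h.abs_err_le (hQ 1)]
  have hflux : |fluxResidual T U β D v (t, x)| ≤ (β 0 + β 1) * (2 * K) := by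
    have h1 := h.solution.flux t ht' x hx n hn
    rw [fluxResidual, hn.outerNormal_eq, ← h1]
    simp only [fluxJump]
    have e : ∀ a a' b b' : ℝ, β 0 * a' - β 1 * b' - (β 0 * a - β 1 * b) =
        β 1 * (b - b') - β 0 * (a - a') := fun a a' b b' => by ring
    rw [e]
    refine (abs_sub _ _).trans ?_
    rw [abs_mul, abs_mul, abs_of_pos (h.coeff_pos 0), abs_of_pos (h.coeff_pos 1)]
    have h2 := mul_le_mul_of_nonneg_left (hgrad 0) (h.coeff_pos 0).le
    have h3 := mul_le_mul_of_nonneg_left (hgrad 1) (h.coeff_pos 1).le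
    linarith
  rw [interfaceSq, ← sq_abs, ← sq_abs (fluxResidual T U β D v (t, x))]
  gcongr

/-- The flux residual is bounded at points with a unit normal only, and these are almost all points
of the interface. -/
lemma interface_ne_top (h : Comparison T₀ T Ω U β D u v K) (hs : SliceBound T₀ U s) :
    stIntegral T (surface d) (interface Ω U) (interfaceSq T U β D v) ≠ ∞ := by
  refine ne_top_of_le_ne_top ?_ (stIntegral_le (s := s)
    (C := (4 * K) ^ 2 + ((β 0 + β 1) * (2 * K)) ^ 2)
    (fun t ht => h.surface_interface_le hs ht) fun t ht => ?_)
  · exact ENNReal.mul_ne_top (ENNReal.mul_ne_top ENNReal.ofReal_ne_top ENNReal.coe_ne_top)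
      ENNReal.ofReal_ne_top
  · have ht' : t ∈ Icc 0 T₀ := h.mem_Icc ⟨ht.1.le, ht.2.le⟩
    have h1 := (h.partition.subdomain 0).ae_exists_isOuterNormal ht'
    have h2 := ae_mono (Measure.restrict_mono (h.partition.interface_subset_frontier 0 ht')
      le_rfl) h1
    filter_upwards [h2, ae_restrict_mem (h.partition.measurableSet_interface ht')] with x hx hxΓ
    obtain ⟨n, hn⟩ := hx
    exact h.interfaceSq_le ht hxΓ hn

/-- The squared residuals, integrated over space-time. -/
def _root_.ParabolicInterface.residualIntegral (T : ℝ) (Ω : ℝ → Set (Space d))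
    (U : Fin 2 → ℝ → Set (Space d)) (β : Fin 2 → ℝ) (D : ProblemData d)
    (v : Fin 2 → ℝ × Space d → ℝ) : ℝ :=
  ∑ i, interiorIntegral T U β D v i + ∑ i, boundaryIntegral T Ω U D v i +
    interfaceIntegral T Ω U β D v

/-- Arithmetic and geometric mean of a residual and a weight. -/
lemma _root_.ParabolicInterface.abs_le_add_sq_div (r : ℝ) {l : ℝ} (hl : 0 < l) :
    |r| ≤ l + r ^ 2 / l := by
  rw [← sub_le_iff_le_add', le_div_iff₀ hl]
  rw [← sq_abs r]
  nlinarith [sq_nonneg (|r| - l), abs_nonneg r, mul_nonneg (abs_nonneg r) hl.le]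

/-- The residual enters linearly and is traded for its square by `abs_le_add_sq_div`; the price is
the weight `l` times the measure of the tube. -/
lemma interiorTerm_le (h : Comparison T₀ T Ω U β D u v K) (hs : SliceBound T₀ U s) (i : Fin 2)
    (hl : 0 < l) :
    ∫⁻ p in innerTube T (U i), ENNReal.ofReal (4 * K * T * |interiorResidual T U β D v i p|) ≤
      ENNReal.ofReal (4 * K * T * (l * s * T + interiorIntegral T U β D v i / l)) := by
  have hT := h.pos.le
  have hI : 0 ≤ interiorIntegral T U β D v i := ENNReal.toReal_nonneg
  calc _ ≤ ∫⁻ t in Icc 0 T, ∫⁻ x in U i t, ENNReal.ofReal (4 * K * T) *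
        ENNReal.ofReal (l + interiorResidual T U β D v i (t, x) ^ 2 / l) := by
        refine (h.lintegral_innerTube_le i _).trans (lintegral_mono fun t => lintegral_mono fun x => ?_)
        rw [← ENNReal.ofReal_mul (by positivity)]
        refine ENNReal.ofReal_le_ofReal (mul_le_mul_of_nonneg_left ?_ (by positivity))
        exact abs_le_add_sq_div _ hl
    _ = ENNReal.ofReal (4 * K * T) * ∫⁻ t in Icc 0 T, ∫⁻ x in U i t,
        ENNReal.ofReal (l + interiorResidual T U β D v i (t, x) ^ 2 / l) := by
        simp_rw [lintegral_const_mul' _ _ ENNReal.ofReal_ne_top]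
    _ ≤ ENNReal.ofReal (4 * K * T) * ENNReal.ofReal (l * s * T + interiorIntegral T U β D v i / l) := by
        gcongr
        exact (lintegral_add_div_le (fun t ht => hs.volume_le i t (h.mem_Icc ht))
          (fun p => interiorResidual T U β D v i p ^ 2) hl).trans_eq
          (ofReal_add_div_eq hl hT (h.interior_ne_top hs i)).symm
    _ = _ := (ENNReal.ofReal_mul (by positivity)).symm

lemma boundaryTerm_le (h : Comparison T₀ T Ω U β D u v K) (hs : SliceBound T₀ U s) (i : Fin 2)
    (hl : 0 < l) {B : ℝ} (hB : 0 ≤ B) :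
    ∫⁻ t in Icc 0 T, ∫⁻ x in outerBoundary Ω U i t,
        ENNReal.ofReal (B * |err u v i (t, x)|) ∂surface d ≤
      ENNReal.ofReal (B * (l * s * T + boundaryIntegral T Ω U D v i / l)) := by
  have hT := h.pos.le
  have hI : 0 ≤ boundaryIntegral T Ω U D v i := ENNReal.toReal_nonneg
  calc _ ≤ ∫⁻ t in Icc 0 T, ∫⁻ x in outerBoundary Ω U i t, ENNReal.ofReal B *
        ENNReal.ofReal (l + boundaryResidual D v i (t, x) ^ 2 / l) ∂surface d := by
        refine setLIntegral_mono' measurableSet_Icc fun t ht => setLIntegral_mono'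
          (h.partition.measurableSet_outerBoundary i (h.mem_Icc ht)) fun x hx => ?_
        rw [← ENNReal.ofReal_mul hB, h.boundaryResidual_eq ht hx, neg_sq]
        exact ENNReal.ofReal_le_ofReal (mul_le_mul_of_nonneg_left (abs_le_add_sq_div _ hl) hB)
    _ = ENNReal.ofReal B * ∫⁻ t in Icc 0 T, ∫⁻ x in outerBoundary Ω U i t,
        ENNReal.ofReal (l + boundaryResidual D v i (t, x) ^ 2 / l) ∂surface d := by
        simp_rw [lintegral_const_mul' _ _ ENNReal.ofReal_ne_top]
    _ ≤ ENNReal.ofReal B * ENNReal.ofReal (l * s * T + boundaryIntegral T Ω U D v i / l) := by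
        gcongr
        exact (lintegral_add_div_le (fun t ht => h.surface_outerBoundary_le hs i ht)
          (fun p => boundaryResidual D v i p ^ 2) hl).trans_eq
          (ofReal_add_div_eq hl hT (h.boundary_ne_top hs i)).symm
    _ = _ := (ENNReal.ofReal_mul hB).symm

lemma interfaceBound_le (h : Comparison T₀ T Ω U β D u v K) (hs : SliceBound T₀ U s) (hl : 0 < l) :
    interfaceBound T Ω U β D v l ≤
      ENNReal.ofReal (l * s * T + interfaceIntegral T Ω U β D v / l) :=
  (lintegral_add_div_le (fun _ ht => h.surface_interface_le hs ht)
    (interfaceSq T U β D v) hl).trans_eq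
    (ofReal_add_div_eq hl h.pos.le (h.interface_ne_top hs)).symm

/-- The initial error is already squared, so no weight is spent on it; this is why its exponent is
`1`. -/
lemma initialTerm_eq (h : Comparison T₀ T Ω U β D u v K) (hs : SliceBound T₀ U s) (i : Fin 2) :
    ∫⁻ x in U i 0, ENNReal.ofReal (err u v i (0, x) ^ 2) =
      ENNReal.ofReal (initialIntegral U D v i) := by
  rw [initialIntegral, ENNReal.ofReal_toReal (h.initial_ne_top hs i)]
  refine setLIntegral_congr_fun (h.measurableSet_slice i ⟨le_rfl, h.pos.le⟩) fun x hx => ?_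
  simp only [h.initialResidual_eq hx, neg_sq]

end Comparison

/-! ### Optimization of the weight and quadrature -/

/-- The best choice of the weight `l`. -/
lemma le_ofReal_of_forall_weight {Y : ℝ≥0∞} {a b s T R : ℝ} (hT : 0 < T) (hR : 0 ≤ R)
    (h : ∀ l > 0, Y ≤ ENNReal.ofReal (a + b * (l * s * T + R / l))) :
    Y ≤ ENNReal.ofReal (a + b * ((s + 1) * (√T * √R))) := by
  -- For `R = 0` the optimal weight would be zero, so `l` is sent to `0` instead.
  rcases hR.eq_or_lt with rfl | hR
  · have h1 : Tendsto (fun l : ℝ => ENNReal.ofReal (a + b * (l * s * T))) (𝓝[>] 0)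
        (𝓝 (ENNReal.ofReal (a + b * (0 * s * T)))) := by
      have : Continuous fun l : ℝ => ENNReal.ofReal (a + b * (l * s * T)) :=
        ENNReal.continuous_ofReal.comp (by fun_prop)
      exact (this.tendsto 0).mono_left nhdsWithin_le_nhds
    have h2 := ge_of_tendsto h1 (eventually_mem_nhdsWithin.mono fun l hl => by
      simpa using h l hl)
    simpa using h2
  · have hsT := Real.sqrt_pos.2 hT
    have hsR := Real.sqrt_pos.2 hR
    -- This weight balances `l * T` against `R / l`: both become `√T * √R`.
    refine (h (√R / √T) (by positivity)).trans_eq ?_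
    have e1 : √T * √T = T := Real.mul_self_sqrt hT.le
    have e2 : √R * √R = R := Real.mul_self_sqrt hR.le
    have e3 : √R / √T * s * T = s * (√T * √R) := by
      rw [div_mul_eq_mul_div, div_mul_eq_mul_div, div_eq_iff hsT.ne']
      linear_combination (-(√R * s)) * e1
    have e4 : R / (√R / √T) = √T * √R := by
      rw [div_div_eq_mul_div, div_eq_iff hsR.ne']
      linear_combination (-√T) * e2
    rw [e3, e4, add_mul, one_mul]

lemma sampleMean_nonneg {X : Type*} {M : ℕ} (y : Fin M → X) {g : X → ℝ} (hg : ∀ x, 0 ≤ g x) :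
    0 ≤ sampleMean y g :=
  mul_nonneg (by positivity) (Finset.sum_nonneg fun _ _ => hg _)

/-- The quadrature error term dominates an absolute value and is therefore nonnegative, so it may be
multiplied by `A ≥ 1`. -/
lemma HasQuadratureError.le {I V F C α A : ℝ} {M : ℕ} (h : HasQuadratureError I V F M C α)
    (hF : 0 ≤ F) (hV : V ≤ A) (hA : 1 ≤ A) : I ≤ A * (F + C * (M : ℝ) ^ (-α)) := by
  have h1 := (le_abs_self _).trans h.2
  have h2 := (abs_nonneg _).trans h.2
  nlinarith [mul_le_mul_of_nonneg_right hV hF, mul_le_mul_of_nonneg_right hA h2]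

lemma stIntegral_one_le {T : ℝ} {m : Measure (Space d)} {S : ℝ → Set (Space d)} {s : ℝ≥0}
    (hT : 0 ≤ T) (hs : ∀ t ∈ Icc 0 T, m (S t) ≤ s) :
    (stIntegral T m S fun _ => 1).toReal ≤ s * T := by
  refine ENNReal.toReal_le_of_le_ofReal (by positivity) ?_
  refine (stIntegral_le hs (C := 1) fun t _ => ae_of_all _ fun x => le_rfl).trans_eq ?_
  rw [ENNReal.ofReal_one, one_mul, ENNReal.ofReal_mul s.coe_nonneg, ENNReal.ofReal_coe_nnreal]

/-- The constant of the energy estimate, for given charts of the first subdomain and of the whole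
domain. -/
def energyConstant {m m' : ℕ} (c : Fin m → GraphChart d) (c' : Fin m' → GraphChart d)
    (β : Fin 2 → ℝ) (K : ℝ≥0) : ℝ :=
  ∑ b, 4 * K * (c b).heightLip * (2 + β 0) +
    ∑ i, (4 * K + (∑ b, 2 * ((c' b).heightLip : ℝ)) * ((1 + 2 * β i) * (2 * K))) + 1

namespace Comparison

variable {T₀ T : ℝ} {Ω : ℝ → Set (Space d)} {U : Fin 2 → ℝ → Set (Space d)} {β : Fin 2 → ℝ}
  {D : ProblemData d} {u v : Fin 2 → ℝ × Space d → ℝ} {K s : ℝ≥0} {l : ℝ}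

lemma residualIntegral_nonneg : 0 ≤ residualIntegral T Ω U β D v :=
  add_nonneg (add_nonneg (Finset.sum_nonneg fun _ _ => ENNReal.toReal_nonneg)
    (Finset.sum_nonneg fun _ _ => ENNReal.toReal_nonneg)) ENNReal.toReal_nonneg

/-- The stability estimate with a weight `l`. -/
lemma stability_weighted (h : Comparison T₀ T Ω U β D u v K) (hd : 1 ≤ d) (hs : SliceBound T₀ U s)
    {m : ℕ} {c : Fin m → GraphChart d} {N : Fin m → Set (ℝ × Space d)}
    (hc : ∀ b, (c b).Describes T₀ (U 0) (N b)) (hcov : lateral T₀ (U 0) ⊆ ⋃ b, N b)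
    {m' : ℕ} {c' : Fin m' → GraphChart d} {N' : Fin m' → Set (ℝ × Space d)}
    (hc' : ∀ b, (c' b).Describes T₀ Ω (N' b)) (hcov' : lateral T₀ Ω ⊆ ⋃ b, N' b) (hl : 0 < l) :
    ∑ i, stIntegral T volume (U i) (fun p => err u v i p ^ 2) ≤
      ENNReal.ofReal (energyConstant c c' β K * T * ∑ i, initialIntegral U D v i +
        energyConstant c c' β K * T * (l * s * T + residualIntegral T Ω U β D v / l)) := by
  have hT := h.pos.le
  have hβ := fun i => (h.coeff_pos i).le
  have hβ0 := hβ 0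
  have hE : ∀ i, 0 ≤ initialIntegral U D v i := fun i => ENNReal.toReal_nonneg
  have hI : ∀ i, 0 ≤ interiorIntegral T U β D v i / l := fun i =>
    div_nonneg ENNReal.toReal_nonneg hl.le
  have hB : ∀ i, 0 ≤ boundaryIntegral T Ω U D v i / l := fun i =>
    div_nonneg ENNReal.toReal_nonneg hl.le
  have hΓ : 0 ≤ interfaceIntegral T Ω U β D v / l := div_nonneg ENNReal.toReal_nonneg hl.le
  set a : ℝ := ∑ b, 4 * K * (c b).heightLip * (2 + β 0) with ha
  set H : ℝ := ∑ b, 2 * ((c' b).heightLip : ℝ) with hH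
  set y : ℝ := l * s * T with hy
  have hy0 : 0 ≤ y := by positivity
  have ha0 : 0 ≤ a := Finset.sum_nonneg fun b _ => by positivity
  have hH0 : 0 ≤ H := Finset.sum_nonneg fun b _ => by positivity
  have hq : ∀ i, 0 ≤ (1 + 2 * β i) * (2 * (K : ℝ)) := fun i => by
    have := hβ i
    positivity
  calc ∑ i, stIntegral T volume (U i) (fun p => err u v i p ^ 2)
      ≤ ENNReal.ofReal (∑ i, ∫ p in innerTube T (U i), err u v i p ^ 2) := by
        rw [ENNReal.ofReal_sum_of_nonneg fun i _ => integral_nonneg fun p => sq_nonneg _]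
        exact Finset.sum_le_sum fun i _ => h.stIntegral_sq_le i
    _ ≤ _ := h.energy_estimate hd hc hcov hc' hcov' hl
    _ ≤ ENNReal.ofReal (T * a) * ENNReal.ofReal (y + interfaceIntegral T Ω U β D v / l) +
        ∑ i, (ENNReal.ofReal (4 * K * T * (y + interiorIntegral T U β D v i / l)) +
          ENNReal.ofReal T * ENNReal.ofReal (initialIntegral U D v i) +
          ENNReal.ofReal H * ENNReal.ofReal (T * ((1 + 2 * β i) * (2 * K)) *
            (y + boundaryIntegral T Ω U D v i / l))) := by
        rw [← ENNReal.ofReal_sum_of_nonneg fun b _ => by positivity, ← Finset.mul_sum,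
          ← ENNReal.ofReal_sum_of_nonneg fun b _ => by positivity]
        gcongr with i
        · exact h.interfaceBound_le hs hl
        · exact h.interiorTerm_le hs i hl
        · exact (h.initialTerm_eq hs i).le
        · exact h.boundaryTerm_le hs i hl (mul_nonneg hT (hq i))
    _ = ENNReal.ofReal (T * a * (y + interfaceIntegral T Ω U β D v / l) +
        ∑ i, (4 * K * T * (y + interiorIntegral T U β D v i / l) +
          T * initialIntegral U D v i +
          H * (T * ((1 + 2 * β i) * (2 * K)) * (y + boundaryIntegral T Ω U D v i / l)))) := by
        have n1 : ∀ i, 0 ≤ 4 * K * T * (y + interiorIntegral T U β D v i / l) := fun i =>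
          mul_nonneg (by positivity) (add_nonneg hy0 (hI i))
        have n2 : ∀ i, 0 ≤ T * initialIntegral U D v i := fun i => mul_nonneg hT (hE i)
        have n3 : ∀ i, 0 ≤ H * (T * ((1 + 2 * β i) * (2 * K)) *
            (y + boundaryIntegral T Ω U D v i / l)) := fun i =>
          mul_nonneg hH0 (mul_nonneg (mul_nonneg hT (hq i)) (add_nonneg hy0 (hB i)))
        rw [ENNReal.ofReal_add (mul_nonneg (mul_nonneg hT ha0) (add_nonneg hy0 hΓ))
          (Finset.sum_nonneg fun i _ => add_nonneg (add_nonneg (n1 i) (n2 i)) (n3 i)),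
          ENNReal.ofReal_mul (mul_nonneg hT ha0), ENNReal.ofReal_sum_of_nonneg fun i _ =>
            add_nonneg (add_nonneg (n1 i) (n2 i)) (n3 i)]
        congr 1
        refine Finset.sum_congr rfl fun i _ => ?_
        rw [ENNReal.ofReal_add (add_nonneg (n1 i) (n2 i)) (n3 i), ENNReal.ofReal_add (n1 i) (n2 i),
          ENNReal.ofReal_mul hT, ENNReal.ofReal_mul hH0]
    _ ≤ _ := by
        refine ENNReal.ofReal_le_ofReal ?_
        have hR : residualIntegral T Ω U β D v / l =
            interiorIntegral T U β D v 0 / l + interiorIntegral T U β D v 1 / l +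
            (boundaryIntegral T Ω U D v 0 / l + boundaryIntegral T Ω U D v 1 / l) +
            interfaceIntegral T Ω U β D v / l := by
          rw [residualIntegral, Fin.sum_univ_two, Fin.sum_univ_two]
          ring
        have hA : energyConstant c c' β K = a + (4 * K + H * ((1 + 2 * β 0) * (2 * K)) +
            (4 * K + H * ((1 + 2 * β 1) * (2 * K)))) + 1 := by
          rw [energyConstant, Fin.sum_univ_two]
        have q0 := mul_nonneg hH0 (hq 0)
        have q1 := mul_nonneg hH0 (hq 1)
        have hK0 : (0 : ℝ) ≤ 4 * K := by positivity
        rw [Fin.sum_univ_two, Fin.sum_univ_two, hR]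
        set A := energyConstant c c' β K
        set k : ℝ := 4 * K
        set x0 := H * ((1 + 2 * β 0) * (2 * K))
        set x1 := H * ((1 + 2 * β 1) * (2 * K))
        -- `A` exceeds the sum of all coefficients, since the weight term `y` occurs once with each
        -- of them; the extra `1` in `A` serves the initial integrals.
        have e := mul_le_mul_of_nonneg_right (show a ≤ A by linarith) hΓ
        have e0 := mul_le_mul_of_nonneg_right (show k ≤ A by linarith) (hI 0)
        have e1 := mul_le_mul_of_nonneg_right (show k ≤ A by linarith) (hI 1)
        have e2 := mul_le_mul_of_nonneg_right (show x0 ≤ A by linarith) (hB 0)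
        have e3 := mul_le_mul_of_nonneg_right (show x1 ≤ A by linarith) (hB 1)
        have e4 := mul_le_mul_of_nonneg_right (show 1 ≤ A by linarith) (hE 0)
        have e5 := mul_le_mul_of_nonneg_right (show 1 ≤ A by linarith) (hE 1)
        have e6 := mul_le_mul_of_nonneg_right
          (show a + k + k + x0 + x1 ≤ A by linarith) hy0
        have key : a * (y + interfaceIntegral T Ω U β D v / l) +
            (k * (y + interiorIntegral T U β D v 0 / l) + initialIntegral U D v 0 +
              x0 * (y + boundaryIntegral T Ω U D v 0 / l) +
            (k * (y + interiorIntegral T U β D v 1 / l) + initialIntegral U D v 1 +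
              x1 * (y + boundaryIntegral T Ω U D v 1 / l))) ≤
            A * (initialIntegral U D v 0 + initialIntegral U D v 1) +
            A * (y + (interiorIntegral T U β D v 0 / l + interiorIntegral T U β D v 1 / l +
            (boundaryIntegral T Ω U D v 0 / l + boundaryIntegral T Ω U D v 1 / l) +
            interfaceIntegral T Ω U β D v / l)) := by linarith
        have := mul_le_mul_of_nonneg_left key hT
        simp only [x0, x1] at this
        linarith

/-- The stability estimate. -/
lemma stability (h : Comparison T₀ T Ω U β D u v K) (hd : 1 ≤ d) (hs : SliceBound T₀ U s)
    {m : ℕ} {c : Fin m → GraphChart d} {N : Fin m → Set (ℝ × Space d)}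
    (hc : ∀ b, (c b).Describes T₀ (U 0) (N b)) (hcov : lateral T₀ (U 0) ⊆ ⋃ b, N b)
    {m' : ℕ} {c' : Fin m' → GraphChart d} {N' : Fin m' → Set (ℝ × Space d)}
    (hc' : ∀ b, (c' b).Describes T₀ Ω (N' b)) (hcov' : lateral T₀ Ω ⊆ ⋃ b, N' b) :
    ∑ i, stIntegral T volume (U i) (fun p => err u v i p ^ 2) ≤
      ENNReal.ofReal (energyConstant c c' β K * ((s + 1) * (T₀ + 1)) *
        (T * ∑ i, initialIntegral U D v i + √T * √(residualIntegral T Ω U β D v))) := by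
  have hT := h.pos.le
  have hβ := fun i => (h.coeff_pos i).le
  have hA : 0 ≤ energyConstant c c' β K := by
    have h0 := hβ 0
    have h1 := hβ 1
    rw [energyConstant, Fin.sum_univ_two]
    positivity
  have hE : 0 ≤ ∑ i, initialIntegral U D v i :=
    Finset.sum_nonneg fun i _ => ENNReal.toReal_nonneg
  refine (le_ofReal_of_forall_weight h.pos residualIntegral_nonneg
    fun l hl => h.stability_weighted hd hs hc hcov hc' hcov' hl).trans (ENNReal.ofReal_le_ofReal ?_)
  set A := energyConstant c c' β K
  set E := ∑ i, initialIntegral U D v i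
  set R := √T * √(residualIntegral T Ω U β D v)
  have hR : 0 ≤ R := by positivity
  have hT₀ : T ≤ T₀ + 1 := by linarith [h.le]
  have hsT : 1 ≤ ((s : ℝ) + 1) * (T₀ + 1) := by
    have := s.coe_nonneg
    nlinarith [h.le]
  -- The residual part carries a surplus factor `T`, which is absorbed into `T₀ + 1`; the initial
  -- part keeps its `T`.
  have e1 : A * T * E * 1 ≤ A * T * E * (((s : ℝ) + 1) * (T₀ + 1)) := by gcongr
  have e2 : A * ((s + 1) * R) * T ≤ A * ((s + 1) * R) * (T₀ + 1) := by gcongr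
  linarith

end Comparison

/-- The loss together with the quadrature errors bounds the residual integrals. -/
lemma QuadratureAssumption.le {T₀ T : ℝ} {Ω : ℝ → Set (Space d)} {U : Fin 2 → ℝ → Set (Space d)}
    {β : Fin 2 → ℝ} {D : ProblemData d} {u v : Fin 2 → ℝ × Space d → ℝ} {K s : ℝ≥0}
    {S : Sampling T Ω U} {q : QuadratureRates} (hq : QuadratureAssumption S β D v q)
    (h : Comparison T₀ T Ω U β D u v K) (hs : SliceBound T₀ U s) {A : ℝ} (hA1 : 1 ≤ A)
    (hAs : s ≤ A) (hAT : s * T₀ ≤ A) :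
    ∑ i, initialIntegral U D v i ≤
        A * (∑ i, initialLoss S D v i + ∑ i, q.CT i * (S.MT i : ℝ) ^ (-q.αT i)) ∧
      residualIntegral T Ω U β D v ≤ A * (∑ i, interiorLoss S β D v i + ∑ i, boundaryLoss S D v i +
        interfaceLoss S β D v + ∑ i, q.C i * (S.M i : ℝ) ^ (-q.α i) +
        ∑ i, q.CB i * (S.MB i : ℝ) ^ (-q.αB i) + q.CΓ * (S.MΓ : ℝ) ^ (-q.αΓ)) := by
  have hT := h.pos.le
  have hsT : s * T ≤ A := (mul_le_mul_of_nonneg_left h.le s.coe_nonneg).trans hAT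
  have hI := fun i => (hq.interior i).le (sampleMean_nonneg _ fun _ => sq_nonneg _)
    ((stIntegral_one_le hT fun t ht => hs.volume_le i t (h.mem_Icc ht)).trans hsT) hA1
  have hB := fun i => (hq.boundary i).le (sampleMean_nonneg _ fun _ => sq_nonneg _)
    ((stIntegral_one_le hT fun t ht => h.surface_outerBoundary_le hs i ht).trans hsT) hA1
  have hΓ := hq.onInterface.le (sampleMean_nonneg _ fun _ => add_nonneg (sq_nonneg _) (sq_nonneg _))
    ((stIntegral_one_le hT fun t ht => h.surface_interface_le hs ht).trans hsT) hA1
  have hE := fun i => (hq.initial i).le (sampleMean_nonneg _ fun _ => sq_nonneg _)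
    ((ENNReal.toReal_le_coe_of_le_coe
      (hs.volume_le i 0 (h.mem_Icc ⟨le_rfl, hT⟩))).trans hAs) hA1
  refine ⟨?_, ?_⟩
  · rw [← Finset.sum_add_distrib, Finset.mul_sum]
    exact Finset.sum_le_sum fun i _ => hE i
  · have h1 := Finset.sum_le_sum fun i (_ : i ∈ Finset.univ) => hI i
    have h2 := Finset.sum_le_sum fun i (_ : i ∈ Finset.univ) => hB i
    rw [← Finset.mul_sum, Finset.sum_add_distrib] at h1 h2
    rw [residualIntegral]
    linarith

end ParabolicInterface

end

/-! ### The stability estimate and the error bound -/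

theorem mainTheorem1 {d : ℕ} (hd : 2 ≤ d) {T₀ : ℝ} (hT₀ : 0 < T₀)
    (Ω : ℝ → Set (ParabolicInterface.Space d))
    (U : Fin 2 → ℝ → Set (ParabolicInterface.Space d))
    (hU : ParabolicInterface.IsMovingPartition T₀ Ω U)
    (β : Fin 2 → ℝ) (hβ : ∀ i, 0 < β i) (K : ℝ≥0) :
    ∃ C₁ C₂ : ℝ, 0 < C₁ ∧ 0 < C₂ ∧
      ∀ T : ℝ, 0 < T → T ≤ T₀ →
      ∀ (D : ParabolicInterface.ProblemData d)
        (u v : Fin 2 → ℝ × ParabolicInterface.Space d → ℝ),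
        ParabolicInterface.IsClassicalSolution T Ω U β D u →
        ParabolicInterface.IsC2 T U v →
        (∀ i, ParabolicInterface.c2Norm (ParabolicInterface.closedTube T (U i)) (u i) ≤ K) →
        (∀ i, ParabolicInterface.c2Norm (ParabolicInterface.closedTube T (U i)) (v i) ≤ K) →
        -- the stability estimate, in terms of the integrals of the squared residuals
        (∑ i, ParabolicInterface.stIntegral T volume (U i) (fun p => (u i p - v i p) ^ 2) ≤
          ENNReal.ofReal
            (C₁ * T * (1 + C₂ * T * Real.exp (C₂ * T)) *
                (∑ i, ParabolicInterface.initialIntegral U D v i) +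
              C₁ * T ^ (1 / 2 : ℝ) * (1 + C₂ * T * Real.exp (C₂ * T)) *
                (∑ i, ParabolicInterface.interiorIntegral T U β D v i +
                  ∑ i, ParabolicInterface.boundaryIntegral T Ω U D v i +
                  ParabolicInterface.interfaceIntegral T Ω U β D v) ^ (1 / 2 : ℝ))) ∧
        -- the error bound, in terms of the losses and the quadrature errors
        ∀ (s : ParabolicInterface.Sampling T Ω U) (q : ParabolicInterface.QuadratureRates),
          ParabolicInterface.QuadratureAssumption s β D v q →
          ∑ i, ParabolicInterface.stIntegral T volume (U i) (fun p => (u i p - v i p) ^ 2) ≤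
            ENNReal.ofReal
              (C₁ * T * (1 + C₂ * T * Real.exp (C₂ * T)) *
                  (∑ i, ParabolicInterface.initialLoss s D v i +
                    ∑ i, q.CT i * (s.MT i : ℝ) ^ (-q.αT i)) +
                C₁ * T ^ (1 / 2 : ℝ) * (1 + C₂ * T * Real.exp (C₂ * T)) *
                  (∑ i, ParabolicInterface.interiorLoss s β D v i +
                    ∑ i, ParabolicInterface.boundaryLoss s D v i +
                    ParabolicInterface.interfaceLoss s β D v +
                    ∑ i, q.C i * (s.M i : ℝ) ^ (-q.α i) +
                    ∑ i, q.CB i * (s.MB i : ℝ) ^ (-q.αB i) +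
                    q.CΓ * (s.MΓ : ℝ) ^ (-q.αΓ)) ^ (1 / 2 : ℝ)) := by
  have hd1 : 1 ≤ d := by omega
  obtain ⟨s, hs⟩ := hU.exists_sliceBound
  obtain ⟨m, c, N, hc, hcov⟩ := (hU.subdomain 0).exists_charts
  obtain ⟨m', c', N', hc', hcov'⟩ := hU.domain.exists_charts
  set A : ℝ := ParabolicInterface.energyConstant c c' β K * ((s + 1) * (T₀ + 1)) with hA
  -- Large enough to dominate `1`, the slice bound `s` and the space-time bound `s * T₀`, as the
  -- quadrature step requires.
  set B : ℝ := s * (T₀ + 1) + 1 with hB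
  have hA0 : 0 < A := by
    have h0 := hβ 0
    have h1 := hβ 1
    rw [hA, ParabolicInterface.energyConstant, Fin.sum_univ_two]
    positivity
  have hsT : 0 ≤ s * T₀ := mul_nonneg s.coe_nonneg hT₀.le
  have hs0 : (0 : ℝ) ≤ s := s.coe_nonneg
  have hB1 : 1 ≤ B := by linarith
  -- Any positive `C₂` would do, because the exponential factor is only used to be at least `1`.
  refine ⟨A * B, 1, by positivity, one_pos, fun T hT hTT₀ D u v hu hv hnu hnv => ?_⟩
  have h : ParabolicInterface.Comparison T₀ T Ω U β D u v K :=
    ⟨hU, hT, hTT₀, hβ, hu, hv, hnu, hnv⟩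
  have hst := h.stability hd1 hs hc hcov hc' hcov'
  have hF : 1 ≤ 1 + 1 * T * Real.exp (1 * T) := by
    have := Real.exp_pos (1 * T)
    have : 0 ≤ 1 * T * Real.exp (1 * T) := by positivity
    linarith
  set F : ℝ := 1 + 1 * T * Real.exp (1 * T)
  have hE0 : 0 ≤ ∑ i, ParabolicInterface.initialIntegral U D v i :=
    Finset.sum_nonneg fun i _ => ENNReal.toReal_nonneg
  have hR0 : 0 ≤ ParabolicInterface.residualIntegral T Ω U β D v :=
    ParabolicInterface.Comparison.residualIntegral_nonneg
  have key : ∀ E R : ℝ, 0 ≤ E → 0 ≤ R →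
      ∑ i, ParabolicInterface.initialIntegral U D v i ≤ B * E →
      ParabolicInterface.residualIntegral T Ω U β D v ≤ B * R →
      ∑ i, ParabolicInterface.stIntegral T volume (U i) (fun p => (u i p - v i p) ^ 2) ≤
        ENNReal.ofReal (A * B * T * F * E + A * B * T ^ (1 / 2 : ℝ) * F * R ^ (1 / 2 : ℝ)) := by
    intro E R hE hR hEB hRB
    refine hst.trans (ENNReal.ofReal_le_ofReal ?_)
    rw [← Real.sqrt_eq_rpow, ← Real.sqrt_eq_rpow]
    -- Since `B ≥ 1`, its square root is at most `B`, so one constant serves both terms.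
    have h1 : √(ParabolicInterface.residualIntegral T Ω U β D v) ≤ B * √R := by
      refine (Real.sqrt_le_sqrt hRB).trans ?_
      rw [Real.sqrt_mul (by linarith)]
      refine mul_le_mul_of_nonneg_right ?_ (Real.sqrt_nonneg _)
      rw [Real.sqrt_le_left (by linarith)]
      nlinarith
    calc A * (T * ∑ i, ParabolicInterface.initialIntegral U D v i +
          √T * √(ParabolicInterface.residualIntegral T Ω U β D v))
        ≤ A * (T * (B * E) + √T * (B * √R)) * 1 := by
          rw [mul_one]
          gcongr
      _ ≤ A * (T * (B * E) + √T * (B * √R)) * F := by gcongr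
      _ = _ := by ring
  refine ⟨?_, fun S q hq => ?_⟩
  · exact key _ _ hE0 hR0 (le_mul_of_one_le_left hE0 hB1) (le_mul_of_one_le_left hR0 hB1)
  · obtain ⟨h1, h2⟩ := hq.le h hs hB1 (by linarith) (by linarith)
    -- The brackets of losses and quadrature errors are not nonnegative by their form, as the
    -- quadrature constants are arbitrary reals. They are so because `B` times each dominates a
    -- nonnegative integral.
    have hpos : 0 < B := by linarith
    exact key _ _ (nonneg_of_mul_nonneg_right (hE0.trans h1) hpos)
      (nonneg_of_mul_nonneg_right (hR0.trans h2) hpos) h1 h2
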